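/- \textbf{Setting.} Let $\Pi=[x_L,x_R]\times[y_L,y_R]$ with $x_L<x_R$, $y_L<y_R$, let $T>0$, $1<\alpha,\mu\le 2$, $0<\beta,\nu<1$, $d_\alpha,d_\mu>0$, $c_\beta,c_\nu\ge 0$. For a function $g$ on $[a,b]$, $\gamma\in(0,1)\cup(1,2]$ and $n$ the smallest integer greater than $\gamma$, the Riesz derivative at $x\in(a,b)$ is $$\frac{\partial^\gamma g}{\partial|x|^\gamma}(x)=-\frac{1}{2\cos(\pi\gamma/2)}\cdot\frac{1}{\Gamma(n-\gamma)}\Big[\frac{d^n}{dx^n}\int_a^x\frac{g(\xi)\,d\xi}{(x-\xi)^{\gamma-n+1}}+(-1)^n\frac{d^n}{dx^n}\int_x^b\frac{g(\xi)\,d\xi}{(\xi-x)^{\gamma-n+1}}\Big].$$ Let $u$ solve the two-dimensional Riesz space fractional advection-dispersion equation $$\frac{\partial u}{\partial t}=d_\alpha\frac{\partial^\alpha u}{\partial|x|^\alpha}+c_\beta\frac{\partial^\beta u}{\partial|x|^\beta}+d_\mu\frac{\partial^\mu u}{\partial|y|^\mu}+c_\nu\frac{\partial^\nu u}{\partial|y|^\nu}+s(x,y,t)$$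 in the interior of $\Pi$ for $0<t\le T$, with $u(x,y,0)=f(x,y)$ on $\Pi$ and $u=0$ on $\partial\Pi$ for $0<t\le T$, where $s$ is continuous in $t\in[0,T]$ at each interior point of $\Pi$. Assume that the extension $\tilde u$ of $u$ in space by zero outside $\Pi$ is of class $C^7$ on $\mathbb R^2\times[0,T]$. \textbf{Scheme.} For positive integers $m_1,m_2,N$ put $\Delta x=(x_R-x_L)/m_1$, $\Delta y=(y_R-y_L)/m_2$, $\Delta t=T/N$, $x_i=x_L+i\Delta x$, $y_j=y_L+j\Delta y$, $t_n=n\Delta t$. Let $$\omega_k^{(\gamma)}=\frac{(-1)^k\,\Gamma(\gamma+1)}{\Gamma(\frac\gamma2-k+1)\,\Gamma(\frac\gamma2+k+1)},\qquad \varrho_{\pm1}^{(\gamma)}=-\frac{\gamma}{24},\qquad \varrho_0^{(\gamma)}=1+\frac{\gamma}{12}$$ (with $1/\Gamma=0$ at the poles of $\Gamma$), and, for grid functions $v=(v_{i,j})_{i,j\in\mathbb Z}$, $$\mathfrak D_{\gamma,x}v_{i,j}=\Delta x^{-\gamma}\sum_{r=-1}^{1}\varrho_r^{(\gamma)}\sum_{k=i-m_1}^{i}\omega_k^{(\gamma)}v_{i-k-r,j},\qquad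 \mathfrak D_{\gamma,y}v_{i,j}=\Delta y^{-\gamma}\sum_{r=-1}^{1}\varrho_r^{(\gamma)}\sum_{k=j-m_2}^{j}\omega_k^{(\gamma)}v_{i,j-k-r}.$$ With $A_x=d_\alpha\mathfrak D_{\alpha,x}+c_\beta\mathfrak D_{\beta,x}$ and $A_y=d_\mu\mathfrak D_{\mu,y}+c_\nu\mathfrak D_{\nu,y}$, the factorized Crank--Nicolson ADI scheme is $$\big(I+\tfrac{\Delta t}2A_x\big)\big(I+\tfrac{\Delta t}2A_y\big)u^{n+1}_{i,j}=\big(I-\tfrac{\Delta t}2A_x\big)\big(I-\tfrac{\Delta t}2A_y\big)u^{n}_{i,j}+\Delta t\,\frac{s^{n+1}_{i,j}+s^{n}_{i,j}}2$$ for $0\le n<N$, $0<i<m_1$, $0<j<m_2$, with grid functions equal to zero at all nodes that are not interior nodes of $\Pi$. Its truncation error $\tau^n_{i,j}$ along $u$ is the left side minus the right side, divided by $\Delta t$, with $u^n_{i,j}$ replaced by $\tilde u(x_i,y_j,t_n)$ and $s^n_{i,j}=s(x_i,y_j,t_n)$. \textbf{Theorem.} The scheme is consistent: $\max_{n,i,j}|\tau^n_{i,j}|\to0$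 as $\Delta x,\Delta y,\Delta t\to0$ independently. Moreover its truncation error is $O(\Delta x^4)+O(\Delta y^4)+O(\Delta t^2)$: there is a constant $C$, independent of $m_1,m_2,N$, such that $$|\tau^n_{i,j}|\le C\,(\Delta x^4+\Delta y^4+\Delta t^2)$$ for all positive integers $m_1,m_2,N$ and all $0\le n<N$, $0<i<m_1$, $0<j<m_2$. -/

import Mathlib

open Set MeasureTheory

noncomputable section

namespace RSFADE

/-! ### Riemann–Liouville and Riesz derivatives on an interval -/

/-- The smallest integer greater than `γ`, for `γ ≥ 0`. -/
def rlOrder (γ : ℝ) : ℕ := ⌊γ⌋₊ + 1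

/-- Left-sided Riemann–Liouville derivative of order `γ` with base point `a`. -/
def leftRL (γ a : ℝ) (g : ℝ → ℝ) (x : ℝ) : ℝ :=
  1 / Real.Gamma (rlOrder γ - γ) *
    iteratedDeriv (rlOrder γ)
      (fun z => ∫ ξ in a..z, g ξ / (z - ξ) ^ (γ - rlOrder γ + 1)) x

/-- Right-sided Riemann–Liouville derivative of order `γ` with base point `b`. -/
def rightRL (γ b : ℝ) (g : ℝ → ℝ) (x : ℝ) : ℝ :=
  (-1) ^ rlOrder γ / Real.Gamma (rlOrder γ - γ) *
    iteratedDeriv (rlOrder γ)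
      (fun z => ∫ ξ in z..b, g ξ / (ξ - z) ^ (γ - rlOrder γ + 1)) x

/-- Riesz derivative of order `γ` of a function on `[a, b]`, at a point `x` of `(a, b)`. -/
def riesz (γ a b : ℝ) (g : ℝ → ℝ) (x : ℝ) : ℝ :=
  -(1 / (2 * Real.cos (Real.pi * γ / 2))) * (leftRL γ a g x + rightRL γ b g x)

/-! ### The equation -/

/-- Domain, exponents, coefficients, source and initial datum of the two-dimensional
Riesz space fractional advection-dispersion equation. -/
structure Data where
  xL : ℝ
  xR : ℝ
  yL : ℝ
  yR : ℝ
  T : ℝ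
  α : ℝ
  β : ℝ
  μ : ℝ
  ν : ℝ
  dα : ℝ
  cβ : ℝ
  dμ : ℝ
  cν : ℝ
  s : ℝ → ℝ → ℝ → ℝ
  f : ℝ → ℝ → ℝ
  hx : xL < xR
  hy : yL < yR
  hT : 0 < T
  hα : 1 < α ∧ α ≤ 2
  hβ : 0 < β ∧ β < 1
  hμ : 1 < μ ∧ μ ≤ 2
  hν : 0 < ν ∧ ν < 1
  hdα : 0 < dα
  hcβ : 0 ≤ cβ
  hdμ : 0 < dμ
  hcν : 0 ≤ cν

namespace Data

/-- The closed rectangle. -/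
def rect (P : Data) : Set (ℝ × ℝ) := Icc P.xL P.xR ×ˢ Icc P.yL P.yR

/-- The spatial operator of the equation applied to `w` at an interior point `(x, y)`. -/
def spatial (P : Data) (w : ℝ → ℝ → ℝ) (x y : ℝ) : ℝ :=
  P.dα * riesz P.α P.xL P.xR (fun z => w z y) x
    + P.cβ * riesz P.β P.xL P.xR (fun z => w z y) x
    + P.dμ * riesz P.μ P.yL P.yR (fun z => w x z) y
    + P.cν * riesz P.ν P.yL P.yR (fun z => w x z) y

/-- `u` solves the initial-boundary value problem: the equation in the interior of the rectangle
for `0 < t ≤ T` (one-sided time derivative at `t = T`), the initial condition, and the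
homogeneous Dirichlet boundary condition. -/
structure IsSolution (P : Data) (u : ℝ → ℝ → ℝ → ℝ) : Prop where
  eqn : ∀ x ∈ Ioo P.xL P.xR, ∀ y ∈ Ioo P.yL P.yR, ∀ t ∈ Ioc 0 P.T,
    HasDerivWithinAt (fun τ => u x y τ)
      (P.spatial (fun x' y' => u x' y' t) x y + P.s x y t) (Icc 0 P.T) t
  initial : ∀ x y, (x, y) ∈ P.rect → u x y 0 = P.f x y
  boundary : ∀ x y, (x, y) ∈ frontier P.rect → ∀ t ∈ Ioc 0 P.T, u x y t = 0

open Classical in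
/-- Extension of `u` in space by zero outside the rectangle. -/
def zeroExt (P : Data) (u : ℝ → ℝ → ℝ → ℝ) (x y t : ℝ) : ℝ :=
  if (x, y) ∈ P.rect then u x y t else 0

/-- `u`, extended in space by zero outside the rectangle, is of class `C⁷` on
`ℝ × ℝ × [0, T]`. -/
def IsSmooth (P : Data) (u : ℝ → ℝ → ℝ → ℝ) : Prop :=
  ContDiffOn ℝ 7 (fun p : ℝ × ℝ × ℝ => P.zeroExt u p.1 p.2.1 p.2.2)
    (univ ×ˢ univ ×ˢ Icc 0 P.T)

end Data

/-! ### Fractional centred differences -/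

/-- The coefficients `ω_k^{(γ)}`; a pole of `Γ` in the denominator gives the value `0`, by
Mathlib's conventions `Γ = 0` at the poles and `x / 0 = 0`. -/
def omega (γ : ℝ) (k : ℤ) : ℝ :=
  (-1) ^ k * Real.Gamma (γ + 1) /
    (Real.Gamma (γ / 2 - k + 1) * Real.Gamma (γ / 2 + k + 1))

/-- The weights `ϱ_r^{(γ)}`, `r = -1, 0, 1`. -/
def rho (γ : ℝ) (r : ℤ) : ℝ := if r = 0 then γ / 12 + 1 else -(γ / 24)

/-- The fractional centred difference operator of order `γ` with step `h` on a one-dimensional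
grid with nodes `0, …, m`. It reads its argument at the indices `-1, …, m + 1`. -/
def fracDiff (γ h : ℝ) (m : ℕ) (v : ℤ → ℝ) (i : ℤ) : ℝ :=
  ∑ r ∈ Finset.Icc (-1 : ℤ) 1, rho γ r *
    ∑ k ∈ Finset.Icc (i - m) i, omega γ k / h ^ γ * v (i - k - r)

/-! ### The factorized Crank–Nicolson ADI scheme -/

namespace Data

/-- Mesh size in the `x`-direction. -/
def dx (P : Data) (m₁ : ℕ) : ℝ := (P.xR - P.xL) / m₁

/-- Mesh size in the `y`-direction. -/
def dy (P : Data) (m₂ : ℕ) : ℝ := (P.yR - P.yL) / m₂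

/-- Time step. -/
def dt (P : Data) (N : ℕ) : ℝ := P.T / N

/-- The operator `d_α 𝔇_{α,x} + c_β 𝔇_{β,x}` on grid functions. -/
def opX (P : Data) (m₁ : ℕ) (v : ℤ → ℤ → ℝ) (i j : ℤ) : ℝ :=
  P.dα * fracDiff P.α (P.dx m₁) m₁ (fun l => v l j) i
    + P.cβ * fracDiff P.β (P.dx m₁) m₁ (fun l => v l j) i

/-- The operator `d_μ 𝔇_{μ,y} + c_ν 𝔇_{ν,y}` on grid functions. -/
def opY (P : Data) (m₂ : ℕ) (v : ℤ → ℤ → ℝ) (i j : ℤ) : ℝ :=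
  P.dμ * fracDiff P.μ (P.dy m₂) m₂ (fun l => v i l) j
    + P.cν * fracDiff P.ν (P.dy m₂) m₂ (fun l => v i l) j

/-- The factor `I + c (d_α 𝔇_{α,x} + c_β 𝔇_{β,x})`. -/
def factorX (P : Data) (m₁ : ℕ) (c : ℝ) (v : ℤ → ℤ → ℝ) (i j : ℤ) : ℝ :=
  v i j + c * P.opX m₁ v i j

/-- The factor `I + c (d_μ 𝔇_{μ,y} + c_ν 𝔇_{ν,y})`. -/
def factorY (P : Data) (m₂ : ℕ) (c : ℝ) (v : ℤ → ℤ → ℝ) (i j : ℤ) : ℝ :=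
  v i j + c * P.opY m₂ v i j

/-- Values of a function of `(x, y, t)` at the grid points `(x_i, y_j, t_n)`. -/
def sample (P : Data) (m₁ m₂ N : ℕ) (w : ℝ → ℝ → ℝ → ℝ) (n : ℕ) (i j : ℤ) : ℝ :=
  w (P.xL + i * P.dx m₁) (P.yL + j * P.dy m₂) (n * P.dt N)

/-- The truncation error at `(i, j)` in the step from `t_n` to `t_{n+1}`: the residual, per unit
time, left by the values of `u` (with value zero outside the rectangle) in the scheme
`(I + (Δt/2) A_x)(I + (Δt/2) A_y) u^{n+1}
  = (I - (Δt/2) A_x)(I - (Δt/2) A_y) u^n + Δt (s^{n+1} + s^n) / 2`. -/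
def truncationError (P : Data) (u : ℝ → ℝ → ℝ → ℝ) (m₁ m₂ N n : ℕ) (i j : ℤ) : ℝ :=
  let U := P.sample m₁ m₂ N (P.zeroExt u)
  let S := P.sample m₁ m₂ N P.s
  let c := P.dt N / 2
  (P.factorX m₁ c (P.factorY m₂ c (U (n + 1))) i j
    - P.factorX m₁ (-c) (P.factorY m₂ (-c) (U n)) i j
    - P.dt N * ((S (n + 1) i j + S n i j) / 2)) / P.dt N

/-- `(n, i, j)` is a time level `0 ≤ n < N` together with an interior node. -/
def IsNode (m₁ m₂ N n : ℕ) (i j : ℤ) : Prop :=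
  n < N ∧ 0 < i ∧ i < m₁ ∧ 0 < j ∧ j < m₂

/-- Consistency along `u`: the truncation error tends to zero, uniformly over the grid, as the
three mesh sizes tend to zero independently. -/
def Consistent (P : Data) (u : ℝ → ℝ → ℝ → ℝ) : Prop :=
  ∀ ε > 0, ∃ δ > 0, ∀ m₁ m₂ N : ℕ, 0 < m₁ → 0 < m₂ → 0 < N →
    P.dx m₁ < δ → P.dy m₂ < δ → P.dt N < δ →
    ∀ (n : ℕ) (i j : ℤ), IsNode m₁ m₂ N n i j →
      |P.truncationError u m₁ m₂ N n i j| < ε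

/-- The truncation error along `u` is `O(Δx⁴) + O(Δy⁴) + O(Δt²)`, uniformly over the grid, with a
constant that does not depend on the mesh. -/
def TruncationOrder (P : Data) (u : ℝ → ℝ → ℝ → ℝ) : Prop :=
  ∃ C : ℝ, ∀ m₁ m₂ N : ℕ, 0 < m₁ → 0 < m₂ → 0 < N →
    ∀ (n : ℕ) (i j : ℤ), IsNode m₁ m₂ N n i j →
      |P.truncationError u m₁ m₂ N n i j| ≤ C * (P.dx m₁ ^ 4 + P.dy m₂ ^ 4 + P.dt N ^ 2)

end Data

end RSFADE

end

/-!
The truncation error of the factorized scheme at an interior node splits exactly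
(`Data.truncationError_eq`) into three parts: the error of the trapezoidal rule in time for `∂u/∂t`,
the mean over `t_n` and `t_{n+1}` of the residual of the equation discretized in space only, and
`(Δt/4) A_x A_y (u^{n+1} - u^n)`, which comes from factorizing the Crank–Nicolson operator.

*Residual.* At `0 < t ≤ T` the equation identifies the residual with the error of replacing each
Riesz derivative by minus the compact difference. In one dimension this error is computed on the
Fourier side, for a `C⁷` function `g` supported in `[a, b]`. The weights `ω_k` are the Fourier
coefficients of `(2 |sin πx|)^γ`, because both sequences obey the same two-term recurrence and agree
at `k = 0` (a Beta integral): `symbolCoeff_eq_omega`. The zero extension turns the left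
Riemann–Liouville derivative into the convolution of `s_+^{n-γ-1} / Γ(n-γ)` with `g^{(n)}`, with
symbol `(2πiξ)^γ`, so the Riesz derivative has symbol `-|2πξ|^γ`: `IsBump.riesz_eq`. The weights
`ϱ_r` multiply the symbol of the difference by `1 + (γ/12)(1 - cos θ)`, which cancels its error of
relative order two, so that an error of size `|θ|^{γ+4}` remains: `abs_compact_symbol_sub_le`. For
`γ < 2` the decay `|ξ|^{-7}` of the transform makes `|ξ|^{γ+4} ĝ` integrable, which gives
`O(Δx⁴)`. At `γ = 2` this integral is borderline, but there the compact difference is the classical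
five-point formula and Taylor's theorem applies. The bound depends on `g` only through a bound of
its derivatives and hence is uniform over the slices of `u`. The equation is not assumed at `t = 0`;
the bound holds there because the residual is continuous in time.

*Factorization term.* `|ω_k|` sums `min(1, (kh)²)` to `O(h^γ)` (`tsum_abs_omega_mul_min_le`), hence
the difference quotient of order `γ` of a grid function is bounded by the function and its second
difference quotients, uniformly in the mesh (`abs_fracDiff_le`). Applied in both variables this
bounds `A_x A_y (u^{n+1} - u^n)` by `O(Δt)`, so the third part is `O(Δt²)`.

*Time.* The trapezoidal rule has local error `O(Δt³)`, that is `O(Δt²)` per unit time.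
-/

noncomputable section

namespace RSFADE

open Filter Topology FourierTransform Convolution

/-! ### The weights `ω_k` -/

/-- `1 / Γ(s) = s / Γ(s + 1)` for every real `s`; at the poles both sides are `0`. -/
lemma inv_Gamma_eq (s : ℝ) : (Real.Gamma s)⁻¹ = s * (Real.Gamma (s + 1))⁻¹ := by
  rcases eq_or_ne s 0 with rfl | hs
  · simp [Real.Gamma_zero]
  · rw [Real.Gamma_add_one hs, mul_inv, mul_inv_cancel_left₀ hs]

lemma omega_eq (γ : ℝ) (k : ℤ) : omega γ k = (-1) ^ k * Real.Gamma (γ + 1) *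
    ((Real.Gamma (γ / 2 - k + 1))⁻¹ * (Real.Gamma (γ / 2 + k + 1))⁻¹) := by
  rw [omega, div_eq_mul_inv, mul_inv]

lemma omega_recurrence (γ : ℝ) (k : ℤ) :
    (γ / 2 + k + 1) * omega γ (k + 1) + (γ / 2 - k) * omega γ k = 0 := by
  have h1 := inv_Gamma_eq (γ / 2 - k)
  have h2 := inv_Gamma_eq (γ / 2 + k + 1)
  rw [omega_eq, omega_eq]
  have e1 : γ / 2 - ((k + 1 : ℤ) : ℝ) + 1 = γ / 2 - k := by push_cast; ring
  have e2 : γ / 2 + ((k + 1 : ℤ) : ℝ) + 1 = γ / 2 + k + 1 + 1 := by push_cast; ring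
  rw [e1, e2, h1, h2, zpow_add_one₀ (by norm_num)]
  ring

lemma omega_neg (γ : ℝ) (k : ℤ) : omega γ (-k) = omega γ k := by
  rw [omega_eq, omega_eq]
  have e : ((-1 : ℝ)) ^ (-k) = (-1) ^ k := by
    rw [zpow_neg, ← inv_zpow]; norm_num
  rw [e]; push_cast
  rw [sub_neg_eq_add, ← sub_eq_add_neg, mul_comm (Real.Gamma (γ / 2 + k + 1))⁻¹]

lemma omega_zero (γ : ℝ) : omega γ 0 = Real.Gamma (γ + 1) / Real.Gamma (γ / 2 + 1) ^ 2 := by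
  simp [omega, sq]

lemma omega_zero_pos {γ : ℝ} (hγ : 0 < γ) : 0 < omega γ 0 := by
  rw [omega_zero]
  exact div_pos (Real.Gamma_pos_of_pos (by linarith))
    (pow_pos (Real.Gamma_pos_of_pos (by linarith)) 2)

lemma omega_nonpos_of_pos {γ : ℝ} (hγ : 0 < γ) (hγ2 : γ ≤ 2) (n : ℕ) :
    omega γ (n + 1 : ℤ) ≤ 0 := by
  induction n with
  | zero =>
    have h := omega_recurrence γ 0
    have h0 := omega_zero_pos hγ
    simp only [Nat.cast_zero, Int.cast_zero] at h ⊢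
    have : (γ / 2 + 0 + 1) * omega γ (0 + 1) ≤ 0 := by nlinarith
    exact nonpos_of_mul_nonpos_right this (by linarith)
  | succ n ih =>
    have h := omega_recurrence γ (n + 1 : ℤ)
    push_cast at h ⊢
    have hn : (0 : ℝ) ≤ n := Nat.cast_nonneg n
    have : (γ / 2 + (n + 1) + 1) * omega γ (n + 1 + 1) ≤ 0 := by nlinarith
    exact nonpos_of_mul_nonpos_right this (by linarith)

lemma omega_nonpos {γ : ℝ} (hγ : 0 < γ) (hγ2 : γ ≤ 2) {k : ℤ} (hk : k ≠ 0) :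
    omega γ k ≤ 0 := by
  rcases lt_or_gt_of_ne hk with h | h
  · obtain ⟨n, hn⟩ := Int.eq_ofNat_of_zero_le (show 0 ≤ -k - 1 by omega)
    rw [← omega_neg, show -k = (n + 1 : ℤ) by omega]
    exact omega_nonpos_of_pos hγ hγ2 n
  · obtain ⟨n, hn⟩ := Int.eq_ofNat_of_zero_le (show 0 ≤ k - 1 by omega)
    rw [show k = (n + 1 : ℤ) by omega]
    exact omega_nonpos_of_pos hγ hγ2 n

/-- The recurrence makes `γ ω_k` telescope: it is `(k + γ/2) ω_k - (k + 1 + γ/2) ω_{k+1}`. -/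
lemma sum_omega (γ : ℝ) (n : ℕ) :
    γ * ∑ k ∈ Finset.range n, omega γ (k + 1 : ℤ) =
      (1 + γ / 2) * omega γ 1 - (n + 1 + γ / 2) * omega γ (n + 1 : ℤ) := by
  induction n with
  | zero => simp
  | succ n ih =>
    have h := omega_recurrence γ (n + 1 : ℤ)
    rw [Finset.sum_range_succ, mul_add, ih]
    push_cast at h ⊢
    linarith

lemma summable_omega {γ : ℝ} (hγ : 0 < γ) (hγ2 : γ ≤ 2) : Summable (omega γ) := by
  have hS : Summable fun n : ℕ => -omega γ (n + 1 : ℤ) := by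
    refine summable_of_sum_range_le (c := -((1 + γ / 2) * omega γ 1) / γ)
      (fun n => neg_nonneg.2 (omega_nonpos_of_pos hγ hγ2 n)) fun n => ?_
    rw [le_div_iff₀ hγ, Finset.sum_neg_distrib, neg_mul, mul_comm, sum_omega]
    have := omega_nonpos_of_pos hγ hγ2 n
    have hn : (0 : ℝ) ≤ n := Nat.cast_nonneg n
    nlinarith
  have hS' : Summable fun n : ℕ => omega γ (n + 1 : ℤ) := by simpa using hS.neg
  refine Summable.of_nat_of_neg_add_one ((summable_nat_add_iff 1).1 (by exact_mod_cast hS')) ?_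
  refine hS'.congr fun n => ?_
  rw [← omega_neg]

/-! ### The symbol of the fractional centred difference -/

/-- The symbol `(2 |sin πx|)^γ` of the fractional centred difference, a `1`-periodic function. -/
def symbol (γ x : ℝ) : ℝ := (2 * |Real.sin (Real.pi * x)|) ^ γ

lemma symbol_nonneg (γ x : ℝ) : 0 ≤ symbol γ x := by unfold symbol; positivity

lemma continuous_symbol {γ : ℝ} (hγ : 0 < γ) : Continuous (symbol γ) := by
  unfold symbol
  exact Continuous.rpow_const (by fun_prop) fun x => Or.inr hγ.le

lemma symbol_add_one (γ x : ℝ) : symbol γ (x + 1) = symbol γ x := by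
  simp [symbol, mul_add, Real.sin_add_pi]

/-- The Fourier coefficients of the symbol, as integrals over a period. -/
def symbolCoeff (γ : ℝ) (k : ℤ) : ℂ :=
  ∫ x in (0 : ℝ)..1, Complex.exp (-(2 * Real.pi * Complex.I * k * x)) * (symbol γ x : ℂ)

/-- The Fourier coefficients obey the recurrence of `ω`: the combination on the left integrates
the derivative of `sin(πx)^(γ+1) e^{-2πi(k+1/2)x}`, which vanishes at both ends. -/
lemma symbolCoeff_recurrence {γ : ℝ} (hγ : 0 < γ) (k : ℤ) :
    (γ / 2 + k + 1) * symbolCoeff γ (k + 1) + (γ / 2 - k) * symbolCoeff γ k = 0 := by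
  have hc := continuous_symbol hγ
  have hint : ∀ j : ℤ, IntervalIntegrable (fun x : ℝ =>
      Complex.exp (-(2 * Real.pi * Complex.I * j * x)) * (symbol γ x : ℂ)) volume 0 1 := fun j =>
    Continuous.intervalIntegrable (by fun_prop) _ _
  unfold symbolCoeff
  rw [← intervalIntegral.integral_const_mul, ← intervalIntegral.integral_const_mul,
    ← intervalIntegral.integral_add ((hint _).const_mul _) ((hint _).const_mul _)]
  set F : ℝ → ℂ := fun x => ((Real.sin (Real.pi * x) ^ (γ + 1) : ℝ) : ℂ) *
    Complex.exp (-(2 * Real.pi * Complex.I * (k + 1 / 2) * x)) with hF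
  have hderiv : ∀ x ∈ uIcc (0 : ℝ) 1, HasDerivAt (fun y => ((2 : ℝ) ^ γ / Real.pi : ℝ) * F y)
      ((γ / 2 + k + 1) * (Complex.exp (-(2 * Real.pi * Complex.I * (k + 1 : ℤ) * x)) *
        (symbol γ x : ℂ)) + (γ / 2 - k) * (Complex.exp (-(2 * Real.pi * Complex.I * k * x)) *
        (symbol γ x : ℂ))) x := by
    intro x hx
    rw [uIcc_of_le zero_le_one] at hx
    have hs0 : 0 ≤ Real.sin (Real.pi * x) :=
      Real.sin_nonneg_of_nonneg_of_le_pi (by have := Real.pi_pos; nlinarith [hx.1])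
        (by have := Real.pi_pos; nlinarith [hx.2])
    have h1 : HasDerivAt (fun x : ℝ => Real.sin (Real.pi * x))
        (Real.cos (Real.pi * x) * Real.pi) x := by
      simpa using ((hasDerivAt_id x).const_mul Real.pi).sin
    have h2 := (h1.rpow_const (p := γ + 1) (Or.inr (by linarith))).ofReal_comp
    have h3 : HasDerivAt (fun x : ℝ => Complex.exp (-(2 * Real.pi * Complex.I * (k + 1 / 2) * x)))
        (Complex.exp (-(2 * Real.pi * Complex.I * (k + 1 / 2) * x)) *
          (-(2 * Real.pi * Complex.I * (k + 1 / 2)))) x := by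
      have : HasDerivAt (fun x : ℝ => -(2 * Real.pi * Complex.I * (k + 1 / 2) * (x : ℂ)))
          (-(2 * Real.pi * Complex.I * (k + 1 / 2))) x := by
        simpa using ((Complex.ofRealCLM.hasDerivAt (x := x)).const_mul
          (2 * Real.pi * Complex.I * (k + 1 / 2))).fun_neg
      exact this.cexp
    refine ((h2.mul h3).const_mul (((2 : ℝ) ^ γ / Real.pi : ℝ) : ℂ)).congr_deriv ?_
    have hsym : symbol γ x = 2 ^ γ * Real.sin (Real.pi * x) ^ γ := by
      rw [symbol, abs_of_nonneg hs0, Real.mul_rpow (by norm_num) hs0]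
    have hpow : Real.sin (Real.pi * x) ^ (γ + 1) =
        Real.sin (Real.pi * x) ^ γ * Real.sin (Real.pi * x) := by
      rw [Real.rpow_add_one' hs0 (by linarith)]
    have hE1 : Complex.exp (-(2 * Real.pi * Complex.I * k * x)) =
        Complex.exp (-(2 * Real.pi * Complex.I * (k + 1 / 2) * x)) *
          Complex.exp (Real.pi * x * Complex.I) := by
      rw [← Complex.exp_add]; congr 1; ring
    have hE2 : Complex.exp (-(2 * Real.pi * Complex.I * (k + 1 : ℤ) * x)) =
        Complex.exp (-(2 * Real.pi * Complex.I * (k + 1 / 2) * x)) *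
          Complex.exp (-(Real.pi * x) * Complex.I) := by
      rw [← Complex.exp_add]; congr 1; push_cast; ring
    rw [hE1, hE2, hsym, hpow, add_sub_cancel_right]
    push_cast
    rw [Complex.sin, Complex.cos]
    have hpi : (Real.pi : ℂ) ≠ 0 := by exact_mod_cast Real.pi_ne_zero
    field_simp
    ring_nf
    simp only [Complex.I_sq]
    ring
  rw [intervalIntegral.integral_eq_sub_of_hasDerivAt hderiv
    (((hint _).const_mul _).add ((hint _).const_mul _))]
  simp [hF, Real.zero_rpow (show γ + 1 ≠ 0 by linarith)]

/-- Substituting `t = sin²(πx/2)` turns the integral of `(2 sin πx)^γ` into an Euler Beta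
integral. -/
lemma integral_symbol {γ : ℝ} (hγ : 0 < γ) :
    ∫ x in (0 : ℝ)..1, symbol γ x = omega γ 0 := by
  set p : ℝ := (γ + 1) / 2 with hp
  have hp0 : 0 < p := by rw [hp]; linarith
  have hbeta : ∫ t in Ioo (0 : ℝ) 1, t ^ (p - 1) * (1 - t) ^ (p - 1) =
      Real.Gamma p * Real.Gamma p / Real.Gamma (p + p) := by
    have h := Complex.betaIntegral_eq_Gamma_mul_div (p : ℂ) (p : ℂ) (by simpa) (by simpa)
    rw [Complex.betaIntegral, intervalIntegral.integral_of_le zero_le_one,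
      integral_Ioc_eq_integral_Ioo] at h
    have h' : ∫ t in Ioo (0 : ℝ) 1, ((t : ℂ) ^ ((p : ℂ) - 1) * (1 - (t : ℂ)) ^ ((p : ℂ) - 1)) =
        ∫ t in Ioo (0 : ℝ) 1, ((t ^ (p - 1) * (1 - t) ^ (p - 1) : ℝ) : ℂ) := by
      refine setIntegral_congr_fun measurableSet_Ioo fun t ht => ?_
      rw [Complex.ofReal_mul, Complex.ofReal_cpow ht.1.le, Complex.ofReal_cpow (by linarith [ht.2])]
      push_cast; rfl
    rw [h', integral_complex_ofReal, ← Complex.ofReal_add] at h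
    simp only [Complex.Gamma_ofReal] at h
    exact_mod_cast h
  have hsub := integral_image_eq_integral_abs_deriv_smul (s := Ioo (0 : ℝ) 1)
    (f := fun x => Real.sin (Real.pi * x / 2) ^ 2)
    (f' := fun x => Real.pi / 2 * Real.sin (Real.pi * x)) measurableSet_Ioo
    (fun x hx => by
      have h1 : HasDerivAt (fun x : ℝ => Real.sin (Real.pi * x / 2))
          (Real.cos (Real.pi * x / 2) * (Real.pi / 2)) x := by
        simpa using (((hasDerivAt_id x).const_mul Real.pi).div_const 2).sin
      refine ((h1.pow 2).congr_deriv ?_).hasDerivWithinAt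
      rw [show Real.pi * x = 2 * (Real.pi * x / 2) by ring, Real.sin_two_mul]
      ring_nf) ?_ (fun t : ℝ => t ^ (p - 1) * (1 - t) ^ (p - 1))
  swap
  · intro x hx y hy hxy
    have hpi := Real.pi_pos
    have h0 : ∀ z ∈ Ioo (0 : ℝ) 1, 0 ≤ Real.sin (Real.pi * z / 2) := fun z hz =>
      Real.sin_nonneg_of_nonneg_of_le_pi (by nlinarith [hz.1]) (by nlinarith [hz.2])
    have h1 : Real.sin (Real.pi * x / 2) = Real.sin (Real.pi * y / 2) := by
      simpa using (pow_left_inj₀ (h0 x hx) (h0 y hy) two_ne_zero).1 hxy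
    have h2 := Real.injOn_sin ⟨by nlinarith [hx.1], by nlinarith [hx.2]⟩
      ⟨by nlinarith [hy.1], by nlinarith [hy.2]⟩ h1
    have : Real.pi * x = Real.pi * y := by linarith
    exact mul_left_cancel₀ hpi.ne' this
  have himg : (fun x => Real.sin (Real.pi * x / 2) ^ 2) '' Ioo (0 : ℝ) 1 = Ioo 0 1 := by
    have hpi := Real.pi_pos
    ext t
    constructor
    · rintro ⟨x, hx, rfl⟩
      have h0 : 0 < Real.sin (Real.pi * x / 2) :=
        Real.sin_pos_of_pos_of_lt_pi (by nlinarith [hx.1]) (by nlinarith [hx.2])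
      have h1 : 0 < Real.cos (Real.pi * x / 2) :=
        Real.cos_pos_of_mem_Ioo ⟨by nlinarith [hx.1], by nlinarith [hx.2]⟩
      have := Real.sin_sq_add_cos_sq (Real.pi * x / 2)
      exact ⟨by positivity, by nlinarith⟩
    · intro ht
      have hs0 : 0 < √t := Real.sqrt_pos.2 ht.1
      have hs1 : √t < 1 := by rw [Real.sqrt_lt' one_pos]; simpa using ht.2
      refine ⟨2 / Real.pi * Real.arcsin √t, ⟨?_, ?_⟩, ?_⟩
      · have := Real.arcsin_pos.2 hs0; positivity
      · have := Real.arcsin_lt_pi_div_two.2 hs1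
        rw [div_mul_eq_mul_div, div_lt_one hpi]; linarith
      · simp only
        rw [show Real.pi * (2 / Real.pi * Real.arcsin √t) / 2 = Real.arcsin √t by
          field_simp, Real.sin_arcsin (by linarith) hs1.le, Real.sq_sqrt ht.1.le]
  rw [himg, hbeta] at hsub
  have hcongr : ∫ x in Ioo (0 : ℝ) 1, |Real.pi / 2 * Real.sin (Real.pi * x)| •
      ((Real.sin (Real.pi * x / 2) ^ 2) ^ (p - 1) *
        (1 - Real.sin (Real.pi * x / 2) ^ 2) ^ (p - 1)) =
      Real.pi / 4 ^ γ * ∫ x in Ioo (0 : ℝ) 1, symbol γ x := by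
    rw [← integral_const_mul]
    refine setIntegral_congr_fun measurableSet_Ioo fun x hx => ?_
    have hpi := Real.pi_pos
    have hs : 0 < Real.sin (Real.pi * x) :=
      Real.sin_pos_of_pos_of_lt_pi (by nlinarith [hx.1]) (by nlinarith [hx.2])
    simp only [smul_eq_mul]
    rw [abs_of_pos (by positivity), ← Real.mul_rpow (by positivity)
      (by nlinarith [Real.sin_sq_le_one (Real.pi * x / 2)]), symbol, abs_of_pos hs,
      ← Real.cos_sq']
    have h1 : Real.sin (Real.pi * x / 2) ^ 2 * Real.cos (Real.pi * x / 2) ^ 2 =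
        (Real.sin (Real.pi * x) / 2) ^ 2 := by
      rw [show Real.pi * x = 2 * (Real.pi * x / 2) by ring, Real.sin_two_mul]
      ring_nf
    rw [h1, ← Real.rpow_natCast, ← Real.rpow_mul (by positivity)]
    have h2 : ((2 : ℕ) : ℝ) * (p - 1) = γ - 1 := by rw [hp]; push_cast; ring
    rw [h2, show (4 : ℝ) ^ γ = 2 ^ γ * 2 ^ γ by
      rw [← Real.mul_rpow (by norm_num) (by norm_num)]; norm_num,
      Real.rpow_sub_one (by positivity), Real.div_rpow hs.le (by norm_num),
      Real.mul_rpow (by norm_num) hs.le]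
    field_simp
  rw [hcongr] at hsub
  rw [intervalIntegral.integral_of_le zero_le_one, integral_Ioc_eq_integral_Ioo, omega_zero]
  have hdup := Real.Gamma_mul_Gamma_add_half p
  rw [show p + 1 / 2 = γ / 2 + 1 by rw [hp]; ring, show 2 * p = γ + 1 by rw [hp]; ring,
    show 1 - (γ + 1) = -γ by ring, Real.rpow_neg (by norm_num)] at hdup
  rw [show p + p = γ + 1 by rw [hp]; ring] at hsub
  have g1 : 0 < Real.Gamma p := Real.Gamma_pos_of_pos hp0
  have g2 : 0 < Real.Gamma (γ / 2 + 1) := Real.Gamma_pos_of_pos (by linarith)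
  have g3 : 0 < Real.Gamma (γ + 1) := Real.Gamma_pos_of_pos (by linarith)
  have h4 : (4 : ℝ) ^ γ = 2 ^ γ * 2 ^ γ := by
    rw [← Real.mul_rpow (by norm_num) (by norm_num)]; norm_num
  have h2g : (0 : ℝ) < 2 ^ γ := by positivity
  have hG : Real.Gamma p = Real.Gamma (γ + 1) * (2 ^ γ)⁻¹ * √Real.pi / Real.Gamma (γ / 2 + 1) := by
    rw [← hdup]; field_simp
  rw [hG, h4] at hsub
  clear_value p
  generalize Real.Gamma (γ / 2 + 1) = G at *
  field_simp at hsub ⊢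
  rw [Real.sq_sqrt Real.pi_pos.le] at hsub
  exact mul_left_cancel₀ Real.pi_pos.ne' (by linear_combination -hsub)

lemma symbolCoeff_zero {γ : ℝ} (hγ : 0 < γ) : symbolCoeff γ 0 = omega γ 0 := by
  rw [symbolCoeff, ← integral_symbol hγ, ← intervalIntegral.integral_ofReal]
  simp

lemma symbolCoeff_eq_omega {γ : ℝ} (hγ : 0 < γ) (k : ℤ) : symbolCoeff γ k = omega γ k := by
  have hω : ∀ j : ℤ, ((γ : ℂ) / 2 + j + 1) * omega γ (j + 1) + (γ / 2 - j) * omega γ j = 0 :=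
    fun j => by exact_mod_cast congrArg (fun r : ℝ => (r : ℂ)) (omega_recurrence γ j)
  induction k using Int.induction_on with
  | zero => exact symbolCoeff_zero hγ
  | succ n ih =>
    have h1 := symbolCoeff_recurrence hγ n
    have h2 := hω n
    rw [ih] at h1
    have hne : (γ : ℂ) / 2 + (n : ℤ) + 1 ≠ 0 := by
      have : (γ / 2 + n + 1 : ℝ) ≠ 0 := by positivity
      exact_mod_cast this
    exact mul_left_cancel₀ hne (by linear_combination h1 - h2)
  | pred n ih =>
    have h1 := symbolCoeff_recurrence hγ (-n - 1)
    have h2 := hω (-n - 1)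
    rw [sub_add_cancel] at h1 h2
    rw [ih] at h1
    have hne : (γ : ℂ) / 2 - ((-n - 1 : ℤ) : ℂ) ≠ 0 := by
      have : (γ / 2 + n + 1 : ℝ) ≠ 0 := by positivity
      have h : ((γ / 2 + n + 1 : ℝ) : ℂ) ≠ 0 := by exact_mod_cast this
      convert h using 1
      push_cast; ring
    exact mul_left_cancel₀ hne (by linear_combination h1 - h2)

/-- The Fourier series of the symbol: `∑ ω_k e^{2πikx} = (2 |sin πx|)^γ`. -/
theorem hasSum_omega_exp {γ : ℝ} (hγ : 0 < γ) (hγ2 : γ ≤ 2) (x : ℝ) :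
    HasSum (fun k : ℤ => (omega γ k : ℂ) * Complex.exp (2 * Real.pi * Complex.I * k * x))
      (symbol γ x : ℂ) := by
  have hper : Function.Periodic (fun x : ℝ => (symbol γ x : ℂ)) 1 := fun x => by
    simp only [symbol_add_one]
  have hcont : Continuous (fun x : ℝ => (symbol γ x : ℂ)) :=
    Complex.continuous_ofReal.comp (continuous_symbol hγ)
  let f : C(AddCircle (1 : ℝ), ℂ) := ⟨hper.lift, hcont.quotient_lift _⟩
  have hf : ∀ x : ℝ, f (x : AddCircle (1 : ℝ)) = (symbol γ x : ℂ) := fun x => hper.lift_coe x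
  have hcoeff : ∀ k : ℤ, fourierCoeff f k = omega γ k := fun k => by
    rw [fourierCoeff_eq_intervalIntegral _ _ 0, ← symbolCoeff_eq_omega hγ, symbolCoeff]
    simp only [hf, fourier_coe_apply, smul_eq_mul, zero_add, div_one, one_smul]
    congr 1; ext t; congr 2; push_cast; ring
  have hsum : Summable (fourierCoeff f) := by
    rw [funext hcoeff]
    exact Complex.ofRealCLM.summable (summable_omega hγ hγ2)
  have h := has_pointwise_sum_fourier_series_of_summable hsum (x : AddCircle (1 : ℝ))
  rw [hf] at h
  simp only [hcoeff, fourier_coe_apply, smul_eq_mul] at h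
  simpa using h

lemma hasSum_omega_cos {γ : ℝ} (hγ : 0 < γ) (hγ2 : γ ≤ 2) (x : ℝ) :
    HasSum (fun k : ℤ => omega γ k * Real.cos (2 * Real.pi * k * x)) (symbol γ x) := by
  have h := Complex.reCLM.hasSum (hasSum_omega_exp hγ hγ2 x)
  simp only [Complex.reCLM_apply, Complex.ofReal_re, Complex.re_ofReal_mul] at h
  convert h using 3 with k
  rw [show 2 * (Real.pi : ℂ) * Complex.I * k * x = ((2 * Real.pi * k * x : ℝ) : ℂ) * Complex.I by
    push_cast; ring, Complex.exp_ofReal_mul_I_re]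

lemma hasSum_omega {γ : ℝ} (hγ : 0 < γ) (hγ2 : γ ≤ 2) : HasSum (omega γ) 0 := by
  simpa [symbol, Real.zero_rpow hγ.ne'] using hasSum_omega_cos hγ hγ2 0

/-! ### The fractional integral on the Fourier side -/

lemma integrableOn_rpow_mul_exp {q ε : ℝ} (hq : 0 < q) (hε : 0 < ε) :
    IntegrableOn (fun s : ℝ => s ^ (q - 1) * Real.exp (-(ε * s))) (Ioi 0) := by
  have := integrableOn_rpow_mul_exp_neg_mul_rpow (p := 1) (s := q - 1) (b := ε)
    (by linarith) one_pos hε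
  simpa using this

/-- The Gamma integral `∫ s^(q-1) e^{-rs} ds = r^{-q} Γ(q)` for complex `r = ε + iη` in the right
half-plane: `r^q` times the integral has zero derivative in `η`. -/
lemma integral_rpow_mul_cexp {q ε : ℝ} (hq : 0 < q) (hε : 0 < ε) (η : ℝ) :
    ∫ s in Ioi (0 : ℝ), ((s ^ (q - 1) : ℝ) : ℂ) * Complex.exp (-((ε + η * Complex.I) * s)) =
      (ε + η * Complex.I) ^ (-(q : ℂ)) * Real.Gamma q := by
  set J : ℝ → ℂ := fun η => ∫ s in Ioi (0 : ℝ),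
    ((s ^ (q - 1) : ℝ) : ℂ) * Complex.exp (-((ε + η * Complex.I) * s)) with hJ
  set J1 : ℝ → ℂ := fun η => ∫ s in Ioi (0 : ℝ),
    ((s ^ q : ℝ) : ℂ) * Complex.exp (-((ε + η * Complex.I) * s)) with hJ1
  have hnorm : ∀ η s : ℝ, ‖Complex.exp (-((ε + η * Complex.I) * s))‖ = Real.exp (-(ε * s)) := by
    intro η s
    rw [Complex.norm_exp]; simp
  have hmeas : ∀ (p η : ℝ), AEStronglyMeasurable (fun s : ℝ =>
      ((s ^ p : ℝ) : ℂ) * Complex.exp (-((ε + η * Complex.I) * s))) (volume.restrict (Ioi 0)) := by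
    intro p η
    apply Measurable.aestronglyMeasurable
    fun_prop
  have hint : ∀ (p η : ℝ), 0 < p → IntegrableOn (fun s : ℝ =>
      ((s ^ (p - 1) : ℝ) : ℂ) * Complex.exp (-((ε + η * Complex.I) * s))) (Ioi 0) := by
    intro p η hp
    refine (integrableOn_rpow_mul_exp hp hε).mono' (hmeas _ _) ?_
    filter_upwards [self_mem_ae_restrict measurableSet_Ioi] with s hs
    rw [norm_mul, hnorm, Complex.norm_real, Real.norm_of_nonneg (Real.rpow_nonneg (le_of_lt hs) _)]
  have hint1 : ∀ η : ℝ, IntegrableOn (fun s : ℝ =>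
      ((s ^ q : ℝ) : ℂ) * Complex.exp (-((ε + η * Complex.I) * s))) (Ioi 0) := fun η => by
    simpa using hint (q + 1) η (by linarith)
  have hr : ∀ η : ℝ, (ε + η * Complex.I : ℂ) ∈ Complex.slitPlane := fun η => by
    left; simpa using hε
  have hr0 : ∀ η : ℝ, (ε + η * Complex.I : ℂ) ≠ 0 := fun η => Complex.slitPlane_ne_zero (hr η)
  -- integration by parts
  have hparts : ∀ η : ℝ, (q : ℂ) * J η = (ε + η * Complex.I) * J1 η := by
    intro η
    have hF : ∀ s ∈ Ioi (0 : ℝ), HasDerivAt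
        (fun s : ℝ => ((s ^ q : ℝ) : ℂ) * Complex.exp (-((ε + η * Complex.I) * s)))
        (q * (((s ^ (q - 1) : ℝ) : ℂ) * Complex.exp (-((ε + η * Complex.I) * s))) -
          (ε + η * Complex.I) * (((s ^ q : ℝ) : ℂ) * Complex.exp (-((ε + η * Complex.I) * s))))
        s := by
      intro s hs
      have h1 := (Real.hasDerivAt_rpow_const (x := s) (p := q) (Or.inl (ne_of_gt hs))).ofReal_comp
      have h2 : HasDerivAt (fun s : ℝ => -((ε + η * Complex.I) * (s : ℂ)))
          (-(ε + η * Complex.I)) s := by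
        simpa using ((Complex.ofRealCLM.hasDerivAt (x := s)).const_mul
          (ε + η * Complex.I)).fun_neg
      refine (h1.mul h2.cexp).congr_deriv ?_
      push_cast
      ring
    have hc : Continuous (fun s : ℝ =>
        ((s ^ q : ℝ) : ℂ) * Complex.exp (-((ε + η * Complex.I) * s))) :=
      (Complex.continuous_ofReal.comp (Real.continuous_rpow_const hq.le)).mul (by fun_prop)
    have hinf : Tendsto (fun s : ℝ => ((s ^ q : ℝ) : ℂ) *
        Complex.exp (-((ε + η * Complex.I) * s))) atTop (𝓝 0) := by
      rw [tendsto_zero_iff_norm_tendsto_zero]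
      refine (tendsto_rpow_mul_exp_neg_mul_atTop_nhds_zero q ε hε).congr' ?_
      filter_upwards [eventually_gt_atTop 0] with s hs
      rw [norm_mul, hnorm, Complex.norm_real, Real.norm_of_nonneg (Real.rpow_nonneg hs.le _),
        neg_mul]
    have h := integral_Ioi_of_hasDerivAt_of_tendsto hc.continuousWithinAt hF
      (((hint q η hq).const_mul _).sub ((hint1 η).const_mul _)) hinf
    rw [integral_sub ((hint q η hq).const_mul _) ((hint1 η).const_mul _), integral_const_mul,
      integral_const_mul] at h
    simpa [Real.zero_rpow hq.ne', sub_eq_zero] using h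
  have hderivJ : ∀ η : ℝ, HasDerivAt J (-Complex.I * J1 η) η := by
    intro η
    have h := hasDerivAt_integral_of_dominated_loc_of_deriv_le (μ := volume.restrict (Ioi (0 : ℝ)))
      (F := fun (η s : ℝ) => ((s ^ (q - 1) : ℝ) : ℂ) * Complex.exp (-((ε + η * Complex.I) * s)))
      (F' := fun (η s : ℝ) => -Complex.I * (((s ^ q : ℝ) : ℂ) *
        Complex.exp (-((ε + η * Complex.I) * s))))
      (bound := fun s => s ^ (q + 1 - 1) * Real.exp (-(ε * s))) (x₀ := η) (s := univ) univ_mem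
      (Eventually.of_forall fun η => hmeas _ _) (hint q η hq) ((hint1 η).const_mul _).1 ?_
      (integrableOn_rpow_mul_exp (by linarith) hε) ?_
    · rw [← integral_const_mul]; exact h.2
    · filter_upwards [self_mem_ae_restrict measurableSet_Ioi] with s hs η _
      rw [norm_mul, norm_mul, hnorm, Complex.norm_real,
        Real.norm_of_nonneg (Real.rpow_nonneg (le_of_lt hs) _)]
      simp
    · filter_upwards [self_mem_ae_restrict measurableSet_Ioi] with s hs η _
      have h2 : HasDerivAt (fun η : ℝ => -((ε + (η : ℂ) * Complex.I) * (s : ℂ)))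
          (-(Complex.I * s)) η := by
        simpa using ((((Complex.ofRealCLM.hasDerivAt (x := η)).mul_const Complex.I).const_add
          (ε : ℂ)).mul_const (s : ℂ)).fun_neg
      refine (h2.cexp.const_mul _).congr_deriv ?_
      have : s ^ q = s ^ (q - 1) * s := by
        rw [← Real.rpow_add_one (ne_of_gt hs), sub_add_cancel]
      rw [this]; push_cast; ring
  set K : ℝ → ℂ := fun η => J η * (ε + η * Complex.I) ^ (q : ℂ) with hK
  have hderivK : ∀ η : ℝ, HasDerivAt K 0 η := by
    intro η
    have h1 : HasDerivAt (fun η : ℝ => (ε + η * Complex.I : ℂ)) Complex.I η := by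
      simpa using ((Complex.ofRealCLM.hasDerivAt (x := η)).mul_const Complex.I).const_add (ε : ℂ)
    have h2 := (Complex.hasStrictDerivAt_cpow_const (c := (q : ℂ)) (hr η)).hasDerivAt.comp η h1
    refine ((hderivJ η).mul h2).congr_deriv ?_
    have := hparts η
    have hne := hr0 η
    rw [Complex.cpow_sub _ _ hne, Complex.cpow_one]
    simp only [Function.comp_apply]
    generalize (ε + η * Complex.I : ℂ) = r at this hne
    field_simp
    linear_combination (r ^ (q : ℂ) * Complex.I) * this
  have hconst : K η = K 0 := is_const_of_deriv_eq_zero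
    (fun η => (hderivK η).differentiableAt) (fun η => (hderivK η).deriv) η 0
  have hJ0 : J 0 = ((ε ^ (-q) * Real.Gamma q : ℝ) : ℂ) := by
    have h := Real.integral_rpow_mul_exp_neg_mul_Ioi hq hε
    rw [one_div, Real.inv_rpow hε.le, ← Real.rpow_neg hε.le] at h
    rw [← h, ← integral_complex_ofReal]
    simp [hJ]
  simp only [hK, hJ0] at hconst
  have hq0 : (ε + η * Complex.I : ℂ) ^ (q : ℂ) ≠ 0 := by simp [Complex.cpow_eq_zero_iff, hr0 η]
  have hε1 : ((ε ^ (-q) : ℝ) : ℂ) * (ε : ℂ) ^ (q : ℂ) = 1 := by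
    rw [← Complex.ofReal_cpow hε.le, ← Complex.ofReal_mul, ← Real.rpow_add hε]
    simp
  rw [Complex.cpow_neg, inv_mul_eq_div, eq_div_iff hq0]
  refine hconst.trans ?_
  push_cast at hε1 ⊢
  rw [zero_mul, add_zero]
  linear_combination (Real.Gamma q : ℂ) * hε1

lemma fourier_inversion {F : ℝ → ℂ} (hc : Continuous F) (hF : Integrable F)
    (hF' : Integrable (𝓕 F)) (x : ℝ) :
    F x = ∫ ξ, 𝓕 F ξ * Complex.exp (2 * Real.pi * Complex.I * ξ * x) := by
  conv_lhs => rw [← hc.fourierInv_fourier_eq hF hF']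
  rw [Real.fourierInv_eq']
  congr 1; ext ξ
  rw [smul_eq_mul, mul_comm]
  congr 2
  simp
  ring

lemma norm_cexp_fourier (ξ x : ℝ) :
    ‖Complex.exp (2 * Real.pi * Complex.I * ξ * x)‖ = 1 := by
  rw [Complex.norm_exp]; simp

/-- The kernel `s^(q-1)` of the fractional integral of order `q`, on the positive half-line. -/
def rlKernel (q : ℝ) : ℝ → ℝ := (Ioi 0).indicator fun s => s ^ (q - 1)

lemma locallyIntegrable_rlKernel {q : ℝ} (hq : 0 < q) : LocallyIntegrable (rlKernel q) := by
  refine LocallyIntegrable.indicator (fun x => ?_) measurableSet_Ioi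
  refine ⟨Icc (x - 1) (x + 1), Icc_mem_nhds (by linarith) (by linarith), ?_⟩
  rw [← uIcc_of_le (by linarith : x - 1 ≤ x + 1), ← intervalIntegrable_iff']
  exact intervalIntegral.intervalIntegrable_rpow' (by linarith)

/-- Insert `e^{-εs}`, apply Fourier inversion and exchange the integrals. -/
lemma integral_rpow_mul_exp_translate {F : ℝ → ℂ} (hc : Continuous F) (hF : Integrable F)
    (hF' : Integrable (𝓕 F)) {q ε : ℝ} (hq : 0 < q) (hε : 0 < ε) (x : ℝ) :
    ∫ s in Ioi (0 : ℝ), ((s ^ (q - 1) * Real.exp (-(ε * s)) : ℝ) : ℂ) * F (x - s) =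
      ∫ ξ, Real.Gamma q * ((ε + (2 * Real.pi * ξ : ℝ) * Complex.I) ^ (-(q : ℂ)) *
        (𝓕 F ξ * Complex.exp (2 * Real.pi * Complex.I * ξ * x))) := by
  have hint : Integrable (Function.uncurry fun (s ξ : ℝ) =>
      ((s ^ (q - 1) * Real.exp (-(ε * s)) : ℝ) : ℂ) *
        (𝓕 F ξ * Complex.exp (2 * Real.pi * Complex.I * ξ * (x - s : ℝ))))
      ((volume.restrict (Ioi 0)).prod volume) := by
    have h1 : Integrable (fun s : ℝ => ((s ^ (q - 1) * Real.exp (-(ε * s)) : ℝ) : ℂ))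
        (volume.restrict (Ioi 0)) := (integrableOn_rpow_mul_exp hq hε).ofReal
    have h2 := (h1.mul_prod hF').bdd_mul (c := 1)
      (f := fun p : ℝ × ℝ => Complex.exp (2 * Real.pi * Complex.I * p.2 * (x - p.1 : ℝ)))
      (Continuous.aestronglyMeasurable (by fun_prop))
      (Eventually.of_forall fun p => (norm_cexp_fourier _ _).le)
    refine h2.congr (Eventually.of_forall fun p => ?_)
    simp only [Function.uncurry]
    ring
  have hswap := integral_integral_swap hint
  calc _ = ∫ s in Ioi (0 : ℝ), ∫ ξ, ((s ^ (q - 1) * Real.exp (-(ε * s)) : ℝ) : ℂ) *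
        (𝓕 F ξ * Complex.exp (2 * Real.pi * Complex.I * ξ * (x - s : ℝ))) := by
        congr 1; ext s
        rw [integral_const_mul, ← fourier_inversion hc hF hF']
    _ = _ := hswap
    _ = _ := by
        congr 1; ext ξ
        have h := integral_rpow_mul_cexp hq hε (2 * Real.pi * ξ)
        rw [← mul_assoc, mul_comm (Real.Gamma q : ℂ), ← h, ← integral_mul_const]
        congr 1; ext s
        rw [show Complex.exp (2 * Real.pi * Complex.I * ξ * (x - s : ℝ)) =
          Complex.exp (2 * Real.pi * Complex.I * ξ * x) *
            Complex.exp (-((2 * Real.pi * ξ : ℝ) * Complex.I * s)) by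
            rw [← Complex.exp_add]; congr 1; push_cast; ring,
          show Complex.exp (-((ε + (2 * Real.pi * ξ : ℝ) * Complex.I) * s)) =
            (Real.exp (-(ε * s)) : ℝ) * Complex.exp (-((2 * Real.pi * ξ : ℝ) * Complex.I * s)) by
            rw [Complex.ofReal_exp, ← Complex.exp_add]; congr 1; push_cast; ring]
        push_cast
        ring

/-- The fractional integral of order `q` over the half-line has Fourier symbol `(2πiξ)^{-q}`. -/
lemma integral_rpow_mul_translate {F : ℝ → ℂ} (hc : Continuous F) (hs : HasCompactSupport F)
    (hF' : Integrable (𝓕 F)) {q : ℝ} (hq : 0 < q)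
    (hF'' : Integrable fun ξ : ℝ => |2 * Real.pi * ξ| ^ (-q) * ‖𝓕 F ξ‖) (x : ℝ) :
    ∫ s in Ioi (0 : ℝ), ((s ^ (q - 1) : ℝ) : ℂ) * F (x - s) =
      Real.Gamma q * ∫ ξ, ((2 * Real.pi * ξ : ℝ) * Complex.I) ^ (-(q : ℂ)) *
        (𝓕 F ξ * Complex.exp (2 * Real.pi * Complex.I * ξ * x)) := by
  have hF : Integrable F := hc.integrable_of_hasCompactSupport hs
  have hkF : IntegrableOn (fun s : ℝ => ((s ^ (q - 1) : ℝ) : ℂ) * F (x - s)) (Ioi 0) := by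
    have h := (hs.convolutionExists_right (ContinuousLinearMap.lsmul ℝ ℝ)
      (locallyIntegrable_rlKernel hq) hc x)
    have h' : Integrable (fun t => rlKernel q t • F (x - t)) := h
    rw [← integrable_indicator_iff measurableSet_Ioi]
    refine h'.congr (Eventually.of_forall fun s => ?_)
    by_cases hs : s ∈ Ioi (0 : ℝ) <;> simp [rlKernel, hs]
  -- Both sides of the regularized identity converge as `ε → 0+`.
  have hL : Tendsto (fun ε : ℝ => ∫ s in Ioi (0 : ℝ),
      ((s ^ (q - 1) * Real.exp (-(ε * s)) : ℝ) : ℂ) * F (x - s)) (𝓝[>] 0)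
      (𝓝 (∫ s in Ioi (0 : ℝ), ((s ^ (q - 1) : ℝ) : ℂ) * F (x - s))) := by
    refine tendsto_integral_filter_of_dominated_convergence
      (fun s => ‖((s ^ (q - 1) : ℝ) : ℂ) * F (x - s)‖) ?_ ?_ hkF.norm ?_
    · refine Eventually.of_forall fun ε => ?_
      refine AEStronglyMeasurable.mul ?_ (by fun_prop)
      apply Measurable.aestronglyMeasurable
      fun_prop
    · filter_upwards [self_mem_nhdsWithin] with ε hε
      filter_upwards [self_mem_ae_restrict measurableSet_Ioi] with s hs
      have h1 : Real.exp (-(ε * s)) ≤ 1 := Real.exp_le_one_iff.2 (by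
        have := mul_pos (mem_Ioi.1 hε) (mem_Ioi.1 hs); linarith)
      have h2 : 0 ≤ s ^ (q - 1) := Real.rpow_nonneg (le_of_lt hs) _
      rw [norm_mul, norm_mul, Complex.norm_real, Complex.norm_real, Real.norm_of_nonneg h2,
        Real.norm_of_nonneg (by positivity)]
      gcongr
      exact mul_le_of_le_one_right h2 h1
    · refine Eventually.of_forall fun s => ?_
      have : Continuous fun ε : ℝ => ((s ^ (q - 1) * Real.exp (-(ε * s)) : ℝ) : ℂ) * F (x - s) := by
        fun_prop
      have h := (this.tendsto 0).mono_left (nhdsWithin_le_nhds (s := Ioi 0))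
      simpa using h
  have hne : ∀ᵐ ξ : ℝ, ξ ≠ 0 := by simp [ae_iff, measure_singleton]
  have hR : Tendsto (fun ε : ℝ => ∫ ξ, Real.Gamma q *
      ((ε + (2 * Real.pi * ξ : ℝ) * Complex.I) ^ (-(q : ℂ)) *
        (𝓕 F ξ * Complex.exp (2 * Real.pi * Complex.I * ξ * x)))) (𝓝[>] 0)
      (𝓝 (∫ ξ, Real.Gamma q * (((2 * Real.pi * ξ : ℝ) * Complex.I) ^ (-(q : ℂ)) *
        (𝓕 F ξ * Complex.exp (2 * Real.pi * Complex.I * ξ * x))))) := by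
    refine tendsto_integral_filter_of_dominated_convergence
      (fun ξ => Real.Gamma q * (|2 * Real.pi * ξ| ^ (-q) * ‖𝓕 F ξ‖)) ?_ ?_ (hF''.const_mul _) ?_
    · refine Eventually.of_forall fun ε => ?_
      refine AEStronglyMeasurable.const_mul (AEStronglyMeasurable.mul ?_
        (hF'.1.mul (Continuous.aestronglyMeasurable (by fun_prop)))) _
      apply Measurable.aestronglyMeasurable
      fun_prop
    · filter_upwards [self_mem_nhdsWithin] with ε hε
      filter_upwards [hne] with ξ hξ
      have hη : 0 < |2 * Real.pi * ξ| := abs_pos.2 (by have := Real.pi_pos; positivity)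
      rw [norm_mul, norm_mul, norm_mul, norm_cexp_fourier, mul_one, Complex.norm_real,
        Real.norm_of_nonneg (Real.Gamma_pos_of_pos hq).le]
      have hz : (ε + (2 * Real.pi * ξ : ℝ) * Complex.I : ℂ) ≠ 0 := by
        intro h
        have := congrArg Complex.re h
        simp at this
        exact (ne_of_gt hε) this
      have hn : ‖(ε + (2 * Real.pi * ξ : ℝ) * Complex.I : ℂ) ^ (-(q : ℂ))‖ =
          ‖(ε + (2 * Real.pi * ξ : ℝ) * Complex.I : ℂ)‖ ^ (-q) := by
        rw [← Complex.ofReal_neg, Complex.norm_cpow_real]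
      rw [hn]
      have hle : |2 * Real.pi * ξ| ≤ ‖(ε + (2 * Real.pi * ξ : ℝ) * Complex.I : ℂ)‖ := by
        simpa using Complex.abs_im_le_norm (ε + (2 * Real.pi * ξ : ℝ) * Complex.I : ℂ)
      have hG := (Real.Gamma_pos_of_pos hq).le
      exact mul_le_mul_of_nonneg_left (mul_le_mul_of_nonneg_right
        (Real.rpow_le_rpow_of_nonpos hη hle (neg_nonpos.2 hq.le)) (norm_nonneg _)) hG
    · filter_upwards [hne] with ξ hξ
      have hsl : ((0 : ℝ) + (2 * Real.pi * ξ : ℝ) * Complex.I : ℂ) ∈ Complex.slitPlane := by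
        right; simpa [Real.pi_ne_zero] using hξ
      have h1 : ContinuousAt (fun ε : ℝ =>
          (ε + (2 * Real.pi * ξ : ℝ) * Complex.I : ℂ) ^ (-(q : ℂ))) 0 :=
        ContinuousAt.cpow (by fun_prop) continuousAt_const hsl
      have h2 : ContinuousAt (fun ε : ℝ => Real.Gamma q *
        ((ε + (2 * Real.pi * ξ : ℝ) * Complex.I : ℂ) ^ (-(q : ℂ)) *
        (𝓕 F ξ * Complex.exp (2 * Real.pi * Complex.I * ξ * x)))) 0 := by fun_prop
      have h3 := h2.tendsto.mono_left (nhdsWithin_le_nhds (s := Ioi 0))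
      simpa using h3
  rw [← integral_const_mul]
  refine tendsto_nhds_unique hL (hR.congr' ?_)
  filter_upwards [self_mem_nhdsWithin] with ε hε
  exact (integral_rpow_mul_exp_translate hc hF hF' hq hε x).symm

/-! ### Smooth functions of compact support and their Fourier transforms -/

/-- A `C⁷` function vanishing outside `(a, b)` whose derivatives up to order seven are bounded
by `M`. -/
structure IsBump (a b M : ℝ) (g : ℝ → ℝ) : Prop where
  contDiff : ContDiff ℝ 7 g
  zero : ∀ x ∉ Ioo a b, g x = 0
  bound : ∀ j : ℕ, j ≤ 7 → ∀ x, |iteratedDeriv j g x| ≤ M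

/-- The Fourier transform of a real function on the line. -/
def ft (g : ℝ → ℝ) : ℝ → ℂ := 𝓕 fun x => (g x : ℂ)

namespace IsBump
variable {a b M : ℝ} {g : ℝ → ℝ}

lemma nonneg (h : IsBump a b M g) : 0 ≤ M := (abs_nonneg _).trans (h.bound 0 (by norm_num) 0)

lemma contDiff_nat (h : IsBump a b M g) {j : ℕ} (hj : j ≤ 7) : ContDiff ℝ j g :=
  h.contDiff.of_le (by exact_mod_cast hj)

lemma hasDerivAt_iteratedDeriv (h : IsBump a b M g) {j : ℕ} (hj : j < 7) (x : ℝ) :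
    HasDerivAt (iteratedDeriv j g) (iteratedDeriv (j + 1) g x) x := by
  rw [iteratedDeriv_succ]
  exact (h.contDiff.differentiable_iteratedDeriv j (by exact_mod_cast hj) x).hasDerivAt

lemma continuous_iteratedDeriv (h : IsBump a b M g) {j : ℕ} (hj : j ≤ 7) :
    Continuous (iteratedDeriv j g) := h.contDiff.continuous_iteratedDeriv j (by exact_mod_cast hj)

lemma iteratedDeriv_eq_zero (h : IsBump a b M g) (j : ℕ) {x : ℝ} (hx : x ∉ Icc a b) :
    iteratedDeriv j g x = 0 := by
  have h0 : g =ᶠ[𝓝 x] fun _ => 0 := by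
    filter_upwards [isClosed_Icc.isOpen_compl.mem_nhds hx] with y hy
    exact h.zero y fun hy' => hy (Ioo_subset_Icc_self hy')
  rw [(h0.iteratedDeriv_eq j)]
  simp

lemma hasCompactSupport_iteratedDeriv (h : IsBump a b M g) (j : ℕ) :
    HasCompactSupport (iteratedDeriv j g) :=
  HasCompactSupport.intro isCompact_Icc fun _ hx => h.iteratedDeriv_eq_zero j hx

lemma iteratedDeriv_ofReal (h : IsBump a b M g) {j : ℕ} (hj : j ≤ 7) :
    iteratedDeriv j (fun x => (g x : ℂ)) = fun x => ((iteratedDeriv j g x : ℝ) : ℂ) := by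
  induction j with
  | zero => simp
  | succ j ih =>
    rw [iteratedDeriv_succ, ih (by omega)]
    ext x
    exact (h.hasDerivAt_iteratedDeriv (by omega) x).ofReal_comp.deriv

lemma integrable_iteratedDeriv (h : IsBump a b M g) {j : ℕ} (hj : j ≤ 7) :
    Integrable (iteratedDeriv j g) :=
  (h.continuous_iteratedDeriv hj).integrable_of_hasCompactSupport
    (h.hasCompactSupport_iteratedDeriv j)

lemma ft_iteratedDeriv (h : IsBump a b M g) {j : ℕ} (hj : j ≤ 7) (ξ : ℝ) :
    ft (iteratedDeriv j g) ξ = ((2 * Real.pi * ξ : ℝ) * Complex.I) ^ j * ft g ξ := by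
  have hf : ContDiff ℝ (7 : ℕ∞) (fun x => (g x : ℂ)) :=
    Complex.ofRealCLM.contDiff.comp h.contDiff
  have hi : ∀ n : ℕ, (n : ℕ∞) ≤ (7 : ℕ∞) → Integrable (iteratedDeriv n fun x => (g x : ℂ)) := by
    intro n hn
    have hn' : n ≤ 7 := by exact_mod_cast hn
    rw [h.iteratedDeriv_ofReal hn']
    exact (h.integrable_iteratedDeriv hn').ofReal
  have h1 := congrFun (Real.fourier_iteratedDeriv hf hi (n := j) (by exact_mod_cast hj)) ξ
  rw [h.iteratedDeriv_ofReal hj] at h1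
  rw [ft, h1, smul_eq_mul, ft]
  congr 2; push_cast; ring

lemma norm_ft_iteratedDeriv_le (h : IsBump a b M g) (hab : a ≤ b) {j : ℕ} (hj : j ≤ 7) (ξ : ℝ) :
    ‖ft (iteratedDeriv j g) ξ‖ ≤ (b - a) * M := by
  rw [ft, Real.fourier_real_eq_integral_exp_smul]
  have h0 : ∀ x ∉ Icc a b, Complex.exp (((-2 * Real.pi * x * ξ : ℝ) : ℂ) * Complex.I) •
      ((iteratedDeriv j g x : ℝ) : ℂ) = 0 := fun x hx => by simp [h.iteratedDeriv_eq_zero j hx]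
  rw [← setIntegral_eq_integral_of_forall_compl_eq_zero h0]
  refine (norm_setIntegral_le_of_norm_le_const (C := M) (by simp) fun x _ => ?_).trans ?_
  · rw [norm_smul, Complex.norm_exp_ofReal_mul_I, one_mul, Complex.norm_real]
    exact h.bound j hj x
  · simp [measureReal_def, hab, mul_comm]

lemma pow_mul_norm_ft_le (h : IsBump a b M g) (hab : a ≤ b) {j : ℕ} (hj : j ≤ 7) (ξ : ℝ) :
    |2 * Real.pi * ξ| ^ j * ‖ft g ξ‖ ≤ (b - a) * M := by
  have := h.norm_ft_iteratedDeriv_le hab hj ξ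
  rwa [h.ft_iteratedDeriv hj, norm_mul, norm_pow, norm_mul, Complex.norm_I, mul_one,
    Complex.norm_real, Real.norm_eq_abs] at this

/-- The Fourier transform of a `C⁷` bump decays like `|ξ|^{-7}`. -/
lemma norm_ft_le (h : IsBump a b M g) (hab : a ≤ b) (ξ : ℝ) :
    ‖ft g ξ‖ ≤ 128 * ((b - a) * M) * (1 + |2 * Real.pi * ξ|) ^ (-7 : ℝ) := by
  have h0 := h.pow_mul_norm_ft_le hab (j := 0) (by norm_num) ξ
  have h7 := h.pow_mul_norm_ft_le hab (j := 7) le_rfl ξ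
  have hp : 0 ≤ |2 * Real.pi * ξ| := abs_nonneg _
  have hpow : (1 + |2 * Real.pi * ξ|) ^ 7 ≤ 2 ^ 6 * (1 ^ 7 + |2 * Real.pi * ξ| ^ 7) :=
    add_pow_le zero_le_one hp 7
  rw [show (-7 : ℝ) = -((7 : ℕ) : ℝ) by norm_num, Real.rpow_neg (by positivity), Real.rpow_natCast,
    ← div_eq_mul_inv, le_div_iff₀ (by positivity)]
  have := mul_le_mul_of_nonneg_left hpow (norm_nonneg (ft g ξ))
  nlinarith

lemma continuous_ft (h : IsBump a b M g) : Continuous (ft g) := by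
  have hi : Integrable (fun x => (g x : ℂ)) := by
    simpa using (h.integrable_iteratedDeriv (j := 0) (by norm_num)).ofReal (𝕜 := ℂ)
  exact VectorFourier.fourierIntegral_continuous Real.continuous_fourierChar
    (by fun_prop) hi

lemma rpow_mul_norm_ft_le (h : IsBump a b M g) (hab : a ≤ b) {s : ℝ} (hs : 0 ≤ s) (ξ : ℝ) :
    |2 * Real.pi * ξ| ^ s * ‖ft g ξ‖ ≤
      128 * ((b - a) * M) * (1 + |2 * Real.pi * ξ|) ^ (s - 7) := by
  have hp : 0 ≤ |2 * Real.pi * ξ| := abs_nonneg _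
  have h1 : |2 * Real.pi * ξ| ^ s ≤ (1 + |2 * Real.pi * ξ|) ^ s :=
    Real.rpow_le_rpow hp (by linarith) hs
  calc _ ≤ (1 + |2 * Real.pi * ξ|) ^ s *
        (128 * ((b - a) * M) * (1 + |2 * Real.pi * ξ|) ^ (-7 : ℝ)) := by
        gcongr; exact h.norm_ft_le hab ξ
    _ = _ := by
        rw [sub_eq_add_neg s, Real.rpow_add (by positivity)]; ring

end IsBump

lemma integrable_one_add_rpow {s : ℝ} (hs : s < 6) :
    Integrable fun ξ : ℝ => (1 + |2 * Real.pi * ξ|) ^ (s - 7) := by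
  have h := integrable_one_add_norm (E := ℝ) (μ := volume) (r := 7 - s) (by
    simp; linarith)
  have h' := h.comp_mul_left' (R := 2 * Real.pi) (by positivity)
  simpa using h'

namespace IsBump
variable {a b M : ℝ} {g : ℝ → ℝ}

lemma integrable_rpow_mul_ft (h : IsBump a b M g) (hab : a ≤ b) {s : ℝ} (hs : 0 ≤ s)
    (hs6 : s < 6) : Integrable fun ξ : ℝ => |2 * Real.pi * ξ| ^ s * ‖ft g ξ‖ := by
  refine ((integrable_one_add_rpow hs6).const_mul (128 * ((b - a) * M))).mono' ?_
    (Eventually.of_forall fun ξ => ?_)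
  · exact (Continuous.mul (Continuous.rpow_const (by fun_prop) fun _ => Or.inr hs)
      h.continuous_ft.norm).aestronglyMeasurable
  · rw [Real.norm_of_nonneg (by positivity)]
    exact h.rpow_mul_norm_ft_le hab hs ξ

lemma integral_rpow_mul_ft_le (h : IsBump a b M g) (hab : a ≤ b) {s : ℝ} (hs : 0 ≤ s)
    (hs6 : s < 6) : ∫ ξ : ℝ, |2 * Real.pi * ξ| ^ s * ‖ft g ξ‖ ≤
      128 * ((b - a) * M) * ∫ ξ : ℝ, (1 + |2 * Real.pi * ξ|) ^ (s - 7) := by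
  rw [← integral_const_mul]
  exact integral_mono (h.integrable_rpow_mul_ft hab hs hs6)
    ((integrable_one_add_rpow hs6).const_mul _) fun ξ => h.rpow_mul_norm_ft_le hab hs ξ

lemma comp_neg (h : IsBump a b M g) : IsBump (-b) (-a) M (fun x => g (-x)) where
  contDiff := h.contDiff.comp contDiff_neg
  zero x hx := h.zero _ fun hx' => hx ⟨by linarith [hx'.2], by linarith [hx'.1]⟩
  bound j hj x := by
    rw [iteratedDeriv_comp_neg]
    simpa [abs_mul] using h.bound j hj (-x)

end IsBump

lemma ft_comp_neg (g : ℝ → ℝ) (ξ : ℝ) : ft (fun x => g (-x)) ξ = ft g (-ξ) := by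
  rw [ft, ft, Real.fourier_real_eq_integral_exp_smul, Real.fourier_real_eq_integral_exp_smul,
    ← integral_neg_eq_self]
  congr 1; ext x; simp

/-! ### Fourier symbols of the Riemann–Liouville and Riesz derivatives -/

lemma convolution_rlKernel (q : ℝ) (f : ℝ → ℝ) (x : ℝ) :
    (rlKernel q ⋆[ContinuousLinearMap.mul ℝ ℝ] f) x =
      ∫ s in Ioi (0 : ℝ), s ^ (q - 1) * f (x - s) := by
  rw [convolution_def, ← integral_indicator measurableSet_Ioi]
  congr 1; ext s
  by_cases hs : s ∈ Ioi (0 : ℝ) <;> simp [rlKernel, hs]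

/-- The weakly singular integral in the left Riemann–Liouville derivative, for a function vanishing
to the left of `a`, is a convolution over the whole line. -/
lemma integral_div_rpow_eq_convolution {a : ℝ} {g : ℝ → ℝ} (hg : ∀ x ≤ a, g x = 0) (q z : ℝ) :
    ∫ ξ in a..z, g ξ / (z - ξ) ^ (1 - q) =
      (rlKernel q ⋆[ContinuousLinearMap.mul ℝ ℝ] g) z := by
  have hconv : (rlKernel q ⋆[ContinuousLinearMap.mul ℝ ℝ] g) z =
      ∫ ξ, rlKernel q (z - ξ) * g ξ := by
    rw [convolution_def, ← integral_sub_left_eq_self _ _ z]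
    simp
  rw [hconv]
  rcases le_or_gt a z with haz | haz
  · rw [intervalIntegral.integral_of_le haz, integral_Ioc_eq_integral_Ioo,
      ← setIntegral_eq_integral_of_forall_compl_eq_zero (s := Ioo a z)
        (f := fun ξ => rlKernel q (z - ξ) * g ξ)]
    · refine setIntegral_congr_fun measurableSet_Ioo fun ξ hξ => ?_
      have h0 : 0 < z - ξ := by linarith [hξ.2]
      rw [rlKernel, indicator_of_mem (mem_Ioi.2 h0), ← neg_sub 1 q, Real.rpow_neg h0.le]
      field_simp
    · intro ξ hξ
      rcases le_or_gt ξ a with h | h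
      · simp [hg ξ h]
      · have : ¬ (0 < z - ξ) := fun h' => hξ ⟨h, by linarith⟩
        simp [rlKernel, this]
  · rw [intervalIntegral.integral_of_ge haz.le, setIntegral_eq_zero_of_forall_eq_zero, neg_zero,
      integral_eq_zero_of_ae]
    · refine Eventually.of_forall fun ξ => ?_
      rcases le_or_gt ξ a with h | h
      · simp [hg ξ h]
      · have : ¬ (0 < z - ξ) := fun h' => by linarith
        simp [rlKernel, this]
    · intro ξ hξ; simp [hg ξ hξ.2]

namespace IsBump
variable {a b M : ℝ} {g : ℝ → ℝ}

lemma iteratedDeriv_convolution (h : IsBump a b M g) {q : ℝ} (hq : 0 < q) {n : ℕ} (hn : n ≤ 7) :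
    iteratedDeriv n (rlKernel q ⋆[ContinuousLinearMap.mul ℝ ℝ] g) =
      (rlKernel q ⋆[ContinuousLinearMap.mul ℝ ℝ] iteratedDeriv n g) := by
  induction n with
  | zero => simp
  | succ n ih =>
    rw [iteratedDeriv_succ, ih (by omega)]
    ext x
    have hc : ContDiff ℝ 1 (iteratedDeriv n g) := by
      rw [iteratedDeriv_eq_iterate]
      exact ContDiff.iterate_deriv' 1 n (h.contDiff_nat (by omega))
    rw [((h.hasCompactSupport_iteratedDeriv n).hasDerivAt_convolution_right _
      (locallyIntegrable_rlKernel hq) hc x).deriv, iteratedDeriv_succ]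

end IsBump

lemma rlOrder_pos (γ : ℝ) : 0 < rlOrder γ := Nat.succ_pos _

lemma lt_rlOrder (γ : ℝ) : γ < rlOrder γ := by
  simpa [rlOrder] using Nat.lt_floor_add_one γ

lemma rlOrder_le_three {γ : ℝ} (hγ2 : γ ≤ 2) : rlOrder γ ≤ 3 := by
  have : ⌊γ⌋₊ ≤ 2 := by
    simpa using Nat.floor_mono hγ2
  rw [rlOrder]; omega

namespace IsBump
variable {a b M : ℝ} {g : ℝ → ℝ}

/-- The left Riemann–Liouville derivative has Fourier symbol `(2πiξ)^γ`. -/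
lemma leftRL_eq (h : IsBump a b M g) (hab : a ≤ b) {γ : ℝ} (hγ : 0 < γ) (hγ2 : γ ≤ 2) (x : ℝ) :
    (leftRL γ a g x : ℂ) = ∫ ξ, ((2 * Real.pi * ξ : ℝ) * Complex.I) ^ (γ : ℂ) *
        (ft g ξ * Complex.exp (2 * Real.pi * Complex.I * ξ * x)) := by
  obtain ⟨n, hn⟩ : ∃ n, n = rlOrder γ := ⟨_, rfl⟩
  have hn3 : n ≤ 3 := hn ▸ rlOrder_le_three hγ2
  have hn7 : n ≤ 7 := hn3.trans (by norm_num)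
  have hn0 : n ≠ 0 := hn ▸ (rlOrder_pos γ).ne'
  obtain ⟨q, hq⟩ : ∃ q : ℝ, q = n - γ := ⟨_, rfl⟩
  have hq0 : 0 < q := by rw [hq, hn]; exact sub_pos.2 (lt_rlOrder γ)
  have hg0 : ∀ x ≤ a, g x = 0 := fun x hx => h.zero x fun hx' => not_lt.2 hx hx'.1
  have h1 : (fun z => ∫ ξ in a..z, g ξ / (z - ξ) ^ (γ - n + 1)) =
      rlKernel q ⋆[ContinuousLinearMap.mul ℝ ℝ] g := by
    ext z
    rw [← integral_div_rpow_eq_convolution hg0, show 1 - q = γ - n + 1 by rw [hq]; ring]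
  have hFt : ∀ ξ, 𝓕 (fun x => ((iteratedDeriv n g x : ℝ) : ℂ)) ξ =
      ((2 * Real.pi * ξ : ℝ) * Complex.I) ^ n * ft g ξ := h.ft_iteratedDeriv hn7
  have hnorm : ∀ ξ, ‖𝓕 (fun x => ((iteratedDeriv n g x : ℝ) : ℂ)) ξ‖ =
      |2 * Real.pi * ξ| ^ (n : ℝ) * ‖ft g ξ‖ := fun ξ => by
    rw [hFt, norm_mul, norm_pow, norm_mul, Complex.norm_I, mul_one, Complex.norm_real,
      Real.norm_eq_abs, Real.rpow_natCast]
  have hn6 : (n : ℝ) < 6 := by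
    have : n < 6 := by omega
    exact_mod_cast this
  have hcont : Continuous (fun x => ((iteratedDeriv n g x : ℝ) : ℂ)) :=
    Complex.continuous_ofReal.comp (h.continuous_iteratedDeriv hn7)
  have hcs : HasCompactSupport (fun x => ((iteratedDeriv n g x : ℝ) : ℂ)) :=
    (h.hasCompactSupport_iteratedDeriv n).comp_left Complex.ofReal_zero
  have hFm : AEStronglyMeasurable (𝓕 (fun x => ((iteratedDeriv n g x : ℝ) : ℂ))) volume := by
    rw [funext hFt]
    have := h.continuous_ft
    exact Continuous.aestronglyMeasurable (by fun_prop)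
  have hF' : Integrable (𝓕 (fun x => ((iteratedDeriv n g x : ℝ) : ℂ))) := by
    refine (integrable_norm_iff hFm).1 ?_
    rw [funext hnorm]
    exact h.integrable_rpow_mul_ft hab (Nat.cast_nonneg n) hn6
  have hF'' : Integrable fun ξ : ℝ => |2 * Real.pi * ξ| ^ (-q) *
      ‖𝓕 (fun x => ((iteratedDeriv n g x : ℝ) : ℂ)) ξ‖ := by
    refine (h.integrable_rpow_mul_ft hab hγ.le (by linarith)).congr ?_
    have hne : ∀ᵐ ξ : ℝ, ξ ≠ 0 := by simp [ae_iff, measure_singleton]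
    filter_upwards [hne] with ξ hξ
    have hη : 0 < |2 * Real.pi * ξ| := abs_pos.2 (by have := Real.pi_pos; positivity)
    rw [hnorm, ← mul_assoc, ← Real.rpow_add hη, hq]
    congr 2; ring
  have key := integral_rpow_mul_translate hcont hcs hF' hq0 hF'' x
  have hG : (Real.Gamma q : ℂ) ≠ 0 := by exact_mod_cast (Real.Gamma_pos_of_pos hq0).ne'
  rw [leftRL, ← hn, ← hq, h1, h.iteratedDeriv_convolution hq0 hn7, convolution_rlKernel,
    Complex.ofReal_mul, ← integral_complex_ofReal]
  have h2 : ∫ s in Ioi (0 : ℝ), ((s ^ (q - 1) * iteratedDeriv n g (x - s) : ℝ) : ℂ) =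
      ∫ s in Ioi (0 : ℝ), ((s ^ (q - 1) : ℝ) : ℂ) * ((iteratedDeriv n g (x - s) : ℝ) : ℂ) := by
    congr 1; ext s; push_cast; rfl
  rw [h2, key]
  push_cast
  rw [one_div, inv_mul_cancel_left₀ hG]
  congr 1; ext ξ
  have := hFt ξ
  push_cast at this
  have hc : (2 * (Real.pi : ℂ) * ξ * Complex.I) ^ (γ : ℂ) =
      (2 * (Real.pi : ℂ) * ξ * Complex.I) ^ (-(q : ℂ)) *
        (2 * (Real.pi : ℂ) * ξ * Complex.I) ^ n := by
    rcases eq_or_ne ξ 0 with rfl | hξ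
    · simp [hn0, hγ.ne']
    · have hz : (2 * (Real.pi : ℂ) * ξ * Complex.I) ≠ 0 := by simp [hξ, Real.pi_ne_zero]
      rw [← Complex.cpow_natCast, ← Complex.cpow_add _ _ hz, hq]
      congr 1; push_cast; ring
  rw [this, hc]
  ring

lemma rightRL_eq_leftRL (γ b : ℝ) (g : ℝ → ℝ) (x : ℝ) :
    rightRL γ b g x = leftRL γ (-b) (fun x => g (-x)) (-x) := by
  have h : (fun z => ∫ ξ in -b..z, g (-ξ) / (z - ξ) ^ (γ - rlOrder γ + 1)) =
      fun z => (fun z => ∫ ξ in z..b, g ξ / (ξ - z) ^ (γ - rlOrder γ + 1)) (-z) := by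
    ext z
    have := intervalIntegral.integral_comp_neg (a := -b) (b := z)
      (fun ξ => g ξ / (ξ - -z) ^ (γ - rlOrder γ + 1))
    rw [neg_neg] at this
    simp only
    rw [← this]
    congr 1; ext ξ; congr 2; ring
  rw [rightRL, leftRL, h, iteratedDeriv_comp_neg
    (f := fun z => ∫ ξ in z..b, g ξ / (ξ - z) ^ (γ - rlOrder γ + 1)), neg_neg]
  simp only [smul_eq_mul]
  ring

/-- The right Riemann–Liouville derivative has Fourier symbol `(-2πiξ)^γ`. -/
lemma rightRL_eq (h : IsBump a b M g) (hab : a ≤ b) {γ : ℝ} (hγ : 0 < γ) (hγ2 : γ ≤ 2) (x : ℝ) :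
    (rightRL γ b g x : ℂ) = ∫ ξ, (-((2 * Real.pi * ξ : ℝ) * Complex.I)) ^ (γ : ℂ) *
        (ft g ξ * Complex.exp (2 * Real.pi * Complex.I * ξ * x)) := by
  rw [rightRL_eq_leftRL, h.comp_neg.leftRL_eq (by linarith) hγ hγ2, ← integral_neg_eq_self]
  congr 1; ext ξ
  rw [ft_comp_neg, neg_neg]
  congr 2
  · push_cast; ring
  · congr 1; push_cast; ring

end IsBump

/-- The symbols of the two one-sided derivatives add up to a real multiple of `|η|^γ`. -/
lemma cpow_add_cpow_neg {γ : ℝ} (hγ : 0 < γ) (η : ℝ) :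
    (η * Complex.I) ^ (γ : ℂ) + (-(η * Complex.I)) ^ (γ : ℂ) =
      ((2 * Real.cos (Real.pi * γ / 2) * |η| ^ γ : ℝ) : ℂ) := by
  have main : ∀ η : ℝ, 0 < η → (η * Complex.I) ^ (γ : ℂ) + (-(η * Complex.I)) ^ (γ : ℂ) =
      ((2 * Real.cos (Real.pi * γ / 2) * |η| ^ γ : ℝ) : ℂ) := by
    intro η hη
    have hη' : (η : ℂ) ≠ 0 := by exact_mod_cast hη.ne'
    rw [← mul_neg, Complex.cpow_def_of_ne_zero (by simp [hη']), Complex.cpow_def_of_ne_zero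
      (by simp [hη']), Complex.log_ofReal_mul hη (by simp), Complex.log_ofReal_mul hη (by simp),
      Complex.log_I, Complex.log_neg_I, abs_of_pos hη, Real.rpow_def_of_pos hη]
    push_cast
    rw [Complex.cos, add_mul, add_mul, Complex.exp_add, Complex.exp_add]
    ring_nf
  rcases lt_trichotomy η 0 with h | rfl | h
  · have := main (-η) (by linarith)
    rw [abs_neg] at this
    rw [← this, add_comm]
    push_cast
    simp
  · simp [hγ.ne', Real.zero_rpow hγ.ne']
  · exact main η h

lemma cos_ne_zero_of_exponent {γ : ℝ} (hγ : 0 < γ) (hγ2 : γ ≤ 2) (hγ1 : γ ≠ 1) :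
    Real.cos (Real.pi * γ / 2) ≠ 0 := by
  have hpi := Real.pi_pos
  rcases lt_or_gt_of_ne hγ1 with h | h
  · exact (Real.cos_pos_of_mem_Ioo ⟨by nlinarith, by nlinarith⟩).ne'
  · exact (Real.cos_neg_of_pi_div_two_lt_of_lt (by nlinarith) (by nlinarith)).ne

/-- The Riesz derivative has Fourier symbol `-|2πξ|^γ`. -/
theorem IsBump.riesz_eq {a b M : ℝ} {g : ℝ → ℝ} (h : IsBump a b M g) (hab : a ≤ b) {γ : ℝ}
    (hγ : 0 < γ) (hγ2 : γ ≤ 2) (hγ1 : γ ≠ 1) (x : ℝ) :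
    (riesz γ a b g x : ℂ) = -∫ ξ, ((|2 * Real.pi * ξ| ^ γ : ℝ) : ℂ) *
        (ft g ξ * Complex.exp (2 * Real.pi * Complex.I * ξ * x)) := by
  have hi : ∀ m : ℝ → ℂ, Measurable m → (∀ ξ, ‖m ξ‖ ≤ |2 * Real.pi * ξ| ^ γ) → Integrable fun ξ =>
      m ξ * (ft g ξ * Complex.exp (2 * Real.pi * Complex.I * ξ * x)) := by
    intro m hm hle
    refine (h.integrable_rpow_mul_ft hab hγ.le (by linarith)).mono' ?_
      (Eventually.of_forall fun ξ => ?_)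
    · refine hm.aestronglyMeasurable.mul ?_
      have := h.continuous_ft
      exact Continuous.aestronglyMeasurable (by fun_prop)
    · rw [norm_mul, norm_mul, norm_cexp_fourier, mul_one]
      exact mul_le_mul_of_nonneg_right (hle ξ) (norm_nonneg _)
  have hcos := cos_ne_zero_of_exponent hγ hγ2 hγ1
  have hn : ∀ η : ℝ, ‖(η * Complex.I : ℂ) ^ (γ : ℂ)‖ = |η| ^ γ := fun η => by
    rw [Complex.norm_cpow_real, norm_mul, Complex.norm_I, mul_one, Complex.norm_real,
      Real.norm_eq_abs]
  have hi1 := hi (fun ξ => ((2 * Real.pi * ξ : ℝ) * Complex.I) ^ (γ : ℂ)) (by fun_prop)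
    fun ξ => (hn _).le
  have hi2 := hi (fun ξ => (-((2 * Real.pi * ξ : ℝ) * Complex.I)) ^ (γ : ℂ)) (by fun_prop)
    fun ξ => by
      have := hn (-(2 * Real.pi * ξ))
      rw [abs_neg, Complex.ofReal_neg, neg_mul] at this
      exact this.le
  rw [riesz, Complex.ofReal_mul, Complex.ofReal_add, h.leftRL_eq hab hγ hγ2,
    h.rightRL_eq hab hγ hγ2, ← integral_add hi1 hi2, ← integral_const_mul, ← integral_neg]
  congr 1; ext ξ
  rw [← add_mul, cpow_add_cpow_neg hγ, ← mul_assoc, ← Complex.ofReal_mul, ← neg_mul,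
    ← Complex.ofReal_neg]
  congr 2
  field_simp

/-! ### The symbol of the compact difference -/

/-- Second-order expansion of `(1 - e)^γ` at `e = 0`. -/
lemma abs_one_sub_rpow_sub_le {γ e : ℝ} (hγ : 0 < γ) (hγ2 : γ ≤ 2) (he : 0 ≤ e) (he6 : e ≤ 1 / 6) :
    |(1 - e) ^ γ - (1 - γ * e)| ≤ 2 * e ^ 2 := by
  have h1e : 0 < 1 - e := by linarith
  rcases le_or_gt 1 γ with h1 | h1
  · have hl : 1 + γ * (-e) ≤ (1 + -e) ^ γ := one_add_mul_self_le_rpow_one_add (by linarith) h1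
    have hu : (1 + -e) ^ (γ - 1) ≤ 1 + (γ - 1) * (-e) :=
      rpow_one_add_le_one_add_mul_self (by linarith) (by linarith) (by linarith)
    rw [← sub_eq_add_neg] at hl hu
    have hs : (1 - e) ^ γ = (1 - e) ^ (γ - 1) * (1 - e) := by
      rw [← Real.rpow_add_one h1e.ne', sub_add_cancel]
    have := mul_le_mul_of_nonneg_right hu h1e.le
    rw [← hs] at this
    rw [abs_le]
    constructor <;> nlinarith [sq_nonneg e]
  · have hu : (1 + -e) ^ γ ≤ 1 + γ * (-e) :=
      rpow_one_add_le_one_add_mul_self (by linarith) hγ.le h1.le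
    have hl : 1 + (γ + 1) * (-e) ≤ (1 + -e) ^ (γ + 1) :=
      one_add_mul_self_le_rpow_one_add (by linarith) (by linarith)
    rw [← sub_eq_add_neg] at hl hu
    rw [Real.rpow_add_one h1e.ne'] at hl
    rw [abs_le]
    have he3 : 0 ≤ e * e ^ 2 := mul_nonneg he (sq_nonneg e)
    constructor
    · by_contra! hc
      have := mul_lt_mul_of_pos_right hc h1e
      nlinarith [sq_nonneg e]
    · nlinarith [sq_nonneg e]

/-- The symbol of the compact fractional difference `∑ ϱ_r e^{irθ} ∑ ω_k e^{ikθ}` agrees with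
`|θ|^γ` to fourth relative order. -/
lemma abs_compact_symbol_sub_le {γ : ℝ} (hγ : 0 < γ) (hγ2 : γ ≤ 2) (θ : ℝ) :
    |(1 + γ / 12 * (1 - Real.cos θ)) * (2 * |Real.sin (θ / 2)|) ^ γ - |θ| ^ γ| ≤
      |θ| ^ (γ + 4) := by
  wlog hθ : 0 < θ generalizing θ
  · rcases eq_or_ne θ 0 with rfl | h0
    · simp [Real.zero_rpow hγ.ne', Real.zero_rpow (show γ + 4 ≠ 0 by linarith)]
    · have := this (-θ) (neg_pos.2 (lt_of_le_of_ne (not_lt.1 hθ) h0))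
      simpa [neg_div] using this
  rw [abs_of_pos hθ]
  obtain ⟨t, rfl⟩ : ∃ t, θ = 2 * t := ⟨θ / 2, by ring⟩
  have ht : 0 < t := by linarith
  rw [mul_div_cancel_left₀ _ two_ne_zero, Real.cos_two_mul', ← Real.cos_sq_add_sin_sq t,
    show γ / 12 * (Real.cos t ^ 2 + Real.sin t ^ 2 - (Real.cos t ^ 2 - Real.sin t ^ 2)) =
      γ / 6 * Real.sin t ^ 2 by ring, Real.cos_sq_add_sin_sq,
    Real.rpow_add (by positivity), show (4 : ℝ) = (4 : ℕ) by norm_num, Real.rpow_natCast]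
  have hP : 0 < (2 * t) ^ γ := by positivity
  have hs1 : |Real.sin t| ≤ t := by
    have := Real.abs_sin_le_abs (x := t); rwa [abs_of_pos ht] at this
  have hle : (2 * |Real.sin t|) ^ γ ≤ (2 * t) ^ γ :=
    Real.rpow_le_rpow (by positivity) (by linarith) hγ.le
  have hnn : 0 ≤ (2 * |Real.sin t|) ^ γ := by positivity
  rcases le_or_gt 1 t with h1 | h1
  -- Away from the origin both symbols are at most `2 |θ|^γ`, and `|θ|⁴ ≥ 16`.
  · have hsq := Real.sin_sq_le_one t
    have hsq0 := sq_nonneg (Real.sin t)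
    have h16 : (16 : ℝ) ≤ (2 * t) ^ 4 := by
      calc (16 : ℝ) = (2 * 1) ^ 4 := by norm_num
        _ ≤ (2 * t) ^ 4 := by gcongr
    have hA : 1 + γ / 6 * Real.sin t ^ 2 ≤ 2 := by nlinarith
    have hA0 : 0 ≤ 1 + γ / 6 * Real.sin t ^ 2 := by positivity
    have hB := mul_le_mul hA hle hnn zero_le_two
    have hB0 := mul_nonneg hA0 hnn
    rw [abs_le]
    constructor <;> nlinarith
  -- Near the origin, with `sin t = (1 - e) t` and `e = t²/6 + O(t⁴)`, the relative error is
  -- `(1 + γ/6 · sin² t) (1 - e)^γ - 1`, and the terms `±γ t²/6` cancel.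
  · obtain ⟨q, hq⟩ : ∃ q, q = Real.sin t / t := ⟨_, rfl⟩
    have hst : Real.sin t = q * t := by rw [hq, div_mul_cancel₀ _ ht.ne']
    have hb := Real.sin_bound (x := t) (by rw [abs_of_pos ht]; exact h1.le)
    have hs0 : 0 < Real.sin t := Real.sin_pos_of_pos_of_lt_pi ht (by
      have := Real.pi_gt_three; linarith)
    have hge := Real.sin_ge_sub_cube ht.le
    have hq0 : 0 < q := by rw [hq]; positivity
    rw [abs_of_pos ht, hst] at hb
    rw [hst] at hge
    obtain ⟨e, he⟩ : ∃ e, e = 1 - q := ⟨_, rfl⟩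
    have hqe : q = 1 - e := by linarith
    have ht2 : t ^ 2 ≤ 1 := by nlinarith
    have he0 : 0 ≤ e := by
      rw [abs_of_pos hs0, hst] at hs1
      nlinarith
    have heu : e ≤ t ^ 2 / 6 := by
      have : (1 - t ^ 2 / 6) * t ≤ q * t := by linear_combination hge
      have := le_of_mul_le_mul_right this ht
      linarith
    have hel : t ^ 2 / 6 - e ≤ t ^ 4 / 100 := by
      have h2 := (abs_le.1 hb).2
      have : (t ^ 2 / 6 - e) * t ≤ t ^ 4 / 100 * t := by
        rw [he]; nlinarith
      exact le_of_mul_le_mul_right this ht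
    have hρ := abs_one_sub_rpow_sub_le hγ hγ2 he0 (by linarith)
    have hqq : (1 - 2 * e) ≤ q ^ γ := by
      have h3 : q ^ (2 : ℝ) ≤ q ^ γ := Real.rpow_le_rpow_of_exponent_ge hq0 (by linarith) hγ2
      rw [Real.rpow_two] at h3
      nlinarith [sq_nonneg e]
    have hq1 : q ^ γ ≤ 1 := Real.rpow_le_one hq0.le (by linarith) hγ.le
    have hfac : (2 * |Real.sin t|) ^ γ = (2 * t) ^ γ * q ^ γ := by
      rw [abs_of_pos hs0, hst, ← Real.mul_rpow (by positivity) hq0.le]; congr 1; ring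
    have hkey : |(1 + γ / 6 * (q * t) ^ 2) * q ^ γ - 1| ≤ (2 * t) ^ 4 := by
      rw [← hqe] at hρ
      obtain ⟨hρ1, hρ2⟩ := abs_le.1 hρ
      have he2 : e ^ 2 ≤ t ^ 4 / 36 := by
        calc e ^ 2 ≤ (t ^ 2 / 6) ^ 2 := by gcongr
          _ = _ := by ring
      have hA1 : q ^ 2 * q ^ γ ≤ 1 := by
        have : q ^ 2 ≤ 1 := by nlinarith
        nlinarith [sq_nonneg q, Real.rpow_nonneg hq0.le γ]
      have hA2 : 1 - 4 * e ≤ q ^ 2 * q ^ γ := by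
        have h5 : (1 - 2 * e) ≤ q ^ 2 := by rw [hqe]; nlinarith [sq_nonneg e]
        have h6 : (0 : ℝ) ≤ 1 - 2 * e := by linarith
        nlinarith [mul_le_mul h5 hqq h6 (sq_nonneg q), sq_nonneg e]
      have hdec : (1 + γ / 6 * (q * t) ^ 2) * q ^ γ - 1 =
          γ * (t ^ 2 / 6 - e) + (q ^ γ - (1 - γ * e)) + γ / 6 * t ^ 2 * (q ^ 2 * q ^ γ - 1) := by
        ring
      have hc1 : 0 ≤ γ * (t ^ 2 / 6 - e) := mul_nonneg hγ.le (by linarith)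
      have hc2 : γ * (t ^ 2 / 6 - e) ≤ 2 * (t ^ 4 / 100) :=
        mul_le_mul hγ2 hel (by linarith) zero_le_two
      have hc3 : γ / 6 * t ^ 2 * (q ^ 2 * q ^ γ - 1) ≤ 0 :=
        mul_nonpos_of_nonneg_of_nonpos (by positivity) (by linarith)
      have hc4 : -(t ^ 4) ≤ γ / 6 * t ^ 2 * (q ^ 2 * q ^ γ - 1) := by
        have : γ / 6 * t ^ 2 * (1 - q ^ 2 * q ^ γ) ≤ (2 / 6 * t ^ 2) * (4 * (t ^ 2 / 6)) := by
          apply mul_le_mul _ (by linarith) (by linarith) (by positivity)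
          gcongr
        nlinarith [sq_nonneg (t ^ 2)]
      have ht4 : 0 ≤ t ^ 4 := by positivity
      rw [hdec, abs_le, mul_pow]
      constructor <;> linarith
    rw [hfac, hst, show (1 + γ / 6 * (q * t) ^ 2) * ((2 * t) ^ γ * q ^ γ) - (2 * t) ^ γ =
      (2 * t) ^ γ * ((1 + γ / 6 * (q * t) ^ 2) * q ^ γ - 1) by ring, abs_mul, abs_of_pos hP]
    exact mul_le_mul_of_nonneg_left hkey hP.le

/-! ### Consistency in one dimension -/

/-- The fractional centred difference `∑ ω_k v_{i-k}` of a grid function on all of `ℤ`, without the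
factor `h^{-γ}`. -/
def centredDiff (γ : ℝ) (v : ℤ → ℝ) (i : ℤ) : ℝ := ∑' k : ℤ, omega γ k * v (i - k)

/-- For a grid function vanishing off the interior nodes the truncated sums in `fracDiff` are
complete. -/
lemma fracDiff_eq {m : ℕ} {v : ℤ → ℝ} (hv : ∀ l : ℤ, l ≤ 0 ∨ (m : ℤ) ≤ l → v l = 0) (γ h : ℝ)
    (i : ℤ) :
    fracDiff γ h m v i =
      (∑ r ∈ Finset.Icc (-1 : ℤ) 1, rho γ r * centredDiff γ v (i - r)) / h ^ γ := by
  rw [fracDiff, Finset.sum_div]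
  refine Finset.sum_congr rfl fun r hr => ?_
  rw [mul_div_assoc]
  congr 1
  rw [centredDiff, tsum_eq_sum (s := Finset.Icc (i - m) i), Finset.sum_div]
  · refine Finset.sum_congr rfl fun k _ => ?_
    rw [div_mul_eq_mul_div, sub_right_comm]
  · intro k hk
    simp only [Finset.mem_Icc] at hk hr
    rw [hv, mul_zero]
    omega

lemma symbol_neg (γ x : ℝ) : symbol γ (-x) = symbol γ x := by simp [symbol]

/-- The weights `ϱ_r` and their symbol. -/
lemma sum_rho_mul (γ : ℝ) (f : ℤ → ℂ) : ∑ r ∈ Finset.Icc (-1 : ℤ) 1, (rho γ r : ℂ) * f r =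
    (γ / 12 + 1) * f 0 - γ / 24 * (f 1 + f (-1)) := by
  rw [show Finset.Icc (-1 : ℤ) 1 = {-1, 0, 1} by decide]
  simp [rho]
  ring

namespace IsBump
variable {a b M : ℝ} {g : ℝ → ℝ}

lemma integrable_ft (h : IsBump a b M g) (hab : a ≤ b) : Integrable (ft g) := by
  refine (integrable_norm_iff h.continuous_ft.aestronglyMeasurable).1 ?_
  simpa using h.integrable_rpow_mul_ft hab (s := 0) le_rfl (by norm_num)

lemma eq_integral_ft (h : IsBump a b M g) (hab : a ≤ b) (x : ℝ) :
    (g x : ℂ) = ∫ ξ, ft g ξ * Complex.exp (2 * Real.pi * Complex.I * ξ * x) := by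
  have hi : Integrable (fun x => (g x : ℂ)) := by
    simpa using (h.integrable_iteratedDeriv (j := 0) (by norm_num)).ofReal (𝕜 := ℂ)
  exact fourier_inversion (F := fun x => (g x : ℂ))
    (Complex.continuous_ofReal.comp h.contDiff.continuous) hi (h.integrable_ft hab) x

lemma integrable_mul_ft_exp (h : IsBump a b M g) (hab : a ≤ b) {m : ℝ → ℂ} (hm : Continuous m)
    {C : ℝ} (hC : ∀ ξ, ‖m ξ‖ ≤ C) (x : ℝ) :
    Integrable fun ξ : ℝ => m ξ * (ft g ξ * Complex.exp (2 * Real.pi * Complex.I * ξ * x)) := by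
  refine Integrable.bdd_mul (c := C) ?_ hm.aestronglyMeasurable (Eventually.of_forall hC)
  refine ((h.integrable_ft hab).bdd_mul (c := 1)
    (f := fun ξ : ℝ => Complex.exp (2 * Real.pi * Complex.I * ξ * x))
    (Continuous.aestronglyMeasurable (by fun_prop))
    (Eventually.of_forall fun ξ => (norm_cexp_fourier ξ x).le)).congr
    (Eventually.of_forall fun ξ => mul_comm _ _)

/-- The fractional centred difference acts on the Fourier side by multiplication with its symbol. -/
lemma centredDiff_eq (h : IsBump a b M g) (hab : a ≤ b) {γ : ℝ} (hγ : 0 < γ) (hγ2 : γ ≤ 2)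
    (x₀ δ : ℝ) (i : ℤ) :
    (centredDiff γ (fun l => g (x₀ + l * δ)) i : ℂ) = ∫ ξ, (symbol γ (δ * ξ) : ℂ) *
      (ft g ξ * Complex.exp (2 * Real.pi * Complex.I * ξ * (x₀ + i * δ : ℝ))) := by
  have hint : ∀ k : ℤ, Integrable fun ξ : ℝ => (omega γ k : ℂ) *
      (ft g ξ * Complex.exp (2 * Real.pi * Complex.I * ξ * (x₀ + (i - k : ℤ) * δ : ℝ))) :=
    fun k => h.integrable_mul_ft_exp hab continuous_const (fun _ => le_rfl) _
  have hsum := hasSum_integral_of_summable_integral_norm hint (by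
    simp only [norm_mul, norm_cexp_fourier, mul_one, integral_const_mul, Complex.norm_real]
    exact (summable_omega hγ hγ2).norm.mul_right _)
  have h1 : ∀ k : ℤ, ∫ ξ : ℝ, (omega γ k : ℂ) *
      (ft g ξ * Complex.exp (2 * Real.pi * Complex.I * ξ * (x₀ + (i - k : ℤ) * δ : ℝ))) =
      ((omega γ k * g (x₀ + (i - k : ℤ) * δ) : ℝ) : ℂ) := fun k => by
    rw [integral_const_mul, ← h.eq_integral_ft hab, Complex.ofReal_mul]
  simp only [h1] at hsum
  rw [centredDiff, Complex.ofReal_tsum, hsum.tsum_eq]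
  congr 1; ext ξ
  have h2 := (hasSum_omega_exp hγ hγ2 (-(δ * ξ))).mul_right
    (ft g ξ * Complex.exp (2 * Real.pi * Complex.I * ξ * (x₀ + i * δ : ℝ)))
  rw [symbol_neg] at h2
  rw [← h2.tsum_eq]
  congr 1; ext k
  rw [show Complex.exp (2 * Real.pi * Complex.I * ξ * (x₀ + (i - k : ℤ) * δ : ℝ)) =
    Complex.exp (2 * Real.pi * Complex.I * k * (-(δ * ξ) : ℝ)) *
      Complex.exp (2 * Real.pi * Complex.I * ξ * (x₀ + i * δ : ℝ)) by
    rw [← Complex.exp_add]; congr 1; push_cast; ring]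
  ring

/-- On the Fourier side, the error of the compact fractional difference is the difference of the
symbols. -/
lemma compactDiff_add_riesz_eq (h : IsBump a b M g) (hab : a ≤ b) {γ : ℝ} (hγ : 0 < γ)
    (hγ2 : γ ≤ 2) (hγ1 : γ ≠ 1) (x₀ δ : ℝ) (i : ℤ) :
    (((∑ r ∈ Finset.Icc (-1 : ℤ) 1, rho γ r *
        centredDiff γ (fun l => g (x₀ + l * δ)) (i - r)) / δ ^ γ +
      riesz γ a b g (x₀ + i * δ) : ℝ) : ℂ) =
    ∫ ξ, (((1 + γ / 12 * (1 - Real.cos (2 * Real.pi * ξ * δ))) *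
        symbol γ (δ * ξ) / δ ^ γ - |2 * Real.pi * ξ| ^ γ : ℝ) : ℂ) *
      (ft g ξ * Complex.exp (2 * Real.pi * Complex.I * ξ * (x₀ + i * δ : ℝ))) := by
  have hsb : ∀ ξ : ℝ, ‖(symbol γ (δ * ξ) : ℂ)‖ ≤ 2 ^ γ := fun ξ => by
    rw [Complex.norm_real, Real.norm_of_nonneg (symbol_nonneg _ _), symbol]
    have := Real.abs_sin_le_one (Real.pi * (δ * ξ))
    exact Real.rpow_le_rpow (by positivity) (by linarith) hγ.le
  have hsc := continuous_symbol hγ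
  have hint : ∀ r : ℤ, Integrable fun ξ : ℝ => (symbol γ (δ * ξ) : ℂ) *
      (ft g ξ * Complex.exp (2 * Real.pi * Complex.I * ξ * (x₀ + (i - r : ℤ) * δ : ℝ))) :=
    fun r => h.integrable_mul_ft_exp hab (by fun_prop) hsb _
  have hint' : Integrable fun ξ : ℝ => ((|2 * Real.pi * ξ| ^ γ : ℝ) : ℂ) *
      (ft g ξ * Complex.exp (2 * Real.pi * Complex.I * ξ * (x₀ + i * δ : ℝ))) := by
    refine (h.integrable_rpow_mul_ft hab hγ.le (by linarith)).mono' ?_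
      (Eventually.of_forall fun ξ => ?_)
    · have := h.continuous_ft
      have : Continuous fun ξ : ℝ => |2 * Real.pi * ξ| ^ γ :=
        Continuous.rpow_const (by fun_prop) fun _ => Or.inr hγ.le
      exact Continuous.aestronglyMeasurable (by fun_prop)
    · rw [norm_mul, norm_mul, norm_cexp_fourier, mul_one, Complex.norm_real,
        Real.norm_of_nonneg (by positivity)]
  set K : ℤ → ℝ → ℂ := fun r ξ => (symbol γ (δ * ξ) : ℂ) *
    (ft g ξ * Complex.exp (2 * Real.pi * Complex.I * ξ * (x₀ + (i - r : ℤ) * δ : ℝ))) with hK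
  have hi2 : Integrable fun ξ => K 1 ξ + K (-1) ξ := (hint 1).add (hint (-1))
  have hi3 : Integrable fun ξ => (γ / 12 + 1 : ℂ) * K 0 ξ - γ / 24 * (K 1 ξ + K (-1) ξ) :=
    ((hint 0).const_mul _).sub (hi2.const_mul _)
  have hc : ∀ r : ℤ, (centredDiff γ (fun l => g (x₀ + l * δ)) (i - r) : ℂ) = ∫ ξ, K r ξ :=
    fun r => h.centredDiff_eq hab hγ hγ2 x₀ δ (i - r)
  rw [Complex.ofReal_add, h.riesz_eq hab hγ hγ2 hγ1, Complex.ofReal_div, Complex.ofReal_sum]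
  simp only [Complex.ofReal_mul (rho γ _), hc]
  rw [sum_rho_mul, ← integral_add (hint _) (hint _), ← integral_const_mul, ← integral_const_mul,
    ← integral_sub ((hint 0).const_mul _) (hi2.const_mul _), ← integral_div,
    ← sub_eq_add_neg, ← integral_sub (hi3.div_const _) hint']
  congr 1; ext ξ
  have hE : ∀ r : ℤ, Complex.exp (2 * Real.pi * Complex.I * ξ * (x₀ + (i - r : ℤ) * δ : ℝ)) =
      Complex.exp (2 * Real.pi * Complex.I * ξ * (x₀ + i * δ : ℝ)) *
        Complex.exp (-r * ((2 * Real.pi * ξ * δ) * Complex.I)) := fun r => by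
    rw [← Complex.exp_add]; congr 1; push_cast; ring
  simp only [hK]
  rw [hE, hE, hE]
  push_cast
  rw [Complex.cos]
  simp only [neg_neg, neg_zero, zero_mul, Complex.exp_zero, neg_mul, one_mul]
  ring

/-- Fourth-order consistency of the compact fractional difference for `γ < 2`: then the decay
`|ξ|^{-7}` of the Fourier transform makes `|ξ|^{γ+4} ĝ` integrable. -/
lemma abs_compactDiff_add_riesz_le_of_lt (h : IsBump a b M g) (hab : a ≤ b) {γ : ℝ} (hγ : 0 < γ)
    (hγ2 : γ < 2) (hγ1 : γ ≠ 1) (x₀ : ℝ) {δ : ℝ} (hδ : 0 < δ) (i : ℤ) :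
    |(∑ r ∈ Finset.Icc (-1 : ℤ) 1, rho γ r *
        centredDiff γ (fun l => g (x₀ + l * δ)) (i - r)) / δ ^ γ +
      riesz γ a b g (x₀ + i * δ)| ≤
    128 * ((b - a) * M) * (∫ ξ : ℝ, (1 + |2 * Real.pi * ξ|) ^ (γ + 4 - 7)) * δ ^ 4 := by
  rw [← Real.norm_eq_abs, ← Complex.norm_real,
    h.compactDiff_add_riesz_eq hab hγ hγ2.le hγ1 x₀ δ i]
  refine (norm_integral_le_of_norm_le
    (g := fun ξ => δ ^ 4 * (|2 * Real.pi * ξ| ^ (γ + 4) * ‖ft g ξ‖))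
    ((h.integrable_rpow_mul_ft hab (by linarith) (by linarith)).const_mul _)
    (Eventually.of_forall fun ξ => ?_)).trans ?_
  · rw [norm_mul, norm_mul, norm_cexp_fourier, mul_one, Complex.norm_real, Real.norm_eq_abs,
      ← mul_assoc]
    refine mul_le_mul_of_nonneg_right ?_ (norm_nonneg _)
    have hP : 0 < δ ^ γ := by positivity
    have hs := abs_compact_symbol_sub_le hγ hγ2.le (2 * Real.pi * ξ * δ)
    rw [show 2 * Real.pi * ξ * δ / 2 = Real.pi * (δ * ξ) by ring, abs_mul, abs_of_pos hδ,
      Real.mul_rpow (abs_nonneg _) hδ.le, Real.mul_rpow (abs_nonneg _) hδ.le,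
      Real.rpow_add hδ, show (4 : ℝ) = (4 : ℕ) by norm_num, Real.rpow_natCast] at hs
    rw [symbol, div_sub' hP.ne', abs_div, abs_of_pos hP, div_le_iff₀ hP]
    rw [mul_comm (δ ^ γ)]
    calc _ ≤ _ := hs
      _ = _ := by push_cast; ring
  · rw [integral_const_mul, mul_comm]
    exact mul_le_mul_of_nonneg_right
      (h.integral_rpow_mul_ft_le hab (by linarith) (by linarith)) (by positivity)

end IsBump

lemma omega_two_zero : omega 2 0 = 2 := by
  rw [omega_zero, show (2 : ℝ) + 1 = (2 : ℕ) + 1 by norm_num, Real.Gamma_nat_eq_factorial,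
    show (2 : ℝ) / 2 + 1 = (1 : ℕ) + 1 by norm_num, Real.Gamma_nat_eq_factorial]
  norm_num

lemma omega_two_one : omega 2 1 = -1 := by
  have h := omega_recurrence 2 0
  rw [omega_two_zero] at h
  norm_num at h
  linarith

lemma omega_two_add_two (n : ℕ) : omega 2 (n + 2 : ℤ) = 0 := by
  induction n with
  | zero =>
    have h := omega_recurrence 2 1
    norm_num at h
    simpa using h
  | succ n ih =>
    have h := omega_recurrence 2 (n + 2 : ℤ)
    rw [ih, mul_zero, add_zero] at h
    have h0 : (2 : ℝ) / 2 + ((n + 2 : ℤ) : ℝ) + 1 ≠ 0 := by push_cast; positivity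
    rw [show ((n + 1 : ℕ) : ℤ) + 2 = n + 2 + 1 by push_cast; ring]
    exact (mul_eq_zero.1 h).resolve_left h0

/-- For `γ = 2` the fractional centred difference is the ordinary second difference. -/
lemma centredDiff_two (v : ℤ → ℝ) (i : ℤ) :
    centredDiff 2 v i = 2 * v i - v (i - 1) - v (i + 1) := by
  rw [centredDiff, tsum_eq_sum (s := Finset.Icc (-1 : ℤ) 1)]
  · rw [show Finset.Icc (-1 : ℤ) 1 = {-1, 0, 1} by decide]
    have := omega_neg 2 1
    simp [this, omega_two_one, omega_two_zero]
    ring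
  · intro k hk
    have : omega 2 k = 0 := by
      simp only [Finset.mem_Icc, not_and_or, not_le] at hk
      rcases hk with hk | hk
      · obtain ⟨n, hn⟩ := Int.eq_ofNat_of_zero_le (show 0 ≤ -k - 2 by omega)
        rw [← omega_neg, show -k = (n + 2 : ℤ) by omega]
        exact omega_two_add_two n
      · obtain ⟨n, hn⟩ := Int.eq_ofNat_of_zero_le (show 0 ≤ k - 2 by omega)
        rw [show k = (n + 2 : ℤ) by omega]
        exact omega_two_add_two n
    rw [this, zero_mul]

namespace IsBump
variable {a b M : ℝ} {g : ℝ → ℝ}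

/-- For `γ = 2` the Riesz derivative is the second derivative. -/
lemma riesz_two (h : IsBump a b M g) (hab : a ≤ b) (x : ℝ) :
    riesz 2 a b g x = iteratedDeriv 2 g x := by
  have h1 := h.riesz_eq hab (γ := 2) (by norm_num) le_rfl (by norm_num) x
  have hft : ∀ ξ, 𝓕 (fun x => ((iteratedDeriv 2 g x : ℝ) : ℂ)) ξ =
      ((2 * Real.pi * ξ : ℝ) * Complex.I) ^ 2 * ft g ξ := h.ft_iteratedDeriv (by norm_num)
  have hsq : ∀ ξ : ℝ, ((2 * Real.pi * ξ : ℝ) * Complex.I) ^ 2 * ft g ξ =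
      -(((|2 * Real.pi * ξ| ^ (2 : ℝ) : ℝ) : ℂ) * ft g ξ) := fun ξ => by
    rw [Real.rpow_two, sq_abs, mul_pow, Complex.I_sq]; push_cast; ring
  have hint : Integrable (𝓕 (fun x => ((iteratedDeriv 2 g x : ℝ) : ℂ))) := by
    rw [funext hft]
    have hc := h.continuous_ft
    refine (integrable_norm_iff (Continuous.aestronglyMeasurable (by fun_prop))).1 ?_
    refine (h.integrable_rpow_mul_ft hab (s := 2) (by norm_num) (by norm_num)).congr
      (Eventually.of_forall fun ξ => ?_)
    simp only
    rw [hsq, norm_neg, norm_mul, Complex.norm_real, Real.norm_of_nonneg (by positivity)]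
  have h2 := fourier_inversion (Complex.continuous_ofReal.comp (h.continuous_iteratedDeriv
    (j := 2) (by norm_num))) (h.integrable_iteratedDeriv (j := 2) (by norm_num)).ofReal hint x
  have h3 : (riesz 2 a b g x : ℂ) = ((iteratedDeriv 2 g x : ℝ) : ℂ) := by
    rw [h1]
    refine Eq.trans ?_ h2.symm
    rw [← integral_neg]
    congr 1; ext ξ
    have := hft ξ
    simp only [Function.comp_def]
    rw [this, hsq]; ring
  exact_mod_cast h3

lemma abs_sub_taylor_le (h : IsBump a b M g) (x s : ℝ) :
    |g (x + s) - (g x + iteratedDeriv 1 g x * s + iteratedDeriv 2 g x * s ^ 2 / 2 +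
      iteratedDeriv 3 g x * s ^ 3 / 6 + iteratedDeriv 4 g x * s ^ 4 / 24 +
      iteratedDeriv 5 g x * s ^ 5 / 120)| ≤ M * s ^ 6 / 720 := by
  rcases eq_or_ne s 0 with rfl | hs
  · simp
  have hne : x ≠ x + s := by simpa using hs
  obtain ⟨y, -, hy⟩ := taylor_mean_remainder_lagrange_iteratedDeriv (n := 5) hne
    ((h.contDiff_nat (j := 6) (by norm_num)).contDiffOn.of_le (by norm_num))
  have hder : ∀ k : ℕ, k ≤ 7 → iteratedDerivWithin k g (uIcc x (x + s)) x = iteratedDeriv k g x :=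
    fun k hk => iteratedDerivWithin_eq_iteratedDeriv (uniqueDiffOn_uIcc hne)
      (h.contDiff_nat hk).contDiffAt left_mem_uIcc
  rw [taylor_within_apply] at hy
  simp only [Finset.sum_range_succ, Finset.sum_range_zero] at hy
  rw [hder 0 (by norm_num), hder 1 (by norm_num), hder 2 (by norm_num), hder 3 (by norm_num),
    hder 4 (by norm_num), hder 5 (by norm_num)] at hy
  have hb := h.bound 6 (by norm_num) y
  have hs6 : 0 ≤ s ^ 6 := by positivity
  have e : g (x + s) - (g x + iteratedDeriv 1 g x * s + iteratedDeriv 2 g x * s ^ 2 / 2 +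
      iteratedDeriv 3 g x * s ^ 3 / 6 + iteratedDeriv 4 g x * s ^ 4 / 24 +
      iteratedDeriv 5 g x * s ^ 5 / 120) = iteratedDeriv 6 g y * s ^ 6 / 720 := by
    norm_num [Nat.factorial] at hy
    rw [iteratedDeriv_one]
    linear_combination hy
  rw [e, abs_div, abs_mul, abs_of_nonneg hs6, abs_of_pos (by norm_num : (0 : ℝ) < 720)]
  gcongr

/-- For `γ = 2` the compact difference is the classical five-point fourth-order formula; its
error is bounded by Taylor expansion. -/
lemma abs_compactDiff_add_riesz_le_two (h : IsBump a b M g) (hab : a ≤ b) (x₀ : ℝ) {δ : ℝ}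
    (hδ : 0 < δ) (i : ℤ) :
    |(∑ r ∈ Finset.Icc (-1 : ℤ) 1, rho 2 r *
        centredDiff 2 (fun l => g (x₀ + l * δ)) (i - r)) / δ ^ (2 : ℝ) +
      riesz 2 a b g (x₀ + i * δ)| ≤ M * δ ^ 4 := by
  obtain ⟨x, hx⟩ : ∃ x, x = x₀ + i * δ := ⟨_, rfl⟩
  have hp : ∀ l j : ℤ, l = i + j → g (x₀ + l * δ) = g (x + j * δ) := fun l j hl => by
    rw [hx, hl]; push_cast; ring_nf
  have hsum : ∑ r ∈ Finset.Icc (-1 : ℤ) 1, rho 2 r *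
      centredDiff 2 (fun l => g (x₀ + l * δ)) (i - r) =
      (g (x + 2 * δ) + g (x + -2 * δ)) / 12 - 4 / 3 * (g (x + δ) + g (x + -δ)) + 5 / 2 * g x := by
    rw [show Finset.Icc (-1 : ℤ) 1 = {-1, 0, 1} by decide]
    simp only [centredDiff_two]
    rw [Finset.sum_insert (by decide), Finset.sum_insert (by decide), Finset.sum_singleton,
      hp (i - -1) 1 (by ring), hp (i - -1 - 1) 0 (by ring), hp (i - -1 + 1) 2 (by ring),
      hp (i - 0) 0 (by ring), hp (i - 0 - 1) (-1) (by ring), hp (i - 0 + 1) 1 (by ring),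
      hp (i - 1) (-1) (by ring), hp (i - 1 - 1) (-2) (by ring), hp (i - 1 + 1) 0 (by ring)]
    norm_num [rho]
    ring
  rw [← hx, h.riesz_two hab, hsum, Real.rpow_two]
  have t1 := abs_le.1 (h.abs_sub_taylor_le x δ)
  have t2 := abs_le.1 (h.abs_sub_taylor_le x (-δ))
  have t3 := abs_le.1 (h.abs_sub_taylor_le x (2 * δ))
  have t4 := abs_le.1 (h.abs_sub_taylor_le x (-2 * δ))
  have hδ2 : 0 < δ ^ 2 := by positivity
  have hM : 0 ≤ M * δ ^ 6 := mul_nonneg h.nonneg (by positivity)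
  rw [div_add' _ _ _ hδ2.ne', abs_div, abs_of_pos hδ2, div_le_iff₀ hδ2, abs_le]
  constructor
  · linarith [t1.1, t1.2, t2.1, t2.2, t3.1, t3.2, t4.1, t4.2]
  · linarith [t1.1, t1.2, t2.1, t2.2, t3.1, t3.2, t4.1, t4.2]

end IsBump

/-- Fourth-order consistency of the compact fractional difference with the Riesz derivative, with
a constant that depends only on the order and the interval. -/
theorem exists_abs_compactDiff_add_riesz_le {a b : ℝ} (hab : a ≤ b) {γ : ℝ} (hγ : 0 < γ)
    (hγ2 : γ ≤ 2) (hγ1 : γ ≠ 1) :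
    ∃ C : ℝ, 0 ≤ C ∧ ∀ (M : ℝ) (g : ℝ → ℝ), IsBump a b M g → ∀ (x₀ δ : ℝ), 0 < δ → ∀ i : ℤ,
      |(∑ r ∈ Finset.Icc (-1 : ℤ) 1, rho γ r *
          centredDiff γ (fun l => g (x₀ + l * δ)) (i - r)) / δ ^ γ +
        riesz γ a b g (x₀ + i * δ)| ≤ C * M * δ ^ 4 := by
  rcases hγ2.lt_or_eq with h2 | rfl
  · refine ⟨128 * (b - a) * ∫ ξ : ℝ, (1 + |2 * Real.pi * ξ|) ^ (γ + 4 - 7), ?_, ?_⟩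
    · exact mul_nonneg (mul_nonneg (by norm_num) (by linarith))
        (integral_nonneg fun ξ => by positivity)
    · intro M g h x₀ δ hδ i
      refine (h.abs_compactDiff_add_riesz_le_of_lt hab hγ h2 hγ1 x₀ hδ i).trans_eq ?_
      ring
  · refine ⟨1, zero_le_one, fun M g h x₀ δ hδ i => ?_⟩
    rw [one_mul]
    exact h.abs_compactDiff_add_riesz_le_two hab x₀ hδ i

/-! ### Boundedness of the fractional difference on smooth grid functions -/

/-- Averaging over `θ` removes the oscillation of `1 - cos (sθ)`, which is then of the size of
`min(1, s²)`: for `s ≤ π` by a quadratic lower bound of `1 - cos`, beyond by evaluating the mean. -/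
lemma min_one_sq_le_integral (s : ℝ) :
    min 1 (s ^ 2) ≤ 15 * ∫ θ in (0 : ℝ)..1, (1 - Real.cos (s * θ)) := by
  wlog hs : 0 ≤ s generalizing s
  · simpa using this (-s) (by linarith)
  have hpi := Real.pi_pos
  have hpi4 := Real.pi_lt_d2
  rcases le_or_gt s Real.pi with h | h
  · have hle : ∫ θ in (0 : ℝ)..1, 2 / Real.pi ^ 2 * s ^ 2 * θ ^ 2 ≤
        ∫ θ in (0 : ℝ)..1, (1 - Real.cos (s * θ)) := by
      refine intervalIntegral.integral_mono_on zero_le_one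
        (Continuous.intervalIntegrable (by fun_prop) _ _)
        (Continuous.intervalIntegrable (by fun_prop) _ _) fun θ hθ => ?_
      have h1 : |s * θ| ≤ Real.pi := by
        rw [abs_of_nonneg (mul_nonneg hs hθ.1)]
        nlinarith [hθ.1, hθ.2]
      have := Real.cos_le_one_sub_mul_cos_sq h1
      rw [mul_pow] at this
      linarith
    rw [intervalIntegral.integral_const_mul, integral_pow] at hle
    norm_num at hle
    refine (min_le_right _ _).trans ?_
    have h2 : s ^ 2 ≤ 15 * (2 / Real.pi ^ 2 * s ^ 2 * (1 / 3)) := by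
      rw [show 15 * (2 / Real.pi ^ 2 * s ^ 2 * (1 / 3)) = 10 / Real.pi ^ 2 * s ^ 2 by ring]
      have : 1 ≤ 10 / Real.pi ^ 2 := by
        rw [le_div_iff₀ (by positivity)]; nlinarith
      nlinarith [sq_nonneg s]
    linarith
  · have hs0 : s ≠ 0 := by linarith
    have hpi3 := Real.pi_gt_three
    have hint : ∫ θ in (0 : ℝ)..1, (1 - Real.cos (s * θ)) = 1 - Real.sin s / s := by
      rw [intervalIntegral.integral_sub (by simp) (Continuous.intervalIntegrable (by fun_prop) _ _),
        intervalIntegral.integral_comp_mul_left _ hs0]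
      simp [div_eq_inv_mul]
    have h1 : Real.sin s / s ≤ 1 / 3 := by
      rw [div_le_iff₀ (by linarith)]
      have := Real.sin_le_one s
      linarith
    rw [hint]
    exact (min_le_left _ _).trans (by linarith)

/-- The weights integrate `min(1, (kh)²)` to `O(h^γ)`: average the identity
`∑ (-ω_k) (1 - cos kφ) = (2 |sin (φ/2)|)^γ ≤ |φ|^γ` over `0 ≤ φ ≤ h`. -/
lemma tsum_abs_omega_mul_min_le {γ : ℝ} (hγ : 0 < γ) (hγ2 : γ ≤ 2) {h : ℝ} (hh : 0 < h) :
    ∑' k : ℤ, |omega γ k| * min 1 ((k * h) ^ 2) ≤ 15 * h ^ γ := by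
  refine Real.tsum_le_of_sum_le (fun k => by positivity) fun F => ?_
  have hpi := Real.pi_pos
  have hterm : ∀ θ ∈ Icc (0 : ℝ) 1, ∑ k ∈ F, |omega γ k| * (1 - Real.cos (k * h * θ)) ≤ h ^ γ := by
    intro θ hθ
    have hs := (hasSum_omega hγ hγ2).sub (hasSum_omega_cos hγ hγ2 (h * θ / (2 * Real.pi)))
    rw [zero_sub] at hs
    have h1 : ∀ k : ℤ, |omega γ k| * (1 - Real.cos (k * h * θ)) =
        -(omega γ k - omega γ k * Real.cos (2 * Real.pi * k * (h * θ / (2 * Real.pi)))) := by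
      intro k
      rw [show 2 * Real.pi * k * (h * θ / (2 * Real.pi)) = k * h * θ by field_simp]
      rcases eq_or_ne k 0 with rfl | hk
      · simp
      · rw [abs_of_nonpos (omega_nonpos hγ hγ2 hk)]; ring
    have hs' : HasSum (fun k : ℤ => |omega γ k| * (1 - Real.cos (k * h * θ)))
        (symbol γ (h * θ / (2 * Real.pi))) := by
      simp only [h1]
      simpa using hs.neg
    refine (sum_le_hasSum F (fun k _ => mul_nonneg (abs_nonneg _)
      (sub_nonneg.2 (Real.cos_le_one _))) hs').trans ?_
    have hθ0 := hθ.1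
    refine Real.rpow_le_rpow (by positivity) ?_ hγ.le
    have h2 := Real.abs_sin_le_abs (x := Real.pi * (h * θ / (2 * Real.pi)))
    rw [show Real.pi * (h * θ / (2 * Real.pi)) = h * θ / 2 by field_simp] at h2 ⊢
    rw [abs_of_nonneg (a := h * θ / 2) (by positivity)] at h2
    have h3 : h * θ ≤ h := mul_le_of_le_one_right hh.le hθ.2
    linarith
  have hi : ∀ k ∈ F, IntervalIntegrable (fun θ : ℝ => |omega γ k| * (1 - Real.cos (k * h * θ)))
      volume 0 1 := fun k _ => Continuous.intervalIntegrable (by fun_prop) _ _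
  calc ∑ k ∈ F, |omega γ k| * min 1 ((k * h) ^ 2)
      ≤ ∑ k ∈ F, |omega γ k| * (15 * ∫ θ in (0 : ℝ)..1, (1 - Real.cos (k * h * θ))) := by
        gcongr with k hk
        exact min_one_sq_le_integral _
    _ = 15 * ∫ θ in (0 : ℝ)..1, ∑ k ∈ F, |omega γ k| * (1 - Real.cos (k * h * θ)) := by
        rw [intervalIntegral.integral_finsetSum hi, Finset.mul_sum]
        refine Finset.sum_congr rfl fun k _ => ?_
        rw [intervalIntegral.integral_const_mul]; ring
    _ ≤ 15 * ∫ _ in (0 : ℝ)..1, h ^ γ := by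
        refine mul_le_mul_of_nonneg_left ?_ (by norm_num)
        exact intervalIntegral.integral_mono_on zero_le_one
          (Continuous.intervalIntegrable (by fun_prop) _ _) (by simp) hterm
    _ = 15 * h ^ γ := by simp

/-- A bound `B` on the second differences bounds the second difference with step `k` by `k² B`. -/
lemma abs_second_diff_le {v : ℤ → ℝ} {B : ℝ} (hB : ∀ l, |v (l - 1) - 2 * v l + v (l + 1)| ≤ B)
    (i k : ℤ) : |v (i - k) + v (i + k) - 2 * v i| ≤ k ^ 2 * B := by
  have hnat : ∀ n : ℕ, |v (i - n) + v (i + n) - 2 * v i| ≤ n ^ 2 * B ∧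
      |(v (i - (n + 1)) + v (i + (n + 1))) - (v (i - n) + v (i + n))| ≤ (2 * n + 1) * B := by
    intro n
    induction n with
    | zero =>
      refine ⟨by simp [← two_mul], ?_⟩
      have := hB i
      simp only [Nat.cast_zero, zero_add, sub_zero, add_zero, mul_zero, one_mul]
      convert this using 2
      ring
    | succ n ih =>
      obtain ⟨h1, h2⟩ := ih
      have b1 := hB (i - (n + 1))
      have b2 := hB (i + (n + 1))
      rw [show i - ((n : ℤ) + 1) - 1 = i - (n + 1 + 1) by ring,
        show i - ((n : ℤ) + 1) + 1 = i - n by ring] at b1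
      rw [show i + ((n : ℤ) + 1) - 1 = i + n by ring,
        show i + ((n : ℤ) + 1) + 1 = i + (n + 1 + 1) by ring] at b2
      rw [abs_le] at h1 h2 b1 b2
      push_cast
      constructor
      · rw [abs_le]; constructor <;> linarith [h1.1, h1.2, h2.1, h2.2]
      · rw [abs_le]; constructor <;> linarith [b1.1, b1.2, b2.1, b2.2, h2.1, h2.2]
  rcases Int.eq_nat_or_neg k with ⟨n, rfl | rfl⟩
  · exact_mod_cast (hnat n).1
  · have := (hnat n).1
    rw [sub_neg_eq_add, ← sub_eq_add_neg, add_comm (v (i + n))]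
    push_cast
    rwa [neg_sq]

lemma abs_centredDiff_le {γ : ℝ} (hγ : 0 < γ) (hγ2 : γ ≤ 2) {h : ℝ} (hh : 0 < h) {v : ℤ → ℝ}
    {A B : ℝ} (hA : ∀ l, |v l| ≤ A) (hB : ∀ l, |v (l - 1) - 2 * v l + v (l + 1)| ≤ B) (i : ℤ) :
    |centredDiff γ v i| ≤ 30 * (A + B / h ^ 2) * h ^ γ := by
  have hA0 : 0 ≤ A := (abs_nonneg _).trans (hA 0)
  have hB0 : 0 ≤ B := (abs_nonneg _).trans (hB 0)
  have hω := summable_omega hγ hγ2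
  have hsum : Summable fun k => omega γ k * v (i - k) := by
    refine Summable.of_norm_bounded (hω.abs.mul_right A) fun k => ?_
    rw [norm_mul, Real.norm_eq_abs, Real.norm_eq_abs]
    exact mul_le_mul_of_nonneg_left (hA _) (abs_nonneg _)
  have h1 : HasSum (fun k => omega γ k * v (i - k)) (centredDiff γ v i) := hsum.hasSum
  have h2 : HasSum (fun k => omega γ k * v (i + k)) (centredDiff γ v i) := by
    have := (Equiv.neg ℤ).hasSum_iff.2 h1
    simpa [Function.comp_def, omega_neg] using this
  -- By symmetry and `∑ ω_k = 0`, twice the difference is `∑ ω_k (v_{i-k} - 2 v_i + v_{i+k})`.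
  have h3 := (h1.add h2).sub ((hasSum_omega hγ hγ2).mul_right (2 * v i))
  rw [zero_mul, sub_zero] at h3
  have hbound : ∀ k : ℤ, ‖omega γ k * v (i - k) + omega γ k * v (i + k) - omega γ k * (2 * v i)‖ ≤
      4 * (A + B / h ^ 2) * (|omega γ k| * min 1 ((k * h) ^ 2)) := by
    intro k
    rw [← mul_add, ← mul_sub, norm_mul, Real.norm_eq_abs, Real.norm_eq_abs, mul_left_comm]
    refine mul_le_mul_of_nonneg_left ?_ (abs_nonneg _)
    rw [mul_min_of_nonneg _ _ (by positivity)]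
    refine le_min ?_ ?_
    · have a1 := abs_le.1 (hA (i - k))
      have a2 := abs_le.1 (hA (i + k))
      have a3 := abs_le.1 (hA i)
      have : 0 ≤ B / h ^ 2 := by positivity
      rw [abs_le]
      constructor <;> linarith [a1.1, a1.2, a2.1, a2.2, a3.1, a3.2]
    · refine (abs_second_diff_le hB i k).trans ?_
      rw [show 4 * (A + B / h ^ 2) * (k * h) ^ 2 = 4 * A * (k * h) ^ 2 + 4 * (k ^ 2 * B) by
        field_simp]
      have : 0 ≤ (k : ℝ) ^ 2 * B := by positivity
      have : 0 ≤ 4 * A * (k * h) ^ 2 := by positivity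
      linarith
  have hsm : Summable fun k : ℤ => |omega γ k| * min 1 ((k * h) ^ 2) :=
    Summable.of_nonneg_of_le (fun k => by positivity)
      (fun k => mul_le_of_le_one_right (abs_nonneg _) (min_le_left _ _)) hω.abs
  have h4 := tsum_of_norm_bounded (hsm.hasSum.mul_left (4 * (A + B / h ^ 2))) hbound
  rw [h3.tsum_eq, Real.norm_eq_abs, ← two_mul, abs_mul, abs_two] at h4
  have h5 := mul_le_mul_of_nonneg_left (tsum_abs_omega_mul_min_le hγ hγ2 hh)
    (show 0 ≤ 4 * (A + B / h ^ 2) by positivity)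
  linarith

/-- The fractional difference quotient of a grid function is bounded by the grid function and its
second difference quotients, uniformly in the mesh. -/
lemma abs_fracDiff_le {γ : ℝ} (hγ : 0 < γ) (hγ2 : γ ≤ 2) {h : ℝ} (hh : 0 < h) {m : ℕ} {v : ℤ → ℝ}
    (hv : ∀ l : ℤ, l ≤ 0 ∨ (m : ℤ) ≤ l → v l = 0) {A B : ℝ} (hA : ∀ l, |v l| ≤ A)
    (hB : ∀ l, |v (l - 1) - 2 * v l + v (l + 1)| ≤ B) (i : ℤ) :
    |fracDiff γ h m v i| ≤ 40 * (A + B / h ^ 2) := by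
  have hP : 0 < h ^ γ := by positivity
  rw [fracDiff_eq hv, abs_div, abs_of_pos hP, div_le_iff₀ hP]
  have hb := abs_centredDiff_le hγ hγ2 hh hA hB
  have hK : 0 ≤ 30 * (A + B / h ^ 2) * h ^ γ := (abs_nonneg _).trans (hb 0)
  calc _ ≤ ∑ r ∈ Finset.Icc (-1 : ℤ) 1, |rho γ r| * (30 * (A + B / h ^ 2) * h ^ γ) := by
        refine (Finset.abs_sum_le_sum_abs _ _).trans (Finset.sum_le_sum fun r _ => ?_)
        rw [abs_mul]
        exact mul_le_mul_of_nonneg_left (hb _) (abs_nonneg _)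
    _ = (1 + γ / 6) * (30 * (A + B / h ^ 2) * h ^ γ) := by
        rw [← Finset.sum_mul, show Finset.Icc (-1 : ℤ) 1 = {-1, 0, 1} by decide]
        have h1 : 0 < γ / 12 + 1 := by positivity
        have h2 : 0 < γ / 24 := by positivity
        congr 1
        simp [rho, abs_of_pos h1, abs_of_pos h2]
        ring
    _ ≤ (4 / 3) * (30 * (A + B / h ^ 2) * h ^ γ) := by
        gcongr; linarith
    _ = _ := by ring

/-! ### Calculus on the strip `ℝ² × [0, T]` -/

lemma abs_second_difference_le {F F1 F2 : ℝ → ℝ} (h1 : ∀ x, HasDerivAt F (F1 x) x)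
    (h2 : ∀ x, HasDerivAt F1 (F2 x) x) {M : ℝ} (hM : ∀ x, |F2 x| ≤ M) (x : ℝ) {h : ℝ}
    (hh : 0 ≤ h) : |F (x - h) - 2 * F x + F (x + h)| ≤ 2 * M * h ^ 2 := by
  have hlip : ∀ a b : ℝ, |F1 b - F1 a| ≤ M * |b - a| := fun a b => by
    simpa using convex_univ.norm_image_sub_le_of_norm_hasDerivWithin_le
      (fun x _ => (h2 x).hasDerivWithinAt) (fun x _ => hM x) (mem_univ a) (mem_univ b)
  have hM0 : 0 ≤ M := (abs_nonneg _).trans (hM 0)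
  have hφ : ∀ s : ℝ, HasDerivAt (fun s => F (x + s) + F (x - s)) (F1 (x + s) - F1 (x - s)) s := by
    intro s
    have a1 := (h1 (x + s)).comp_const_add x s
    have a2 := (h1 (x - s)).comp_const_sub x s
    simpa [sub_eq_add_neg] using a1.fun_add a2
  have hb : ∀ s ∈ Icc (0 : ℝ) h, ‖F1 (x + s) - F1 (x - s)‖ ≤ 2 * M * h := by
    intro s hs
    refine (hlip _ _).trans ?_
    rw [show x + s - (x - s) = 2 * s by ring, abs_of_nonneg (by linarith [hs.1])]
    nlinarith [mul_le_mul_of_nonneg_left hs.2 hM0]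
  have := (convex_Icc (0 : ℝ) h).norm_image_sub_le_of_norm_hasDerivWithin_le
    (fun s _ => (hφ s).hasDerivWithinAt) hb (left_mem_Icc.2 hh) (right_mem_Icc.2 hh)
  simp only [Real.norm_eq_abs, add_zero, sub_zero, abs_of_nonneg hh] at this
  calc _ = |F (x + h) + F (x - h) - (F x + F x)| := by congr 1; ring
    _ ≤ _ := this
    _ = _ := by ring

/-- The error of the trapezoidal rule for `φ'` on `[a, b]`, when `φ''` is Lipschitz. -/
lemma abs_trapezoid_le {a b : ℝ} (hab : a ≤ b) {φ φ1 φ2 : ℝ → ℝ}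
    (h1 : ∀ t ∈ Icc a b, HasDerivWithinAt φ (φ1 t) (Icc a b) t)
    (h2 : ∀ t ∈ Icc a b, HasDerivWithinAt φ1 (φ2 t) (Icc a b) t) {M : ℝ} (hM0 : 0 ≤ M)
    (hM : ∀ s ∈ Icc a b, ∀ t ∈ Icc a b, |φ2 s - φ2 t| ≤ M * |s - t|) :
    |φ b - φ a - (b - a) * ((φ1 b + φ1 a) / 2)| ≤ M * (b - a) ^ 3 := by
  -- `hkey` bounds twice the derivative in `s` of the trapezoidal error on `[a, s]`.
  have hkey : ∀ s ∈ Icc a b, |φ1 s - φ1 a - (s - a) * φ2 s| ≤ M * (b - a) ^ 2 := by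
    intro s hs
    have hχ : ∀ r ∈ Icc a b, HasDerivWithinAt (fun r => φ1 r - r * φ2 s) (φ2 r - φ2 s)
        (Icc a b) r := fun r hr => by
      simpa using (h2 r hr).fun_sub ((hasDerivWithinAt_id r _).mul_const (φ2 s))
    have hb : ∀ r ∈ Icc a b, ‖φ2 r - φ2 s‖ ≤ M * (b - a) := fun r hr => by
      refine (hM r hr s hs).trans (mul_le_mul_of_nonneg_left ?_ hM0)
      rw [abs_le]; constructor <;> linarith [hr.1, hr.2, hs.1, hs.2]
    have := (convex_Icc a b).norm_image_sub_le_of_norm_hasDerivWithin_le hχ hb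
      (left_mem_Icc.2 hab) hs
    simp only [Real.norm_eq_abs, abs_of_nonneg (sub_nonneg.2 hs.1)] at this
    calc _ = |φ1 s - s * φ2 s - (φ1 a - a * φ2 s)| := by congr 1; ring
      _ ≤ _ := this
      _ ≤ M * (b - a) * (b - a) := by
        refine mul_le_mul_of_nonneg_left (by linarith [hs.2]) ?_
        exact mul_nonneg hM0 (by linarith)
      _ = _ := by ring
  have hψ : ∀ s ∈ Icc a b, HasDerivWithinAt (fun s => φ s - (s - a) * ((φ1 s + φ1 a) / 2))
      ((φ1 s - φ1 a - (s - a) * φ2 s) / 2) (Icc a b) s := fun s hs => by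
    have h3 := (((hasDerivWithinAt_id s (Icc a b)).sub_const a)).mul
      (((h2 s hs).add_const (φ1 a)).div_const 2)
    refine ((h1 s hs).fun_sub h3).congr_deriv ?_
    simp only [id]
    ring
  have hb : ∀ s ∈ Icc a b, ‖(φ1 s - φ1 a - (s - a) * φ2 s) / 2‖ ≤ M * (b - a) ^ 2 := by
    intro s hs
    rw [Real.norm_eq_abs, abs_div, abs_two]
    have := hkey s hs
    linarith [abs_nonneg (φ1 s - φ1 a - (s - a) * φ2 s)]
  have := (convex_Icc a b).norm_image_sub_le_of_norm_hasDerivWithin_le hψ hb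
    (left_mem_Icc.2 hab) (right_mem_Icc.2 hab)
  simp only [Real.norm_eq_abs, abs_of_nonneg (sub_nonneg.2 hab)] at this
  calc _ = |φ b - (b - a) * ((φ1 b + φ1 a) / 2) - (φ a - (a - a) * ((φ1 a + φ1 a) / 2))| := by
        congr 1; ring
    _ ≤ _ := this
    _ = _ := by ring

/-- The strip `ℝ² × [0, T]`. -/
def strip (T : ℝ) : Set (ℝ × ℝ × ℝ) := univ ×ˢ univ ×ˢ Icc 0 T

lemma mem_strip {T x y t : ℝ} (ht : t ∈ Icc 0 T) : (x, y, t) ∈ strip T :=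
  ⟨mem_univ _, mem_univ _, ht⟩

lemma uniqueDiffOn_strip {T : ℝ} (hT : 0 < T) : UniqueDiffOn ℝ (strip T) :=
  uniqueDiffOn_univ.prod (uniqueDiffOn_univ.prod (uniqueDiffOn_Icc hT))

/-- The directional derivative along `w` within the strip (one-sided in time at `0` and `T`). -/
def pd (T : ℝ) (w : ℝ × ℝ × ℝ) (f : ℝ × ℝ × ℝ → ℝ) (p : ℝ × ℝ × ℝ) : ℝ :=
  fderivWithin ℝ f (strip T) p w

/-- A function of class `Cⁿ` on the strip that vanishes outside `K × [0, T]`. -/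
structure StripSmooth (T : ℝ) (K : Set (ℝ × ℝ)) (n : ℕ) (f : ℝ × ℝ × ℝ → ℝ) : Prop where
  contDiffOn : ContDiffOn ℝ n f (strip T)
  zero : ∀ p ∈ strip T, (p.1, p.2.1) ∉ K → f p = 0

namespace StripSmooth
variable {T : ℝ} {K : Set (ℝ × ℝ)} {n : ℕ} {f : ℝ × ℝ × ℝ → ℝ}

lemma of_le (h : StripSmooth T K n f) {m : ℕ} (hm : m ≤ n) : StripSmooth T K m f :=
  ⟨h.contDiffOn.of_le (by exact_mod_cast hm), h.zero⟩

lemma pd (hT : 0 < T) (hK : IsClosed K) (h : StripSmooth T K (n + 1) f) (w : ℝ × ℝ × ℝ) :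
    StripSmooth T K n (pd T w f) where
  contDiffOn := (h.contDiffOn.fderivWithin (uniqueDiffOn_strip hT)
    (by exact_mod_cast le_rfl)).clm_apply contDiffOn_const
  zero p hp hpK := by
    have h0 : f =ᶠ[𝓝[strip T] p] fun _ => 0 := by
      have hU : {q : ℝ × ℝ × ℝ | (q.1, q.2.1) ∉ K} ∈ 𝓝 p :=
        (hK.isOpen_compl.preimage
          (by fun_prop : Continuous fun q : ℝ × ℝ × ℝ => (q.1, q.2.1))).mem_nhds hpK
      filter_upwards [mem_nhdsWithin_of_mem_nhds hU, self_mem_nhdsWithin] with q hq hqS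
      exact h.zero q hqS hq
    rw [RSFADE.pd, h0.fderivWithin_eq (h.zero p hp hpK)]
    simp

lemma exists_bound (hK : IsCompact K) (h : StripSmooth T K n f) :
    ∃ M, 0 ≤ M ∧ ∀ p ∈ strip T, |f p| ≤ M := by
  have hc : IsCompact ((fun q : (ℝ × ℝ) × ℝ => (q.1.1, q.1.2, q.2)) '' (K ×ˢ Icc 0 T)) :=
    (hK.prod isCompact_Icc).image (by fun_prop)
  have hsub : (fun q : (ℝ × ℝ) × ℝ => (q.1.1, q.1.2, q.2)) '' (K ×ˢ Icc 0 T) ⊆ strip T := by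
    rintro _ ⟨q, hq, rfl⟩
    exact mem_strip hq.2
  obtain ⟨M, hM⟩ := hc.exists_bound_of_continuousOn (h.contDiffOn.continuousOn.mono hsub)
  refine ⟨max M 0, le_max_right _ _, fun p hp => ?_⟩
  by_cases hpK : (p.1, p.2.1) ∈ K
  · exact (hM p ⟨((p.1, p.2.1), p.2.2), ⟨hpK, hp.2.2⟩, rfl⟩).trans (le_max_left _ _)
  · rw [h.zero p hp hpK, abs_zero]; exact le_max_right _ _

lemma hasFDerivWithinAt (h : StripSmooth T K (n + 1) f) {p : ℝ × ℝ × ℝ} (hp : p ∈ strip T) :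
    HasFDerivWithinAt f (fderivWithin ℝ f (strip T) p) (strip T) p :=
  (h.contDiffOn.differentiableOn (by simp) p hp).hasFDerivWithinAt

lemma hasDerivAt_x (h : StripSmooth T K (n + 1) f) (x y : ℝ) {t : ℝ} (ht : t ∈ Icc 0 T) :
    HasDerivAt (fun x => f (x, y, t)) (RSFADE.pd T (1, 0, 0) f (x, y, t)) x := by
  have h1 : HasDerivWithinAt (fun x : ℝ => (x, y, t)) (1, 0, 0) univ x :=
    (hasDerivWithinAt_id x _).prodMk (hasDerivWithinAt_const _ _ _)
  have := (h.hasFDerivWithinAt (mem_strip ht)).comp_hasDerivWithinAt x h1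
    fun _ _ => mem_strip ht
  exact hasDerivWithinAt_univ.1 this

lemma hasDerivAt_y (h : StripSmooth T K (n + 1) f) (x y : ℝ) {t : ℝ} (ht : t ∈ Icc 0 T) :
    HasDerivAt (fun y => f (x, y, t)) (RSFADE.pd T (0, 1, 0) f (x, y, t)) y := by
  have h1 : HasDerivWithinAt (fun y : ℝ => (x, y, t)) (0, 1, 0) univ y :=
    (hasDerivWithinAt_const _ _ _).prodMk
      ((hasDerivWithinAt_id y _).prodMk (hasDerivWithinAt_const _ _ _))
  have := (h.hasFDerivWithinAt (mem_strip ht)).comp_hasDerivWithinAt y h1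
    fun _ _ => mem_strip ht
  exact hasDerivWithinAt_univ.1 this

lemma hasDerivWithinAt_t (h : StripSmooth T K (n + 1) f) (x y : ℝ) {t : ℝ} (ht : t ∈ Icc 0 T) :
    HasDerivWithinAt (fun t => f (x, y, t)) (RSFADE.pd T (0, 0, 1) f (x, y, t)) (Icc 0 T) t := by
  have h1 : HasDerivWithinAt (fun t : ℝ => (x, y, t)) (0, 0, 1) (Icc 0 T) t :=
    (hasDerivWithinAt_const _ _ _).prodMk
      ((hasDerivWithinAt_const _ _ _).prodMk (hasDerivWithinAt_id t _))
  exact (h.hasFDerivWithinAt (mem_strip ht)).comp_hasDerivWithinAt t h1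
    fun _ hs => mem_strip hs

lemma continuousOn_t (h : StripSmooth T K n f) (x y : ℝ) :
    ContinuousOn (fun t => f (x, y, t)) (Icc 0 T) :=
  h.contDiffOn.continuousOn.comp (by fun_prop) fun _ ht => mem_strip ht

lemma iterate_pd (hT : 0 < T) (hK : IsClosed K) (w : ℝ × ℝ × ℝ) (j : ℕ) {m : ℕ} :
    StripSmooth T K (m + j) f → StripSmooth T K m ((RSFADE.pd T w)^[j] f) := by
  induction j generalizing m with
  | zero => exact fun h => h
  | succ j ih =>
    intro h
    rw [Function.iterate_succ_apply']
    exact pd hT hK (ih (h.of_le (by omega))) w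

lemma iteratedDeriv_x (hT : 0 < T) (hK : IsClosed K) (h : StripSmooth T K n f) (y : ℝ) {t : ℝ}
    (ht : t ∈ Icc 0 T) {j : ℕ} (hj : j ≤ n) :
    iteratedDeriv j (fun x => f (x, y, t)) =
      fun x => (RSFADE.pd T (1, 0, 0))^[j] f (x, y, t) := by
  induction j with
  | zero => simp
  | succ j ih =>
    rw [iteratedDeriv_succ, ih (by omega)]
    ext x
    rw [Function.iterate_succ_apply']
    exact ((iterate_pd hT hK _ j (h.of_le (by omega : 0 + 1 + j ≤ n))).hasDerivAt_x x y ht).deriv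

lemma iteratedDeriv_y (hT : 0 < T) (hK : IsClosed K) (h : StripSmooth T K n f) (x : ℝ) {t : ℝ}
    (ht : t ∈ Icc 0 T) {j : ℕ} (hj : j ≤ n) :
    iteratedDeriv j (fun y => f (x, y, t)) =
      fun y => (RSFADE.pd T (0, 1, 0))^[j] f (x, y, t) := by
  induction j with
  | zero => simp
  | succ j ih =>
    rw [iteratedDeriv_succ, ih (by omega)]
    ext y
    rw [Function.iterate_succ_apply']
    exact ((iterate_pd hT hK _ j (h.of_le (by omega : 0 + 1 + j ≤ n))).hasDerivAt_y x y ht).deriv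

/-- A common bound for the iterated derivatives in one direction. -/
lemma exists_bound_iterate (hT : 0 < T) (hK : IsCompact K) (h : StripSmooth T K n f)
    (w : ℝ × ℝ × ℝ) :
    ∃ M, 0 ≤ M ∧ ∀ j ≤ n, ∀ p ∈ strip T, |(RSFADE.pd T w)^[j] f p| ≤ M := by
  have hb : ∀ j : ℕ, ∃ M, 0 ≤ M ∧ (j ≤ n → ∀ p ∈ strip T, |(RSFADE.pd T w)^[j] f p| ≤ M) := by
    intro j
    by_cases hj : j ≤ n
    · obtain ⟨M, hM0, hM⟩ :=
        (iterate_pd hT hK.isClosed w j (h.of_le (by omega : 0 + j ≤ n))).exists_bound hK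
      exact ⟨M, hM0, fun _ => hM⟩
    · exact ⟨0, le_rfl, fun h => absurd h hj⟩
  choose M hM0 hM using hb
  refine ⟨∑ j ∈ Finset.range (n + 1), M j, Finset.sum_nonneg fun j _ => hM0 j,
    fun j hj p hp => (hM j hj p hp).trans ?_⟩
  exact Finset.single_le_sum (fun j _ => hM0 j) (Finset.mem_range.2 (by omega))

lemma exists_diff_t_le (hT : 0 < T) (hK : IsCompact K) (h : StripSmooth T K 1 f) :
    ∃ M, 0 ≤ M ∧ ∀ x y, ∀ s ∈ Icc 0 T, ∀ t ∈ Icc 0 T,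
      |f (x, y, s) - f (x, y, t)| ≤ M * |s - t| := by
  obtain ⟨M, hM0, hM⟩ := (pd hT hK.isClosed h (0, 0, 1)).exists_bound hK
  refine ⟨M, hM0, fun x y s hs t ht => ?_⟩
  exact (convex_Icc 0 T).norm_image_sub_le_of_norm_hasDerivWithin_le
    (fun r hr => h.hasDerivWithinAt_t x y hr) (fun r hr => hM _ (mem_strip hr)) ht hs

lemma exists_diff_tx_le (hT : 0 < T) (hK : IsCompact K) (h : StripSmooth T K 3 f) :
    ∃ M, 0 ≤ M ∧ ∀ x y, ∀ s ∈ Icc 0 T, ∀ t ∈ Icc 0 T, ∀ δ : ℝ, 0 ≤ δ →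
      |(f (x - δ, y, s) - f (x - δ, y, t)) - 2 * (f (x, y, s) - f (x, y, t)) +
        (f (x + δ, y, s) - f (x + δ, y, t))| ≤ M * |s - t| * δ ^ 2 := by
  have h1 := pd hT hK.isClosed h (1, 0, 0)
  have h2 := pd hT hK.isClosed h1 (1, 0, 0)
  obtain ⟨M, hM0, hM⟩ := h2.exists_diff_t_le hT hK
  refine ⟨2 * M, by positivity, fun x y s hs t ht δ hδ => ?_⟩
  refine (abs_second_difference_le
    (fun x => (h.hasDerivAt_x x y hs).fun_sub (h.hasDerivAt_x x y ht))
    (fun x => (h1.hasDerivAt_x x y hs).fun_sub (h1.hasDerivAt_x x y ht))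
    (fun x => hM x y s hs t ht) x hδ).trans_eq ?_
  ring

lemma exists_diff_ty_le (hT : 0 < T) (hK : IsCompact K) (h : StripSmooth T K 3 f) :
    ∃ M, 0 ≤ M ∧ ∀ x y, ∀ s ∈ Icc 0 T, ∀ t ∈ Icc 0 T, ∀ δ : ℝ, 0 ≤ δ →
      |(f (x, y - δ, s) - f (x, y - δ, t)) - 2 * (f (x, y, s) - f (x, y, t)) +
        (f (x, y + δ, s) - f (x, y + δ, t))| ≤ M * |s - t| * δ ^ 2 := by
  have h1 := pd hT hK.isClosed h (0, 1, 0)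
  have h2 := pd hT hK.isClosed h1 (0, 1, 0)
  obtain ⟨M, hM0, hM⟩ := h2.exists_diff_t_le hT hK
  refine ⟨2 * M, by positivity, fun x y s hs t ht δ hδ => ?_⟩
  refine (abs_second_difference_le
    (fun y => (h.hasDerivAt_y x y hs).fun_sub (h.hasDerivAt_y x y ht))
    (fun y => (h1.hasDerivAt_y x y hs).fun_sub (h1.hasDerivAt_y x y ht))
    (fun y => hM x y s hs t ht) y hδ).trans_eq ?_
  ring

lemma exists_diff_txy_le (hT : 0 < T) (hK : IsCompact K) (h : StripSmooth T K 5 f) :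
    ∃ M, 0 ≤ M ∧ ∀ x y, ∀ s ∈ Icc 0 T, ∀ t ∈ Icc 0 T, ∀ δ ε : ℝ, 0 ≤ δ → 0 ≤ ε →
      |((f (x - δ, y - ε, s) - f (x - δ, y - ε, t)) - 2 * (f (x - δ, y, s) - f (x - δ, y, t)) +
          (f (x - δ, y + ε, s) - f (x - δ, y + ε, t))) -
        2 * ((f (x, y - ε, s) - f (x, y - ε, t)) - 2 * (f (x, y, s) - f (x, y, t)) +
          (f (x, y + ε, s) - f (x, y + ε, t))) +
        ((f (x + δ, y - ε, s) - f (x + δ, y - ε, t)) - 2 * (f (x + δ, y, s) - f (x + δ, y, t)) +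
          (f (x + δ, y + ε, s) - f (x + δ, y + ε, t)))| ≤ M * |s - t| * δ ^ 2 * ε ^ 2 := by
  have h1 := pd hT hK.isClosed h (1, 0, 0)
  have h2 := pd hT hK.isClosed h1 (1, 0, 0)
  obtain ⟨M, hM0, hM⟩ := h2.exists_diff_ty_le hT hK
  refine ⟨2 * M, by positivity, fun x y s hs t ht δ ε hδ hε => ?_⟩
  have hd : ∀ {m : ℕ} {g : ℝ × ℝ × ℝ → ℝ}, StripSmooth T K (m + 1) g → ∀ x : ℝ, HasDerivAt
      (fun x => (g (x, y - ε, s) - g (x, y - ε, t)) - 2 * (g (x, y, s) - g (x, y, t)) +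
        (g (x, y + ε, s) - g (x, y + ε, t)))
      ((RSFADE.pd T (1, 0, 0) g (x, y - ε, s) - RSFADE.pd T (1, 0, 0) g (x, y - ε, t)) -
        2 * (RSFADE.pd T (1, 0, 0) g (x, y, s) - RSFADE.pd T (1, 0, 0) g (x, y, t)) +
        (RSFADE.pd T (1, 0, 0) g (x, y + ε, s) - RSFADE.pd T (1, 0, 0) g (x, y + ε, t))) x := by
    intro m g hg x
    have e : ∀ y, HasDerivAt (fun x => g (x, y, s) - g (x, y, t))
        (RSFADE.pd T (1, 0, 0) g (x, y, s) - RSFADE.pd T (1, 0, 0) g (x, y, t)) x := fun y =>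
      (hg.hasDerivAt_x x y hs).fun_sub (hg.hasDerivAt_x x y ht)
    exact ((e _).fun_sub ((e _).const_mul 2)).fun_add (e _)
  refine (abs_second_difference_le (hd h) (hd h1)
    (fun x => hM x y s hs t ht ε hε) x hδ).trans_eq ?_
  ring

/-- The trapezoidal rule in time, uniformly in space. -/
lemma exists_trapezoid_le (hT : 0 < T) (hK : IsCompact K) (h : StripSmooth T K 3 f) :
    ∃ M, 0 ≤ M ∧ ∀ x y, ∀ s ∈ Icc 0 T, ∀ t ∈ Icc 0 T, t ≤ s →
      |f (x, y, s) - f (x, y, t) - (s - t) * ((RSFADE.pd T (0, 0, 1) f (x, y, s) +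
        RSFADE.pd T (0, 0, 1) f (x, y, t)) / 2)| ≤ M * (s - t) ^ 3 := by
  have h1 := pd hT hK.isClosed h (0, 0, 1)
  have h2 := pd hT hK.isClosed h1 (0, 0, 1)
  obtain ⟨M, hM0, hM⟩ := h2.exists_diff_t_le hT hK
  refine ⟨M, hM0, fun x y s hs t ht hts => ?_⟩
  have hsub : Icc t s ⊆ Icc 0 T := Icc_subset_Icc ht.1 hs.2
  exact abs_trapezoid_le hts (fun r hr => (h.hasDerivWithinAt_t x y (hsub hr)).mono hsub)
    (fun r hr => (h1.hasDerivWithinAt_t x y (hsub hr)).mono hsub) hM0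
    fun r hr r' hr' => hM x y r (hsub hr) r' (hsub hr')

end StripSmooth

/-! ### Spatial consistency along the solution -/

lemma riesz_congr {γ a b : ℝ} {g g' : ℝ → ℝ} (h : EqOn g g' (Icc a b)) {x : ℝ}
    (hx : x ∈ Ioo a b) : riesz γ a b g x = riesz γ a b g' x := by
  have hl : (fun z => ∫ ξ in a..z, g ξ / (z - ξ) ^ (γ - rlOrder γ + 1)) =ᶠ[𝓝 x]
      fun z => ∫ ξ in a..z, g' ξ / (z - ξ) ^ (γ - rlOrder γ + 1) := by
    filter_upwards [Ioo_mem_nhds hx.1 hx.2] with z hz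
    refine intervalIntegral.integral_congr fun ξ hξ => ?_
    rw [uIcc_of_le hz.1.le] at hξ
    simp only [h ⟨hξ.1, hξ.2.trans hz.2.le⟩]
  have hr : (fun z => ∫ ξ in z..b, g ξ / (ξ - z) ^ (γ - rlOrder γ + 1)) =ᶠ[𝓝 x]
      fun z => ∫ ξ in z..b, g' ξ / (ξ - z) ^ (γ - rlOrder γ + 1) := by
    filter_upwards [Ioo_mem_nhds hx.1 hx.2] with z hz
    refine intervalIntegral.integral_congr fun ξ hξ => ?_
    rw [uIcc_of_le hz.2.le] at hξ
    simp only [h ⟨hz.1.le.trans hξ.1, hξ.2⟩]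
  rw [riesz, riesz, leftRL, leftRL, rightRL, rightRL, hl.iteratedDeriv_eq, hr.iteratedDeriv_eq]

/-- Uniform grids adapted to `[a, b]`: the grid values of a bump vanish off the interior nodes, so
the finite difference is the full series of the compact centred difference. -/
lemma exists_abs_fracDiff_add_riesz_le {a b : ℝ} (hab : a < b) {γ : ℝ} (hγ : 0 < γ) (hγ2 : γ ≤ 2)
    (hγ1 : γ ≠ 1) : ∃ C, 0 ≤ C ∧ ∀ M g, IsBump a b M g → ∀ m : ℕ, 0 < m → ∀ i : ℤ,
      |fracDiff γ ((b - a) / m) m (fun l => g (a + l * ((b - a) / m))) i +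
        riesz γ a b g (a + i * ((b - a) / m))| ≤ C * M * ((b - a) / m) ^ 4 := by
  obtain ⟨C, hC0, hC⟩ := exists_abs_compactDiff_add_riesz_le hab.le hγ hγ2 hγ1
  refine ⟨C, hC0, fun M g hg m hm i => ?_⟩
  have hm' : (0 : ℝ) < m := by exact_mod_cast hm
  have hδ : 0 < (b - a) / m := div_pos (sub_pos.2 hab) hm'
  rw [fracDiff_eq]
  · exact hC M g hg a _ hδ i
  · rintro l (hl | hl)
    · refine hg.zero _ fun h => ?_
      have : (l : ℝ) ≤ 0 := by exact_mod_cast hl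
      nlinarith [h.1, mul_nonneg (neg_nonneg.2 this) hδ.le]
    · refine hg.zero _ fun h => ?_
      have : (m : ℝ) ≤ l := by exact_mod_cast hl
      have h2 := mul_le_mul_of_nonneg_right this hδ.le
      rw [mul_div_cancel₀ _ hm'.ne'] at h2
      linarith [h.2]

namespace StripSmooth
variable {T a b c d : ℝ} {n : ℕ} {f : ℝ × ℝ × ℝ → ℝ}

lemma contDiff_x {K : Set (ℝ × ℝ)} (h : StripSmooth T K n f) (y : ℝ) {t : ℝ} (ht : t ∈ Icc 0 T) :
    ContDiff ℝ n fun x => f (x, y, t) :=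
  contDiffOn_univ.1 (h.contDiffOn.comp
    (by fun_prop : ContDiff ℝ n fun x : ℝ => (x, y, t)).contDiffOn fun _ _ => mem_strip ht)

lemma contDiff_y {K : Set (ℝ × ℝ)} (h : StripSmooth T K n f) (x : ℝ) {t : ℝ} (ht : t ∈ Icc 0 T) :
    ContDiff ℝ n fun y => f (x, y, t) :=
  contDiffOn_univ.1 (h.contDiffOn.comp
    (by fun_prop : ContDiff ℝ n fun y : ℝ => (x, y, t)).contDiffOn fun _ _ => mem_strip ht)

/-- Continuity makes a function that vanishes outside `[a, b]` vanish at the endpoints as well. -/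
lemma eq_zero_of_notMem_Ioo {g : ℝ → ℝ} (hg : Continuous g) (h : ∀ x ∉ Icc a b, g x = 0) {x : ℝ}
    (hx : x ∉ Ioo a b) : g x = 0 := by
  have hl : EqOn g (fun _ => 0) (Iio a) := fun z hz => h z fun h => not_lt.2 h.1 hz
  have hr : EqOn g (fun _ => 0) (Ioi b) := fun z hz => h z fun h => not_lt.2 h.2 hz
  by_cases hxa : x ≤ a
  · exact hl.closure hg continuous_const (by rwa [closure_Iio])
  · refine hr.closure hg continuous_const ?_
    rw [closure_Ioi]
    exact not_lt.1 fun hxb => hx ⟨not_le.1 hxa, hxb⟩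

lemma zero_x (h : StripSmooth T (Icc a b ×ˢ Icc c d) n f) {x : ℝ} (hx : x ∉ Ioo a b) (y : ℝ)
    {t : ℝ} (ht : t ∈ Icc 0 T) : f (x, y, t) = 0 :=
  eq_zero_of_notMem_Ioo (g := fun x => f (x, y, t)) (h.contDiff_x y ht).continuous
    (fun _ hz => h.zero _ (mem_strip ht) fun hK => hz hK.1) hx

lemma zero_y (h : StripSmooth T (Icc a b ×ˢ Icc c d) n f) (x : ℝ) {y : ℝ} (hy : y ∉ Ioo c d)
    {t : ℝ} (ht : t ∈ Icc 0 T) : f (x, y, t) = 0 :=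
  eq_zero_of_notMem_Ioo (g := fun y => f (x, y, t)) (h.contDiff_y x ht).continuous
    (fun _ hz => h.zero _ (mem_strip ht) fun hK => hz hK.2) hy

lemma exists_isBump_x (hT : 0 < T) (h : StripSmooth T (Icc a b ×ˢ Icc c d) 7 f) :
    ∃ M, 0 ≤ M ∧ ∀ y, ∀ t ∈ Icc 0 T, IsBump a b M fun x => f (x, y, t) := by
  have hK : IsCompact (Icc a b ×ˢ Icc c d) := isCompact_Icc.prod isCompact_Icc
  obtain ⟨M, hM0, hM⟩ := h.exists_bound_iterate hT hK (1, 0, 0)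
  refine ⟨M, hM0, fun y t ht => ⟨h.contDiff_x y ht, fun x hx => h.zero_x hx y ht, fun j hj x => ?_⟩⟩
  rw [h.iteratedDeriv_x hT hK.isClosed y ht hj]
  exact hM j hj _ (mem_strip ht)

lemma exists_isBump_y (hT : 0 < T) (h : StripSmooth T (Icc a b ×ˢ Icc c d) 7 f) :
    ∃ M, 0 ≤ M ∧ ∀ x, ∀ t ∈ Icc 0 T, IsBump c d M fun y => f (x, y, t) := by
  have hK : IsCompact (Icc a b ×ˢ Icc c d) := isCompact_Icc.prod isCompact_Icc
  obtain ⟨M, hM0, hM⟩ := h.exists_bound_iterate hT hK (0, 1, 0)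
  refine ⟨M, hM0, fun x t ht => ⟨h.contDiff_y x ht, fun y hy => h.zero_y x hy ht, fun j hj y => ?_⟩⟩
  rw [h.iteratedDeriv_y hT hK.isClosed x ht hj]
  exact hM j hj _ (mem_strip ht)

end StripSmooth

namespace Data
variable {P : Data} {u : ℝ → ℝ → ℝ → ℝ}

/-- The zero extension as a function of one variable in `ℝ × ℝ × ℝ`. -/
def uncurriedExt (P : Data) (u : ℝ → ℝ → ℝ → ℝ) (p : ℝ × ℝ × ℝ) : ℝ := P.zeroExt u p.1 p.2.1 p.2.2

lemma isCompact_rect (P : Data) : IsCompact P.rect := isCompact_Icc.prod isCompact_Icc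

lemma IsSmooth.stripSmooth (h : P.IsSmooth u) : StripSmooth P.T P.rect 7 (P.uncurriedExt u) :=
  ⟨h, fun _ _ hp => if_neg hp⟩

lemma zeroExt_of_mem {x y : ℝ} (hx : x ∈ Icc P.xL P.xR) (hy : y ∈ Icc P.yL P.yR) (t : ℝ) :
    P.zeroExt u x y t = u x y t := if_pos ⟨hx, hy⟩

lemma dx_pos (P : Data) {m : ℕ} (hm : 0 < m) : 0 < P.dx m :=
  div_pos (sub_pos.2 P.hx) (by exact_mod_cast hm)

lemma dy_pos (P : Data) {m : ℕ} (hm : 0 < m) : 0 < P.dy m :=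
  div_pos (sub_pos.2 P.hy) (by exact_mod_cast hm)

lemma dt_pos (P : Data) {N : ℕ} (hN : 0 < N) : 0 < P.dt N :=
  div_pos P.hT (by exact_mod_cast hN)

lemma node_x_mem_iff (P : Data) {m : ℕ} (hm : 0 < m) {i : ℤ} :
    P.xL + i * P.dx m ∈ Ioo P.xL P.xR ↔ 0 < i ∧ i < m := by
  have hd := P.dx_pos hm
  have hm' : (0 : ℝ) < m := by exact_mod_cast hm
  have he : P.xR = P.xL + m * P.dx m := by rw [dx, mul_div_cancel₀ _ hm'.ne']; ring
  rw [mem_Ioo, lt_add_iff_pos_right, mul_pos_iff_of_pos_right hd, he, add_lt_add_iff_left,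
    mul_lt_mul_iff_left₀ hd]
  norm_cast

lemma node_y_mem_iff (P : Data) {m : ℕ} (hm : 0 < m) {j : ℤ} :
    P.yL + j * P.dy m ∈ Ioo P.yL P.yR ↔ 0 < j ∧ j < m := by
  have hd := P.dy_pos hm
  have hm' : (0 : ℝ) < m := by exact_mod_cast hm
  have he : P.yR = P.yL + m * P.dy m := by rw [dy, mul_div_cancel₀ _ hm'.ne']; ring
  rw [mem_Ioo, lt_add_iff_pos_right, mul_pos_iff_of_pos_right hd, he, add_lt_add_iff_left,
    mul_lt_mul_iff_left₀ hd]
  norm_cast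

lemma spatial_eq_zeroExt {x y : ℝ} (hx : x ∈ Ioo P.xL P.xR) (hy : y ∈ Ioo P.yL P.yR) (t : ℝ) :
    P.spatial (fun x' y' => u x' y' t) x y = P.spatial (fun x' y' => P.zeroExt u x' y' t) x y := by
  have h1 : EqOn (fun z => u z y t) (fun z => P.zeroExt u z y t) (Icc P.xL P.xR) :=
    fun z hz => (zeroExt_of_mem hz (Ioo_subset_Icc_self hy) t).symm
  have h2 : EqOn (fun z => u x z t) (fun z => P.zeroExt u x z t) (Icc P.yL P.yR) :=
    fun z hz => (zeroExt_of_mem (Ioo_subset_Icc_self hx) hz t).symm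
  simp only [spatial]
  rw [riesz_congr h1 hx, riesz_congr h1 hx, riesz_congr h2 hy, riesz_congr h2 hy]

/-- Grid values of the zero extension at time `t`. -/
def gridVal (P : Data) (u : ℝ → ℝ → ℝ → ℝ) (m₁ m₂ : ℕ) (t : ℝ) (i j : ℤ) : ℝ :=
  P.zeroExt u (P.xL + i * P.dx m₁) (P.yL + j * P.dy m₂) t

/-- The residual at a node and time `t` of the equation semi-discretized in space. -/
def residual (P : Data) (u : ℝ → ℝ → ℝ → ℝ) (m₁ m₂ : ℕ) (i j : ℤ) (t : ℝ) : ℝ :=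
  pd P.T (0, 0, 1) (P.uncurriedExt u) (P.xL + i * P.dx m₁, P.yL + j * P.dy m₂, t) +
    P.opX m₁ (P.gridVal u m₁ m₂ t) i j + P.opY m₂ (P.gridVal u m₁ m₂ t) i j -
    P.s (P.xL + i * P.dx m₁) (P.yL + j * P.dy m₂) t

/-- The discrete operators approximate minus the Riesz derivatives of the zero extension, uniformly
over the nodes and the times. -/
lemma exists_abs_op_add_spatial_le (h : P.IsSmooth u) :
    ∃ C, 0 ≤ C ∧ ∀ m₁ m₂ : ℕ, 0 < m₁ → 0 < m₂ → ∀ i j : ℤ, ∀ t ∈ Icc 0 P.T,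
      |P.opX m₁ (P.gridVal u m₁ m₂ t) i j + P.opY m₂ (P.gridVal u m₁ m₂ t) i j +
        P.spatial (fun x y => P.zeroExt u x y t) (P.xL + i * P.dx m₁) (P.yL + j * P.dy m₂)| ≤
        C * (P.dx m₁ ^ 4 + P.dy m₂ ^ 4) := by
  obtain ⟨Mx, hMx0, hMx⟩ := h.stripSmooth.exists_isBump_x P.hT
  obtain ⟨My, hMy0, hMy⟩ := h.stripSmooth.exists_isBump_y P.hT
  obtain ⟨Ca, ha0, ha⟩ := exists_abs_fracDiff_add_riesz_le P.hx (zero_lt_one.trans P.hα.1) P.hα.2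
    P.hα.1.ne'
  obtain ⟨Cb, hb0, hb⟩ := exists_abs_fracDiff_add_riesz_le P.hx P.hβ.1 (P.hβ.2.le.trans one_le_two)
    P.hβ.2.ne
  obtain ⟨Cm, hm0, hm⟩ := exists_abs_fracDiff_add_riesz_le P.hy (zero_lt_one.trans P.hμ.1) P.hμ.2
    P.hμ.1.ne'
  obtain ⟨Cn, hn0, hn⟩ := exists_abs_fracDiff_add_riesz_le P.hy P.hν.1 (P.hν.2.le.trans one_le_two)
    P.hν.2.ne
  have hdα := P.hdα.le
  have hdμ := P.hdμ.le
  have hcβ := P.hcβ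
  have hcν := P.hcν
  refine ⟨P.dα * (Ca * Mx) + P.cβ * (Cb * Mx) + (P.dμ * (Cm * My) + P.cν * (Cn * My)),
    by positivity, fun m₁ m₂ hm₁ hm₂ i j t ht => ?_⟩
  have ea := ha Mx _ (hMx (P.yL + j * P.dy m₂) t ht) m₁ hm₁ i
  have eb := hb Mx _ (hMx (P.yL + j * P.dy m₂) t ht) m₁ hm₁ i
  have em := hm My _ (hMy (P.xL + i * P.dx m₁) t ht) m₂ hm₂ j
  have en := hn My _ (hMy (P.xL + i * P.dx m₁) t ht) m₂ hm₂ j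
  replace ea := mul_le_mul_of_nonneg_left ea hdα
  replace eb := mul_le_mul_of_nonneg_left eb hcβ
  replace em := mul_le_mul_of_nonneg_left em hdμ
  replace en := mul_le_mul_of_nonneg_left en hcν
  rw [← abs_of_nonneg hdα, ← abs_mul, abs_of_nonneg hdα] at ea
  rw [← abs_of_nonneg hcβ, ← abs_mul, abs_of_nonneg hcβ] at eb
  rw [← abs_of_nonneg hdμ, ← abs_mul, abs_of_nonneg hdμ] at em
  rw [← abs_of_nonneg hcν, ← abs_mul, abs_of_nonneg hcν] at en
  have hxy : 0 ≤ (P.dα * (Ca * Mx) + P.cβ * (Cb * Mx)) * P.dy m₂ ^ 4 := by positivity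
  have hyx : 0 ≤ (P.dμ * (Cm * My) + P.cν * (Cn * My)) * P.dx m₁ ^ 4 := by positivity
  have key := (abs_add_le _ _).trans (add_le_add ((abs_add_le _ _).trans (add_le_add ea eb))
    ((abs_add_le _ _).trans (add_le_add em en)))
  change |P.dα * (fracDiff P.α (P.dx m₁) m₁ (fun l => P.gridVal u m₁ m₂ t l j) i +
      riesz P.α P.xL P.xR (fun z => P.zeroExt u z (P.yL + j * P.dy m₂) t) (P.xL + i * P.dx m₁)) +
    P.cβ * (fracDiff P.β (P.dx m₁) m₁ (fun l => P.gridVal u m₁ m₂ t l j) i +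
      riesz P.β P.xL P.xR (fun z => P.zeroExt u z (P.yL + j * P.dy m₂) t) (P.xL + i * P.dx m₁)) +
    (P.dμ * (fracDiff P.μ (P.dy m₂) m₂ (fun l => P.gridVal u m₁ m₂ t i l) j +
      riesz P.μ P.yL P.yR (fun z => P.zeroExt u (P.xL + i * P.dx m₁) z t) (P.yL + j * P.dy m₂)) +
    P.cν * (fracDiff P.ν (P.dy m₂) m₂ (fun l => P.gridVal u m₁ m₂ t i l) j +
      riesz P.ν P.yL P.yR (fun z => P.zeroExt u (P.xL + i * P.dx m₁) z t) (P.yL + j * P.dy m₂)))| ≤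
    P.dα * (Ca * Mx * P.dx m₁ ^ 4) + P.cβ * (Cb * Mx * P.dx m₁ ^ 4) +
    (P.dμ * (Cm * My * P.dy m₂ ^ 4) + P.cν * (Cn * My * P.dy m₂ ^ 4)) at key
  refine le_trans (le_of_eq ?_) (key.trans ?_)
  · simp only [opX, opY, spatial]
    congr 1
    ring
  · linarith

lemma continuousOn_residual
    (hs : ∀ x ∈ Ioo P.xL P.xR, ∀ y ∈ Ioo P.yL P.yR, ContinuousOn (fun t => P.s x y t) (Icc 0 P.T))
    (h : P.IsSmooth u) {m₁ m₂ : ℕ} {i j : ℤ} (hi : P.xL + i * P.dx m₁ ∈ Ioo P.xL P.xR)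
    (hj : P.yL + j * P.dy m₂ ∈ Ioo P.yL P.yR) :
    ContinuousOn (P.residual u m₁ m₂ i j) (Icc 0 P.T) := by
  have hD := (StripSmooth.pd P.hT P.isCompact_rect.isClosed h.stripSmooth (0, 0, 1)).continuousOn_t
    (P.xL + i * P.dx m₁) (P.yL + j * P.dy m₂)
  have hv : ∀ i j, ContinuousOn (fun t => P.gridVal u m₁ m₂ t i j) (Icc 0 P.T) := fun i j =>
    h.stripSmooth.continuousOn_t (P.xL + i * P.dx m₁) (P.yL + j * P.dy m₂)
  have hF : ∀ (γ δ : ℝ) (m : ℕ) (w : ℝ → ℤ → ℝ), (∀ l, ContinuousOn (fun t => w t l) (Icc 0 P.T)) →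
      ∀ i, ContinuousOn (fun t => fracDiff γ δ m (w t) i) (Icc 0 P.T) := fun γ δ m w hw i =>
    continuousOn_finsetSum _ fun r _ => continuousOn_const.mul <|
      continuousOn_finsetSum _ fun k _ => continuousOn_const.mul (hw _)
  have hX : ContinuousOn (fun t => P.opX m₁ (P.gridVal u m₁ m₂ t) i j) (Icc 0 P.T) :=
    (continuousOn_const.mul (hF _ _ _ _ (fun l => hv l j) i)).add
      (continuousOn_const.mul (hF _ _ _ _ (fun l => hv l j) i))
  have hY : ContinuousOn (fun t => P.opY m₂ (P.gridVal u m₁ m₂ t) i j) (Icc 0 P.T) :=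
    (continuousOn_const.mul (hF _ _ _ _ (fun l => hv i l) j)).add
      (continuousOn_const.mul (hF _ _ _ _ (fun l => hv i l) j))
  exact ((hD.add hX).add hY).sub (hs _ hi _ hj)

/-- At positive times the equation turns the residual into the spatial discretization error; the
bound extends to `t = 0`, where the equation is not assumed, by continuity of the residual. -/
lemma exists_abs_residual_le
    (hs : ∀ x ∈ Ioo P.xL P.xR, ∀ y ∈ Ioo P.yL P.yR, ContinuousOn (fun t => P.s x y t) (Icc 0 P.T))
    (hu : P.IsSolution u) (h : P.IsSmooth u) :
    ∃ C, 0 ≤ C ∧ ∀ m₁ m₂ : ℕ, 0 < m₁ → 0 < m₂ → ∀ i j : ℤ, 0 < i ∧ i < m₁ → 0 < j ∧ j < m₂ →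
      ∀ t ∈ Icc 0 P.T, |P.residual u m₁ m₂ i j t| ≤ C * (P.dx m₁ ^ 4 + P.dy m₂ ^ 4) := by
  obtain ⟨C, hC0, hC⟩ := exists_abs_op_add_spatial_le h
  refine ⟨C, hC0, fun m₁ m₂ hm₁ hm₂ i j hi hj => ?_⟩
  have hx := (P.node_x_mem_iff hm₁).2 hi
  have hy := (P.node_y_mem_iff hm₂).2 hj
  have hpos : ∀ t ∈ Ioc 0 P.T, |P.residual u m₁ m₂ i j t| ≤ C * (P.dx m₁ ^ 4 + P.dy m₂ ^ 4) := by
    intro t ht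
    have ht' : t ∈ Icc 0 P.T := Ioc_subset_Icc_self ht
    have h1 := hu.eqn _ hx _ hy t ht
    have h2 := h.stripSmooth.hasDerivWithinAt_t (P.xL + i * P.dx m₁) (P.yL + j * P.dy m₂) ht'
    have h3 : pd P.T (0, 0, 1) (P.uncurriedExt u) (P.xL + i * P.dx m₁, P.yL + j * P.dy m₂, t) =
        P.spatial (fun x' y' => P.zeroExt u x' y' t) (P.xL + i * P.dx m₁) (P.yL + j * P.dy m₂) +
          P.s (P.xL + i * P.dx m₁) (P.yL + j * P.dy m₂) t := by
      rw [← spatial_eq_zeroExt hx hy]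
      refine (uniqueDiffOn_Icc P.hT t ht').eq_deriv _ h2 (h1.congr_of_eventuallyEq ?_ ?_)
      · exact Eventually.of_forall fun τ =>
          zeroExt_of_mem (Ioo_subset_Icc_self hx) (Ioo_subset_Icc_self hy) τ
      · exact zeroExt_of_mem (Ioo_subset_Icc_self hx) (Ioo_subset_Icc_self hy) t
    refine le_trans (le_of_eq ?_) (hC m₁ m₂ hm₁ hm₂ i j t ht')
    rw [residual, h3]
    congr 1
    ring
  have hcl : closure (Ioc 0 P.T) = Icc 0 P.T := closure_Ioc P.hT.ne
  intro t ht
  have hcont := (continuousOn_residual hs h hx hy).abs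
  rw [← hcl] at hcont ht
  exact le_on_closure hpos hcont continuousOn_const ht

end Data

/-! ### The factorization term -/

lemma fracDiff_add (γ δ : ℝ) (m : ℕ) (v w : ℤ → ℝ) (i : ℤ) :
    fracDiff γ δ m (fun l => v l + w l) i = fracDiff γ δ m v i + fracDiff γ δ m w i := by
  simp only [fracDiff, mul_add, Finset.sum_add_distrib]

lemma fracDiff_mul (γ δ : ℝ) (m : ℕ) (c : ℝ) (v : ℤ → ℝ) (i : ℤ) :
    fracDiff γ δ m (fun l => c * v l) i = c * fracDiff γ δ m v i := by
  simp only [fracDiff, Finset.mul_sum]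
  exact Finset.sum_congr rfl fun r _ => Finset.sum_congr rfl fun k _ => by ring

lemma fracDiff_zero (γ δ : ℝ) (m : ℕ) (i : ℤ) : fracDiff γ δ m (fun _ => 0) i = 0 := by
  simp [fracDiff]

lemma fracDiff_sub (γ δ : ℝ) (m : ℕ) (v w : ℤ → ℝ) (i : ℤ) :
    fracDiff γ δ m (fun l => v l - w l) i = fracDiff γ δ m v i - fracDiff γ δ m w i := by
  simp only [fracDiff, mul_sub, Finset.sum_sub_distrib]

namespace Data
variable {P : Data} {u : ℝ → ℝ → ℝ → ℝ}

lemma opX_add_mul (P : Data) (m : ℕ) (c : ℝ) (v w : ℤ → ℤ → ℝ) (i j : ℤ) :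
    P.opX m (fun l p => v l p + c * w l p) i j = P.opX m v i j + c * P.opX m w i j := by
  simp only [opX, fracDiff_add, fracDiff_mul]
  ring

lemma opX_sub (P : Data) (m : ℕ) (v w : ℤ → ℤ → ℝ) (i j : ℤ) :
    P.opX m (fun l p => v l p - w l p) i j = P.opX m v i j - P.opX m w i j := by
  simp only [opX, fracDiff_sub]
  ring

lemma opY_sub (P : Data) (m : ℕ) (v w : ℤ → ℤ → ℝ) (i j : ℤ) :
    P.opY m (fun l p => v l p - w l p) i j = P.opY m v i j - P.opY m w i j := by
  simp only [opY, fracDiff_sub]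
  ring

lemma opY_second_difference (P : Data) (m : ℕ) (v : ℤ → ℤ → ℝ) (i j : ℤ) :
    P.opY m v (i - 1) j - 2 * P.opY m v i j + P.opY m v (i + 1) j =
      P.opY m (fun l p => v (l - 1) p - 2 * v l p + v (l + 1) p) i j := by
  simp only [opY, fracDiff_add, fracDiff_sub, fracDiff_mul]
  ring

lemma abs_opX_le (P : Data) {m : ℕ} (hm : 0 < m) {v : ℤ → ℤ → ℝ} {j : ℤ}
    (hv : ∀ l : ℤ, l ≤ 0 ∨ (m : ℤ) ≤ l → v l j = 0) {A : ℝ} (hA : ∀ l, |v l j| ≤ A)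
    (hB : ∀ l, |v (l - 1) j - 2 * v l j + v (l + 1) j| ≤ A * P.dx m ^ 2) (i : ℤ) :
    |P.opX m v i j| ≤ 80 * (P.dα + P.cβ) * A := by
  have hd := P.dx_pos hm
  have hF : ∀ γ, 0 < γ → γ ≤ 2 → |fracDiff γ (P.dx m) m (fun l => v l j) i| ≤ 80 * A := by
    intro γ h0 h2
    refine (abs_fracDiff_le h0 h2 hd hv hA hB i).trans_eq ?_
    rw [mul_div_cancel_right₀ _ (by positivity)]
    ring
  have h1 := mul_le_mul_of_nonneg_left (hF P.α (zero_lt_one.trans P.hα.1) P.hα.2) P.hdα.le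
  have h2 := mul_le_mul_of_nonneg_left (hF P.β P.hβ.1 (P.hβ.2.le.trans one_le_two)) P.hcβ
  refine (abs_add_le _ _).trans ?_
  rw [abs_mul, abs_mul, abs_of_pos P.hdα, abs_of_nonneg P.hcβ]
  linarith

lemma abs_opY_le (P : Data) {m : ℕ} (hm : 0 < m) {v : ℤ → ℤ → ℝ} {i : ℤ}
    (hv : ∀ l : ℤ, l ≤ 0 ∨ (m : ℤ) ≤ l → v i l = 0) {A : ℝ} (hA : ∀ l, |v i l| ≤ A)
    (hB : ∀ l, |v i (l - 1) - 2 * v i l + v i (l + 1)| ≤ A * P.dy m ^ 2) (j : ℤ) :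
    |P.opY m v i j| ≤ 80 * (P.dμ + P.cν) * A := by
  have hd := P.dy_pos hm
  have hF : ∀ γ, 0 < γ → γ ≤ 2 → |fracDiff γ (P.dy m) m (fun l => v i l) j| ≤ 80 * A := by
    intro γ h0 h2
    refine (abs_fracDiff_le h0 h2 hd hv hA hB j).trans_eq ?_
    rw [mul_div_cancel_right₀ _ (by positivity)]
    ring
  have h1 := mul_le_mul_of_nonneg_left (hF P.μ (zero_lt_one.trans P.hμ.1) P.hμ.2) P.hdμ.le
  have h2 := mul_le_mul_of_nonneg_left (hF P.ν P.hν.1 (P.hν.2.le.trans one_le_two)) P.hcν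
  refine (abs_add_le _ _).trans ?_
  rw [abs_mul, abs_mul, abs_of_pos P.hdμ, abs_of_nonneg P.hcν]
  linarith

/-- The composition of the two discrete operators is bounded, uniformly in the mesh, by the
difference quotients of order two in each variable. -/
lemma abs_opX_opY_le (P : Data) {m₁ m₂ : ℕ} (hm₁ : 0 < m₁) (hm₂ : 0 < m₂) {v : ℤ → ℤ → ℝ}
    (hx : ∀ l p : ℤ, l ≤ 0 ∨ (m₁ : ℤ) ≤ l → v l p = 0)
    (hy : ∀ l p : ℤ, p ≤ 0 ∨ (m₂ : ℤ) ≤ p → v l p = 0) {A : ℝ} (hA : ∀ l p, |v l p| ≤ A)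
    (hAx : ∀ l p, |v (l - 1) p - 2 * v l p + v (l + 1) p| ≤ A * P.dx m₁ ^ 2)
    (hAy : ∀ l p, |v l (p - 1) - 2 * v l p + v l (p + 1)| ≤ A * P.dy m₂ ^ 2)
    (hAxy : ∀ l p, |(v (l - 1) (p - 1) - 2 * v (l - 1) p + v (l - 1) (p + 1)) -
      2 * (v l (p - 1) - 2 * v l p + v l (p + 1)) +
      (v (l + 1) (p - 1) - 2 * v (l + 1) p + v (l + 1) (p + 1))| ≤
        A * P.dx m₁ ^ 2 * P.dy m₂ ^ 2) (i j : ℤ) :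
    |P.opX m₁ (P.opY m₂ v) i j| ≤ 80 * (P.dα + P.cβ) * (80 * (P.dμ + P.cν) * A) := by
  refine P.abs_opX_le hm₁ (fun l hl => ?_) (fun l => ?_) (fun l => ?_) i
  · have : (fun p => v l p) = fun _ => 0 := funext fun p => hx l p hl
    simp only [opY, this, fracDiff_zero, mul_zero, add_zero]
  · exact P.abs_opY_le hm₂ (hy l) (hA l) (hAy l) j
  · rw [opY_second_difference]
    refine (P.abs_opY_le hm₂ (A := A * P.dx m₁ ^ 2) (fun p hp => ?_) (hAx l) (fun p => ?_)
      j).trans_eq (by ring)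
    · simp only [hy _ p hp]; norm_num
    · refine le_trans (le_of_eq ?_) (hAxy l p)
      congr 1
      ring

lemma exists_abs_opX_opY_diff_le (h : P.IsSmooth u) :
    ∃ C, 0 ≤ C ∧ ∀ m₁ m₂ : ℕ, 0 < m₁ → 0 < m₂ → ∀ s ∈ Icc 0 P.T, ∀ t ∈ Icc 0 P.T, ∀ i j : ℤ,
      |P.opX m₁ (P.opY m₂ (P.gridVal u m₁ m₂ s)) i j -
        P.opX m₁ (P.opY m₂ (P.gridVal u m₁ m₂ t)) i j| ≤ C * |s - t| := by
  have hf := h.stripSmooth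
  have hK := P.isCompact_rect
  obtain ⟨A0, h00, h0⟩ := (hf.of_le (by norm_num : 1 ≤ 7)).exists_diff_t_le P.hT hK
  obtain ⟨A1, h10, h1⟩ := (hf.of_le (by norm_num : 3 ≤ 7)).exists_diff_tx_le P.hT hK
  obtain ⟨A2, h20, h2⟩ := (hf.of_le (by norm_num : 3 ≤ 7)).exists_diff_ty_le P.hT hK
  obtain ⟨A3, h30, h3⟩ := (hf.of_le (by norm_num : 5 ≤ 7)).exists_diff_txy_le P.hT hK
  have hdα := P.hdα.le
  have hdμ := P.hdμ.le
  have hcβ := P.hcβ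
  have hcν := P.hcν
  refine ⟨80 * (P.dα + P.cβ) * (80 * (P.dμ + P.cν) * (A0 + A1 + A2 + A3)), by positivity,
    fun m₁ m₂ hm₁ hm₂ s hs t ht i j => ?_⟩
  have hdx := P.dx_pos hm₁
  have hdy := P.dy_pos hm₂
  have hZ : ∀ l p r, r ∈ Icc 0 P.T → (l ≤ 0 ∨ (m₁ : ℤ) ≤ l) ∨ (p ≤ 0 ∨ (m₂ : ℤ) ≤ p) →
      P.gridVal u m₁ m₂ r l p = 0 := by
    rintro l p r hr (hl | hp)
    · exact hf.zero_x (fun hx => by have := (P.node_x_mem_iff hm₁).1 hx; omega) _ hr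
    · exact hf.zero_y _ (fun hy => by have := (P.node_y_mem_iff hm₂).1 hy; omega) hr
  have hxm : ∀ l : ℤ, P.xL + ((l - 1 : ℤ) : ℝ) * P.dx m₁ = P.xL + l * P.dx m₁ - P.dx m₁ :=
    fun l => by push_cast; ring
  have hxp : ∀ l : ℤ, P.xL + ((l + 1 : ℤ) : ℝ) * P.dx m₁ = P.xL + l * P.dx m₁ + P.dx m₁ :=
    fun l => by push_cast; ring
  have hym : ∀ l : ℤ, P.yL + ((l - 1 : ℤ) : ℝ) * P.dy m₂ = P.yL + l * P.dy m₂ - P.dy m₂ :=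
    fun l => by push_cast; ring
  have hyp : ∀ l : ℤ, P.yL + ((l + 1 : ℤ) : ℝ) * P.dy m₂ = P.yL + l * P.dy m₂ + P.dy m₂ :=
    fun l => by push_cast; ring
  have hst := abs_nonneg (s - t)
  rw [← opX_sub, ← funext₂ (P.opY_sub m₂ (P.gridVal u m₁ m₂ s) (P.gridVal u m₁ m₂ t))]
  refine (P.abs_opX_opY_le hm₁ hm₂ (A := (A0 + A1 + A2 + A3) * |s - t|) (fun l p hl => ?_)
    (fun l p hp => ?_) (fun l p => ?_) (fun l p => ?_) (fun l p => ?_) (fun l p => ?_) i j).trans_eq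
    (by ring)
  · simp only [hZ l p _ hs (.inl hl), hZ l p _ ht (.inl hl), sub_self]
  · simp only [hZ l p _ hs (.inr hp), hZ l p _ ht (.inr hp), sub_self]
  · refine (h0 (P.xL + l * P.dx m₁) (P.yL + p * P.dy m₂) s hs t ht).trans ?_
    gcongr; linarith
  · have := h1 (P.xL + l * P.dx m₁) (P.yL + p * P.dy m₂) s hs t ht (P.dx m₁) hdx.le
    simp only [gridVal, hxm, hxp]
    refine this.trans ?_
    gcongr; linarith
  · have := h2 (P.xL + l * P.dx m₁) (P.yL + p * P.dy m₂) s hs t ht (P.dy m₂) hdy.le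
    simp only [gridVal, hym, hyp]
    refine this.trans ?_
    gcongr; linarith
  · have := h3 (P.xL + l * P.dx m₁) (P.yL + p * P.dy m₂) s hs t ht (P.dx m₁) (P.dy m₂) hdx.le hdy.le
    simp only [gridVal, hxm, hxp, hym, hyp]
    refine this.trans ?_
    gcongr; linarith

/-! ### The truncation error -/

/-- The truncation error splits into the trapezoidal rule error in time, the mean of the
semi-discrete residuals at the two time levels, and the term produced by the factorization. -/
lemma truncationError_eq (P : Data) (u : ℝ → ℝ → ℝ → ℝ) {m₁ m₂ N : ℕ} (hN : 0 < N) (n : ℕ)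
    (i j : ℤ) {s t : ℝ} (hs : s = (n + 1 : ℕ) * P.dt N) (ht : t = n * P.dt N) :
    P.truncationError u m₁ m₂ N n i j =
      (P.gridVal u m₁ m₂ s i j - P.gridVal u m₁ m₂ t i j - (s - t) *
        ((pd P.T (0, 0, 1) (P.uncurriedExt u) (P.xL + i * P.dx m₁, P.yL + j * P.dy m₂, s) +
          pd P.T (0, 0, 1) (P.uncurriedExt u) (P.xL + i * P.dx m₁, P.yL + j * P.dy m₂, t)) / 2)) /
        P.dt N +
      (P.residual u m₁ m₂ i j s + P.residual u m₁ m₂ i j t) / 2 +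
      P.dt N / 4 * (P.opX m₁ (P.opY m₂ (P.gridVal u m₁ m₂ s)) i j -
        P.opX m₁ (P.opY m₂ (P.gridVal u m₁ m₂ t)) i j) := by
  have hd := (P.dt_pos hN).ne'
  have hst : s - t = P.dt N := by rw [hs, ht]; push_cast; ring
  have hF : ∀ c v, P.factorX m₁ c (P.factorY m₂ c v) i j =
      v i j + c * P.opY m₂ v i j + c * (P.opX m₁ v i j + c * P.opX m₁ (P.opY m₂ v) i j) :=
    fun c v => by rw [← opX_add_mul]; rfl
  have hUs : P.sample m₁ m₂ N (P.zeroExt u) (n + 1) = P.gridVal u m₁ m₂ s := by subst hs; rfl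
  have hUt : P.sample m₁ m₂ N (P.zeroExt u) n = P.gridVal u m₁ m₂ t := by subst ht; rfl
  simp only [truncationError, hF, hUs, hUt, residual, sample, ← hs, ← ht, hst]
  field_simp
  ring

theorem truncationOrder
    (hs : ∀ x ∈ Ioo P.xL P.xR, ∀ y ∈ Ioo P.yL P.yR, ContinuousOn (fun t => P.s x y t) (Icc 0 P.T))
    (hu : P.IsSolution u) (h : P.IsSmooth u) : P.TruncationOrder u := by
  obtain ⟨C1, h10, h1⟩ := exists_abs_residual_le hs hu h
  obtain ⟨C2, h20, h2⟩ := exists_abs_opX_opY_diff_le h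
  obtain ⟨C3, h30, h3⟩ := (h.stripSmooth.of_le (by norm_num : 3 ≤ 7)).exists_trapezoid_le P.hT
    P.isCompact_rect
  refine ⟨C1 + C2 + C3, fun m₁ m₂ N hm₁ hm₂ hN n i j ⟨hn, hi0, hi, hj0, hj⟩ => ?_⟩
  have hd := P.dt_pos hN
  have hT : N * P.dt N = P.T := by
    have : (N : ℝ) ≠ 0 := by exact_mod_cast hN.ne'
    rw [dt, mul_div_cancel₀ _ this]
  have hmem : ∀ k : ℕ, k ≤ N → (k : ℝ) * P.dt N ∈ Icc 0 P.T := fun k hk =>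
    ⟨by positivity, by rw [← hT]; gcongr⟩
  obtain ⟨s, hs'⟩ : ∃ s, s = ((n + 1 : ℕ) : ℝ) * P.dt N := ⟨_, rfl⟩
  obtain ⟨t, ht'⟩ : ∃ t, t = (n : ℝ) * P.dt N := ⟨_, rfl⟩
  have hsT : s ∈ Icc 0 P.T := hs' ▸ hmem _ hn
  have htT : t ∈ Icc 0 P.T := ht' ▸ hmem _ hn.le
  have hst : s - t = P.dt N := by rw [hs', ht']; push_cast; ring
  have e1 := h1 m₁ m₂ hm₁ hm₂ i j ⟨hi0, hi⟩ ⟨hj0, hj⟩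
  have e2 := h2 m₁ m₂ hm₁ hm₂ s hsT t htT i j
  have e3 := h3 (P.xL + i * P.dx m₁) (P.yL + j * P.dy m₂) s hsT t htT (by linarith)
  rw [hst, abs_of_pos hd] at e2
  rw [truncationError_eq P u hN n i j hs' ht']
  have b1 : |(P.residual u m₁ m₂ i j s + P.residual u m₁ m₂ i j t) / 2| ≤
      C1 * (P.dx m₁ ^ 4 + P.dy m₂ ^ 4) := by
    rw [abs_div, abs_two]
    linarith [abs_add_le (P.residual u m₁ m₂ i j s) (P.residual u m₁ m₂ i j t), e1 s hsT, e1 t htT]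
  have b2 : |P.dt N / 4 * (P.opX m₁ (P.opY m₂ (P.gridVal u m₁ m₂ s)) i j -
        P.opX m₁ (P.opY m₂ (P.gridVal u m₁ m₂ t)) i j)| ≤ C2 * P.dt N ^ 2 := by
    rw [abs_mul, abs_of_pos (by positivity : 0 < P.dt N / 4)]
    have := mul_le_mul_of_nonneg_left e2 (by positivity : 0 ≤ P.dt N / 4)
    nlinarith [mul_nonneg h20 (sq_nonneg (P.dt N))]
  have b3 := (div_le_iff₀ hd).2 (e3.trans_eq
    (by rw [hst]; ring : C3 * (s - t) ^ 3 = C3 * P.dt N ^ 2 * P.dt N))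
  rw [← abs_of_pos hd, ← abs_div, abs_of_pos hd] at b3
  refine (abs_add_three _ _ _).trans ((add_le_add (add_le_add b3 b1) b2).trans ?_)
  have p1 : 0 ≤ P.dx m₁ ^ 4 + P.dy m₂ ^ 4 := by positivity
  nlinarith [mul_nonneg h20 p1, mul_nonneg h30 p1, mul_nonneg h10 (sq_nonneg (P.dt N))]

lemma TruncationOrder.consistent (h : P.TruncationOrder u) : P.Consistent u := by
  obtain ⟨C, hC⟩ := h
  intro ε hε
  refine ⟨min 1 (ε / (3 * (|C| + 1))), by positivity,
    fun m₁ m₂ N hm₁ hm₂ hN hx hy ht n i j hn => ?_⟩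
  have key : ∀ d : ℝ, 0 < d → d < min 1 (ε / (3 * (|C| + 1))) → ∀ k : ℕ, k ≠ 0 →
      d ^ k < ε / (3 * (|C| + 1)) := fun d hd hd' k hk =>
    (pow_le_of_le_one hd.le (hd'.le.trans (min_le_left _ _)) hk).trans_lt
      (hd'.trans_le (min_le_right _ _))
  have k1 := key _ (P.dx_pos hm₁) hx 4 (by norm_num)
  have k2 := key _ (P.dy_pos hm₂) hy 4 (by norm_num)
  have k3 := key _ (P.dt_pos hN) ht 2 (by norm_num)
  have hsum : P.dx m₁ ^ 4 + P.dy m₂ ^ 4 + P.dt N ^ 2 < ε / (|C| + 1) := by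
    refine (add_lt_add (add_lt_add k1 k2) k3).trans_eq ?_
    field_simp
    norm_num
  have h0 : 0 ≤ P.dx m₁ ^ 4 + P.dy m₂ ^ 4 + P.dt N ^ 2 := by
    have := P.dx_pos hm₁
    have := P.dy_pos hm₂
    positivity
  calc _ ≤ C * (P.dx m₁ ^ 4 + P.dy m₂ ^ 4 + P.dt N ^ 2) := hC m₁ m₂ N hm₁ hm₂ hN n i j hn
    _ ≤ (|C| + 1) * (P.dx m₁ ^ 4 + P.dy m₂ ^ 4 + P.dt N ^ 2) :=
      mul_le_mul_of_nonneg_right (by linarith [le_abs_self C]) h0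
    _ < (|C| + 1) * (ε / (|C| + 1)) := mul_lt_mul_of_pos_left hsum (by positivity)
    _ = ε := by field_simp

end Data

end RSFADE

end

theorem mainTheorem3 (P : RSFADE.Data) (u : ℝ → ℝ → ℝ → ℝ)
    (hs : ∀ x ∈ Set.Ioo P.xL P.xR, ∀ y ∈ Set.Ioo P.yL P.yR,
      ContinuousOn (fun t => P.s x y t) (Set.Icc 0 P.T))
    (hu : P.IsSolution u) (hsmooth : P.IsSmooth u) :
    P.Consistent u ∧ P.TruncationOrder u :=
  have h := RSFADE.Data.truncationOrder hs hu hsmooth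
  ⟨h.consistent, h⟩
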